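/- **Setting.** Let $(X,Y)\in\mathbb R^p\times\mathbb R$ with $E X=0$, $E\|X\|^2<\infty$, $\Sigma=\mathrm{Var}(X)$, and let $(x_i,y_i)_{i\ge1}$ be i.i.d. copies of $(X,Y)$. Let $g:\mathbb R^p\times\mathbb R^d\to\mathbb R$ and $\Theta\subset\mathbb R^d$ be given. The null hypothesis $H_0$ is: there is $\theta_0\in\Theta$ such that $Y=g(X,\theta_0)+\varepsilon$ with $\varepsilon$ independent of $X$ and $E\varepsilon=0$. The alternative hypothesis $H_1$ is: for no $\theta\in\Theta$ is $Y-g(X,\theta)$ independent of $X$. **Central subspace, dimension, target matrix.** Let $\theta^*$ be the minimizer of $E\{Y-g(X,\theta)\}^2$ over $\Theta$ and $\eta=Y-g(X,\theta^*)$. A dimension reduction subspace is the column space of a matrix $B$ such that $\eta$ and $X$ are conditionally independent given $B^\top X$. The central subspace $S_{\eta|X}$ is the intersection of all dimension reduction subspaces, and $q=\dim S_{\eta|X}$. Put $m(t)=E[X e^{it\eta}]$ and $M=\int m(t)m(t)^H\,dF_\eta(t)$, where $F_\eta$ is the law of $\eta$. **Estimator.** For every $n$ let $\hat\theta_n$ be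 a (measurable) minimizer of $\sum_{j=1}^n\{y_j-g(x_j,\theta)\}^2$ over $\Theta$. Put $\hat\eta_j=y_j-g(x_j,\hat\theta_n)$, $\hat m_n(t)=\frac1n\sum_{j=1}^n x_je^{it\hat\eta_j}$, $\hat M_n=\frac1n\sum_{j=1}^n\hat m_n(\hat\eta_j)\hat m_n(\hat\eta_j)^H$. Let $\hat\lambda_1\ge\dots\ge\hat\lambda_p\ge0$ be the eigenvalues of $\hat M_n$, let $\hat\lambda_{p+1}=\hat\lambda_{p+2}=0$, and put $$\hat s_j=\frac{\hat\lambda_j}{\hat\lambda_j+1},\qquad \hat s_j^*=\frac{\hat s_j^2+c_{1n}}{\hat s_{j+1}^2+c_{1n}}-1,\qquad \hat r_j=\frac{\hat s_{j+1}^*+c_{2n}}{\hat s_j^*+c_{2n}}.$$ The ridges $c_{1n},c_{2n}$ are real numbers that are positive for all large $n$. For a fixed threshold $\tau\in(0,1)$ let $\hat q$ be the largest $j\in\{1,\dots,p\}$ with $\hat r_j\le\tau$, and $\hat q=0$ if there is no such $j$. **Regularity conditions.** - $EY^2<\infty$; $\Theta$ is compact and convex. - $g(\cdot,\theta)$ is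 Borel for every $\theta$, and for every $x$ the function $g(x,\cdot)$ is twice continuously differentiable near every point of $\Theta$; $\dot g$ and $\ddot g$ denote its gradient and Hessian in $\theta$. - $E\sup_{\theta\in\Theta} g^2(X,\theta)$, $E\sup_{\theta\in\Theta}\|\dot g\dot g^\top\|$, $E\sup_{\theta\in\Theta}\|(Y-g)^2\dot g\dot g^\top\|$ and $E\sup_{\theta\in\Theta}\|(Y-g)^2\ddot g\|$ are finite. - The minimizer $\theta^*$ exists and is unique; under $H_0$ it is an interior point of $\Theta$. - $E\{\dot g(X,\theta^*)\dot g(X,\theta^*)^\top\}$ is nonsingular. - Linearity: for every matrix $B$ whose columns form a basis of $S_{\eta|X}$, $E(X\mid B^\top X)=P_B(\Sigma)^\top X$ a.s., where $P_B(\Sigma)=B(B^\top\Sigma B)^{-1}B^\top\Sigma$. **Theorem.** Assume the regularity conditions, and $c_{1n}\to0$, $c_{2n}\to0$. 1. If $H_0$ holds and $n^2c_{1n}c_{2n}\to\infty$, then $P(\hat q=0)\to1$. 2. Let $H_1$ hold and $nc_{1n}c_{2n}\to\infty$. Suppose also that $S_{\eta|X}$ is itself a dimension reduction subspace, that $\mathrm{rank}(M)\ge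 q$ (so that, by linearity, $\mathrm{rank}(M)=q$), and that the minimizer $\theta^*$ is nondegenerate: there is $c>0$ with $E\{Y-g(X,\theta)\}^2\ge E\{Y-g(X,\theta^*)\}^2+c\|\theta-\theta^*\|^2$ for all $\theta\in\Theta$. Then $P(\hat q=q>0)\to1$. -/

import Mathlib

open MeasureTheory ProbabilityTheory Filter Topology
open scoped ENNReal

noncomputable section

namespace HybridTest

/-! ### Population quantities

`P` is the joint law of `(X, Y)`, a probability measure on `ℝᵖ × ℝ`, so `X` is the first and `Y`
the second coordinate. -/

/-- The residual `Y - g(X, θ)`. -/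
def residual {p d : ℕ} (g : EuclideanSpace ℝ (Fin p) → EuclideanSpace ℝ (Fin d) → ℝ)
    (θ : EuclideanSpace ℝ (Fin d)) (z : EuclideanSpace ℝ (Fin p) × ℝ) : ℝ :=
  z.2 - g z.1 θ

/-- The population least squares criterion `E{Y - g(X, θ)}²`. -/
def risk {p d : ℕ} (P : Measure (EuclideanSpace ℝ (Fin p) × ℝ))
    (g : EuclideanSpace ℝ (Fin p) → EuclideanSpace ℝ (Fin d) → ℝ)
    (θ : EuclideanSpace ℝ (Fin d)) : ℝ :=
  ∫ z, residual g θ z ^ 2 ∂P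

/-- The null hypothesis: `Y = g(X, θ₀) + ε` for some `θ₀ ∈ Θ`, where the error `ε` is independent
of `X` and centred. -/
def NullHypothesis {p d : ℕ} (P : Measure (EuclideanSpace ℝ (Fin p) × ℝ))
    (g : EuclideanSpace ℝ (Fin p) → EuclideanSpace ℝ (Fin d) → ℝ)
    (Θ : Set (EuclideanSpace ℝ (Fin d))) : Prop :=
  ∃ θ₀ ∈ Θ, IndepFun Prod.fst (residual g θ₀) P ∧ ∫ z, residual g θ₀ z ∂P = 0

/-- The alternative hypothesis: for no `θ ∈ Θ` is `Y = g(X, θ) + ε` with an error `ε` that is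
independent of `X`. -/
def AlternativeHypothesis {p d : ℕ} (P : Measure (EuclideanSpace ℝ (Fin p) × ℝ))
    (g : EuclideanSpace ℝ (Fin p) → EuclideanSpace ℝ (Fin d) → ℝ)
    (Θ : Set (EuclideanSpace ℝ (Fin d))) : Prop :=
  ∀ θ ∈ Θ, ¬ IndepFun Prod.fst (residual g θ) P

/-- The covariance matrix `Σ` of `X`. -/
def covX {p : ℕ} (P : Measure (EuclideanSpace ℝ (Fin p) × ℝ)) : Matrix (Fin p) (Fin p) ℝ :=
  Matrix.of fun i j => cov[fun z => z.1 i, fun z => z.1 j; P]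

/-! ### The central subspace -/

/-- The linear map `(x, y) ↦ Bᵀ x`, as a function on the sample space `ℝᵖ × ℝ`. -/
def reduce {p q : ℕ} (B : Matrix (Fin p) (Fin q) ℝ) (z : EuclideanSpace ℝ (Fin p) × ℝ) :
    Fin q → ℝ :=
  B.transpose.mulVec z.1.ofLp

lemma measurable_reduce {p q : ℕ} (B : Matrix (Fin p) (Fin q) ℝ) : Measurable (reduce B) := by
  have h : Continuous (reduce B) := by
    unfold reduce
    fun_prop
  exact h.measurable

/-- The column space `Span{B}`. -/
def colSpan {p q : ℕ} (B : Matrix (Fin p) (Fin q) ℝ) : Submodule ℝ (Fin p → ℝ) :=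
  Submodule.span ℝ (Set.range B.transpose)

/-- `S = Span{B}` for some matrix `B` such that `η` and `X` are conditionally independent
given `Bᵀ X`. -/
def IsDimensionReductionSubspace {p : ℕ} (P : Measure (EuclideanSpace ℝ (Fin p) × ℝ))
    [IsProbabilityMeasure P] (η : EuclideanSpace ℝ (Fin p) × ℝ → ℝ)
    (S : Submodule ℝ (Fin p → ℝ)) : Prop :=
  ∃ (q : ℕ) (B : Matrix (Fin p) (Fin q) ℝ), colSpan B = S ∧
    CondIndepFun (MeasurableSpace.comap (reduce B) inferInstance) (measurable_reduce B).comap_le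
      η Prod.fst P

/-- The central subspace `S_{η|X}`: the intersection of all dimension reduction subspaces. -/
def centralSubspace {p : ℕ} (P : Measure (EuclideanSpace ℝ (Fin p) × ℝ))
    [IsProbabilityMeasure P] (η : EuclideanSpace ℝ (Fin p) × ℝ → ℝ) :
    Submodule ℝ (Fin p → ℝ) :=
  sInf {S | IsDimensionReductionSubspace P η S}

/-- The indicative dimension `q = dim S_{η|X}`. -/
def indicativeDim {p : ℕ} (P : Measure (EuclideanSpace ℝ (Fin p) × ℝ))
    [IsProbabilityMeasure P] (η : EuclideanSpace ℝ (Fin p) × ℝ → ℝ) : ℕ :=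
  Module.finrank ℝ (centralSubspace P η)

/-- `P_B(Σ) = B (Bᵀ Σ B)⁻¹ Bᵀ Σ`. -/
def projMatrix {p q : ℕ} (B : Matrix (Fin p) (Fin q) ℝ) (Sig : Matrix (Fin p) (Fin p) ℝ) :
    Matrix (Fin p) (Fin p) ℝ :=
  B * (B.transpose * Sig * B)⁻¹ * B.transpose * Sig

/-- The linearity condition: `E(X | Bᵀ X) = P_B(Σ)ᵀ X` almost surely, for every matrix `B` whose
columns form a basis of the central subspace. -/
def LinearityCondition {p : ℕ} (P : Measure (EuclideanSpace ℝ (Fin p) × ℝ))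
    [IsProbabilityMeasure P] (η : EuclideanSpace ℝ (Fin p) × ℝ → ℝ) : Prop :=
  ∀ (q : ℕ) (B : Matrix (Fin p) (Fin q) ℝ), LinearIndependent ℝ B.transpose →
    colSpan B = centralSubspace P η → ∀ i : Fin p,
      P[fun z => z.1 i | MeasurableSpace.comap (reduce B) inferInstance]
        =ᵐ[P] fun z => ((projMatrix B (covX P)).transpose.mulVec z.1.ofLp) i

/-! ### The target matrix -/

/-- `m(t) = E[X exp(i t η)]`. -/
def targetVector {p : ℕ} (P : Measure (EuclideanSpace ℝ (Fin p) × ℝ))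
    (η : EuclideanSpace ℝ (Fin p) × ℝ → ℝ) (t : ℝ) : Fin p → ℂ :=
  fun k => ∫ z, (z.1 k : ℂ) * Complex.exp (Complex.I * t * η z) ∂P

/-- The target matrix `M = ∫ m(t) m(t)ᴴ dF_η(t)`. -/
def targetMatrix {p : ℕ} (P : Measure (EuclideanSpace ℝ (Fin p) × ℝ))
    (η : EuclideanSpace ℝ (Fin p) × ℝ → ℝ) : Matrix (Fin p) (Fin p) ℂ :=
  Matrix.of fun k l =>
    ∫ t, targetVector P η t k * starRingEnd ℂ (targetVector P η t l) ∂(P.map η)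

/-! ### Regularity conditions -/

/-- The standing assumptions on the law `P` of `(X, Y)`, the regression function `g`, the parameter
space `Θ` and the population least squares parameter `θs`. The Frobenius norm of `v vᵀ`
is `‖v‖²`, which is how the norms of the outer products of the gradient are written. -/
structure RegularityConditions {p d : ℕ} (P : Measure (EuclideanSpace ℝ (Fin p) × ℝ))
    [IsProbabilityMeasure P]
    (g : EuclideanSpace ℝ (Fin p) → EuclideanSpace ℝ (Fin d) → ℝ)
    (Θ : Set (EuclideanSpace ℝ (Fin d))) (θs : EuclideanSpace ℝ (Fin d)) : Prop where
  /-- `E Y² < ∞`. -/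
  memLp_Y : MemLp (fun z => z.2) 2 P
  /-- `E ‖X‖² < ∞`, so that `Σ = Var(X)` exists. -/
  memLp_X : MemLp (fun z => z.1) 2 P
  /-- `E X = 0`. -/
  mean_X : ∫ z, z.1 ∂P = 0
  compact : IsCompact Θ
  convex : Convex ℝ Θ
  measurable_g : ∀ θ, Measurable fun x => g x θ
  contDiff_g : ∀ x, ∀ θ ∈ Θ, ContDiffAt ℝ 2 (g x) θ
  /-- `E sup_θ g² < ∞`. -/
  moment_g : ∫⁻ z, ⨆ θ ∈ Θ, ENNReal.ofReal (g z.1 θ ^ 2) ∂P < ∞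
  /-- `E sup_θ ‖ġ ġᵀ‖ < ∞`. -/
  moment_grad : ∫⁻ z, ⨆ θ ∈ Θ, ENNReal.ofReal (‖gradient (g z.1) θ‖ ^ 2) ∂P < ∞
  /-- `E sup_θ ‖(Y - g)² ġ ġᵀ‖ < ∞`. -/
  moment_residual_grad :
    ∫⁻ z, ⨆ θ ∈ Θ, ENNReal.ofReal (residual g θ z ^ 2 * ‖gradient (g z.1) θ‖ ^ 2) ∂P < ∞
  /-- `E sup_θ ‖(Y - g)² g̈‖ < ∞`. -/
  moment_residual_hess :
    ∫⁻ z, ⨆ θ ∈ Θ, ENNReal.ofReal (residual g θ z ^ 2 * ‖iteratedFDeriv ℝ 2 (g z.1) θ‖) ∂P < ∞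
  /-- `θs` is the unique minimizer of `E{Y - g(X, θ)}²` over `Θ`. -/
  mem_Θ : θs ∈ Θ
  unique_min : ∀ θ ∈ Θ, θ ≠ θs → risk P g θs < risk P g θ
  interior_of_null : NullHypothesis P g Θ → θs ∈ interior Θ
  /-- `E{ġ(X, θs) ġ(X, θs)ᵀ}` is nonsingular. -/
  nonsingular : IsUnit (Matrix.det (Matrix.of fun i j : Fin d =>
    ∫ z, gradient (g z.1) θs i * gradient (g z.1) θs j ∂P))
  linearity : LinearityCondition P (residual g θs)

/-- The minimizer `θs` of the population least squares criterion is nondegenerate: the criterion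
grows at least quadratically away from it. -/
def NondegenerateMin {p d : ℕ} (P : Measure (EuclideanSpace ℝ (Fin p) × ℝ))
    (g : EuclideanSpace ℝ (Fin p) → EuclideanSpace ℝ (Fin d) → ℝ)
    (Θ : Set (EuclideanSpace ℝ (Fin d))) (θs : EuclideanSpace ℝ (Fin d)) : Prop :=
  ∃ c : ℝ, 0 < c ∧ ∀ θ ∈ Θ, risk P g θs + c * ‖θ - θs‖ ^ 2 ≤ risk P g θ

/-! ### The estimators

The sample of size `n` consists of the observations with indices `0, …, n - 1`. -/

/-- `θ̂` minimizes the sum of squares `∑ⱼ (yⱼ - g(xⱼ, θ))²` over `Θ`. -/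
def IsLeastSquares {p d : ℕ} (g : EuclideanSpace ℝ (Fin p) → EuclideanSpace ℝ (Fin d) → ℝ)
    (Θ : Set (EuclideanSpace ℝ (Fin d))) (x : ℕ → EuclideanSpace ℝ (Fin p)) (y : ℕ → ℝ) (n : ℕ)
    (θhat : EuclideanSpace ℝ (Fin d)) : Prop :=
  θhat ∈ Θ ∧ ∀ θ ∈ Θ, ∑ j ∈ Finset.range n, (y j - g (x j) θhat) ^ 2
    ≤ ∑ j ∈ Finset.range n, (y j - g (x j) θ) ^ 2

/-- `m̂ₙ(t) = n⁻¹ ∑ⱼ xⱼ exp(i t η̂ⱼ)`, for residuals `η̂ⱼ = e j`. -/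
def mHat {p : ℕ} (x : ℕ → EuclideanSpace ℝ (Fin p)) (e : ℕ → ℝ) (n : ℕ) (t : ℝ) : Fin p → ℂ :=
  fun k => (1 / (n : ℂ)) * ∑ j ∈ Finset.range n, (x j k : ℂ) * Complex.exp (Complex.I * t * e j)

/-- `M̂ₙ = n⁻¹ ∑ⱼ m̂ₙ(η̂ⱼ) m̂ₙ(η̂ⱼ)ᴴ`, for residuals `η̂ⱼ = e j`. -/
def MHat {p : ℕ} (x : ℕ → EuclideanSpace ℝ (Fin p)) (e : ℕ → ℝ) (n : ℕ) :
    Matrix (Fin p) (Fin p) ℂ :=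
  Matrix.of fun k l => (1 / (n : ℂ)) *
    ∑ j ∈ Finset.range n, mHat x e n (e j) k * starRingEnd ℂ (mHat x e n (e j) l)

lemma isHermitian_MHat {p : ℕ} (x : ℕ → EuclideanSpace ℝ (Fin p)) (e : ℕ → ℝ) (n : ℕ) :
    (MHat x e n).IsHermitian := by
  ext k l
  simp [MHat, Matrix.conjTranspose_apply, mul_comm]

/-- The `j`-th largest eigenvalue (`1 ≤ j ≤ p`) of a Hermitian `p × p` matrix, counted with
multiplicity; it is `0` for all other `j`. -/
def sortedEigenvalue {p : ℕ} {A : Matrix (Fin p) (Fin p) ℂ} (hA : A.IsHermitian) (j : ℕ) : ℝ :=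
  if h : 1 ≤ j ∧ j ≤ p then hA.eigenvalues₀ ⟨j - 1, by rw [Fintype.card_fin]; omega⟩ else 0

/-- `s_j = λ_j / (λ_j + 1)`. -/
def sVal (lam : ℕ → ℝ) (j : ℕ) : ℝ := lam j / (lam j + 1)

/-- `s*_j = (s_j² + c₁) / (s_{j+1}² + c₁) - 1`. -/
def sStar (lam : ℕ → ℝ) (c₁ : ℝ) (j : ℕ) : ℝ :=
  (sVal lam j ^ 2 + c₁) / (sVal lam (j + 1) ^ 2 + c₁) - 1

/-- `r_j = (s*_{j+1} + c₂) / (s*_j + c₂)`. -/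
def rRatio (lam : ℕ → ℝ) (c₁ c₂ : ℝ) (j : ℕ) : ℝ :=
  (sStar lam c₁ (j + 1) + c₂) / (sStar lam c₁ j + c₂)

/-- The thresholding double ridge ratio criterion: the largest `j ∈ {1, …, p}` with `r_j ≤ τ`, and
`0` if there is none. -/
def tdrr (p : ℕ) (lam : ℕ → ℝ) (c₁ c₂ τ : ℝ) : ℕ :=
  open Classical in ((Finset.Icc 1 p).filter fun j => rRatio lam c₁ c₂ j ≤ τ).sup id

/-- The estimator `q̂` from the first `n` observations, the estimate `θhat` of the parameter, the
ridges `c₁`, `c₂` and the threshold `τ`. -/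
def qHat {p d : ℕ} (g : EuclideanSpace ℝ (Fin p) → EuclideanSpace ℝ (Fin d) → ℝ)
    (x : ℕ → EuclideanSpace ℝ (Fin p)) (y : ℕ → ℝ) (n : ℕ) (θhat : EuclideanSpace ℝ (Fin d))
    (c₁ c₂ τ : ℝ) : ℕ :=
  tdrr p (sortedEigenvalue (isHermitian_MHat x (fun j => y j - g (x j) θhat) n)) c₁ c₂ τ

end HybridTest

end

/-!
The estimated dimension is read off the eigenvalues of `M̂ₙ`, and everything rests on one estimate: with
`m` the population target vector, `ηⱼ` the true and `η̂ⱼ` the estimated residuals,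

  `Dₙ = n⁻¹ ∑ⱼ ‖m̂ₙ(η̂ⱼ) - m(ηⱼ)‖²`  is  `O_p(n⁻¹)`

(`RegularityConditions.bddAboveInProb_meanSqDev`). It has two sources of error. With the true residuals,
the second moment of `m̂ₙ(ηⱼ) - m(ηⱼ)` is of order `n⁻¹`, since its off-diagonal terms are centred
(`bddAboveInProb_meanSqDev_true`). Exchanging the residuals costs `O(‖θ̂ - θ*‖²)`, because `t ↦ exp(it)`
is Lipschitz and so is `g` in the parameter, with a square integrable constant
(`exists_lipschitz_envelope`). The estimator `θ̂` is within `O_p(n^{-1/2})` of `θ*`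
(`bddAboveInProb_sqrt_mul_norm_sub`), a rate for general minimum contrast estimators. The contrast only
has a square integrable Lipschitz constant, so its increments are cut off where the constant exceeds
`√n`. The truncated increments satisfy a Bernstein type moment bound, chaining over dyadic grids gives a
maximal inequality on balls around `θ*`, and peeling into dyadic shells gives the rate. Quadratic growth
of the risk is needed here. It is assumed under the alternative; under the null hypothesis it follows
from uniqueness of the minimizer and nonsingularity of the second moment matrix of the gradient
(`RegularityConditions.nondegenerateMin_of_null`).

The eigenvalues follow from the variational characterization, applied to quadratic forms
(`sortedEigenvalue_le`, `le_sortedEigenvalue`). Vectors in the kernel of `M` are orthogonal to almost all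
`m(ηⱼ)`, so on the kernel the form of `M̂ₙ` is at most `2 Dₙ ‖v‖²`. On the orthogonal complement the form
of `M` is bounded below, and by the law of large numbers so is that of `n⁻¹ ∑ⱼ m(ηⱼ) m(ηⱼ)ᴴ`, hence that
of `M̂ₙ`. Consequently the first `rank M` eigenvalues stay away from zero, and all others are `O_p(n⁻¹)`.

Under the null hypothesis `η` is independent of the centred vector `X`, so `M = 0`. Under the alternative
`rank M = q`: linearity and conditional independence give `m(t) = P_B(Σ)ᵀ m(t)`, which bounds the rank by
`q` (`rank_targetMatrix_le`), and the other inequality is assumed. Moreover `q > 0`, for a trivial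
central subspace that is a dimension reduction subspace makes `η` independent of `X`
(`indepFun_of_indicativeDim_eq_zero`).

Finally, eigenvalues of order `n⁻¹` have squares that are negligible compared with `c₁ c₂`, as
`n² c₁ c₂ → ∞`. Their ratios `r_j` then exceed the threshold (`lt_rRatio`), whereas the ratio at `q`, where
the eigenvalues drop from a constant to `O_p(n⁻¹)`, tends to zero (`rRatio_le`).
-/

noncomputable section

namespace HybridTest

/-! ### Boundedness in probability -/

/-- The sequence `U n` is bounded above in probability: `U n = O_p(1)` for non-negative `U n`. -/
def BddAboveInProb {Ω : Type*} [MeasurableSpace Ω] (μ : Measure Ω) (U : ℕ → Ω → ℝ) : Prop :=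
  ∀ ε : ℝ≥0∞, 0 < ε → ∃ K : ℝ, ∀ᶠ n in atTop, μ {ω | K < U n ω} ≤ ε

section BddAboveInProb

variable {Ω : Type*} [MeasurableSpace Ω] {μ : Measure Ω} {U V : ℕ → Ω → ℝ}

lemma BddAboveInProb.mono (hV : BddAboveInProb μ V)
    (h : ∀ᶠ n in atTop, ∀ᵐ ω ∂μ, U n ω ≤ V n ω) : BddAboveInProb μ U := by
  intro ε hε
  obtain ⟨K, hK⟩ := hV ε hε
  refine ⟨K, ?_⟩
  filter_upwards [h, hK] with n hn hKn
  refine le_trans (measure_mono_ae ?_) hKn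
  filter_upwards [hn] with ω hω hlt
  exact lt_of_lt_of_le hlt hω

lemma bddAboveInProb_const (c : ℝ) : BddAboveInProb μ (fun _ _ => c) :=
  fun ε _ => ⟨c, by simp⟩

/-- If `U n` is bounded whenever `V n` and `W n` are, then boundedness in probability is inherited
by `U`. -/
lemma BddAboveInProb.of_bound₂ {W : ℕ → Ω → ℝ} (hV : BddAboveInProb μ V)
    (hW : BddAboveInProb μ W)
    (h : ∀ K L : ℝ, ∃ M : ℝ, ∀ n ω, V n ω ≤ K → W n ω ≤ L → U n ω ≤ M) :
    BddAboveInProb μ U := by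
  intro ε hε
  have hε2 : 0 < ε / 2 := ENNReal.half_pos hε.ne'
  obtain ⟨K, hK⟩ := hV _ hε2
  obtain ⟨L, hL⟩ := hW _ hε2
  obtain ⟨M, hM⟩ := h K L
  refine ⟨M, ?_⟩
  filter_upwards [hK, hL] with n hKn hLn
  have hsub : {ω | M < U n ω} ⊆ {ω | K < V n ω} ∪ {ω | L < W n ω} := by
    intro ω hω
    by_contra hc
    simp only [Set.mem_union, Set.mem_ofPred_eq, not_or, not_lt] at hc
    exact absurd (hM n ω hc.1 hc.2) (not_le.mpr hω)
  calc μ {ω | M < U n ω} ≤ μ {ω | K < V n ω} + μ {ω | L < W n ω} :=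
        (measure_mono hsub).trans (measure_union_le _ _)
    _ ≤ ε / 2 + ε / 2 := add_le_add hKn hLn
    _ = ε := ENNReal.add_halves ε

lemma BddAboveInProb.add (hU : BddAboveInProb μ U) (hV : BddAboveInProb μ V) :
    BddAboveInProb μ (fun n ω => U n ω + V n ω) :=
  hU.of_bound₂ hV fun K L => ⟨K + L, fun _ _ h₁ h₂ => add_le_add h₁ h₂⟩

lemma BddAboveInProb.mul (hU : BddAboveInProb μ U) (hV : BddAboveInProb μ V)
    (hU0 : ∀ n ω, 0 ≤ U n ω) (hV0 : ∀ n ω, 0 ≤ V n ω) :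
    BddAboveInProb μ (fun n ω => U n ω * V n ω) :=
  hU.of_bound₂ hV fun K L => ⟨K * L, fun n ω h₁ h₂ =>
    mul_le_mul h₁ h₂ (hV0 n ω) ((hU0 n ω).trans h₁)⟩

lemma BddAboveInProb.pow_two (hU : BddAboveInProb μ U) (hU0 : ∀ n ω, 0 ≤ U n ω) :
    BddAboveInProb μ (fun n ω => U n ω ^ 2) := by
  simpa only [sq] using hU.mul hU hU0 hU0

/-- **Markov's inequality**: bounded first moments give boundedness in probability. -/
lemma bddAboveInProb_of_lintegral_le {C : ℝ≥0∞} (hC : C ≠ ∞)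
    (hmeas : ∀ n, AEMeasurable (U n) μ)
    (h : ∀ᶠ n in atTop, ∫⁻ ω, ENNReal.ofReal (U n ω) ∂μ ≤ C) : BddAboveInProb μ U := by
  intro ε hε
  by_cases hεt : ε = ∞
  · exact ⟨0, by simp [hεt]⟩
  have hCε : C / ε ≠ ∞ := ENNReal.div_ne_top hC hε.ne'
  refine ⟨(C / ε).toReal + 1, ?_⟩
  filter_upwards [h] with n hn
  set K : ℝ≥0∞ := ENNReal.ofReal ((C / ε).toReal + 1) with hK
  have hK0 : K ≠ 0 := by
    rw [hK]; simp only [ne_eq, ENNReal.ofReal_eq_zero, not_le]; positivity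
  have hKt : K ≠ ∞ := ENNReal.ofReal_ne_top
  have hKC : C / ε ≤ K := by
    rw [hK, ← ENNReal.ofReal_toReal hCε]
    exact ENNReal.ofReal_le_ofReal (by rw [ENNReal.toReal_ofReal ENNReal.toReal_nonneg]; linarith)
  have h1 : K * μ {ω | K ≤ ENNReal.ofReal (U n ω)} ≤ C :=
    (mul_meas_ge_le_lintegral₀ (hmeas n).ennreal_ofReal K).trans hn
  have h2 : μ {ω | (C / ε).toReal + 1 < U n ω} ≤ μ {ω | K ≤ ENNReal.ofReal (U n ω)} :=
    measure_mono fun ω hω => ENNReal.ofReal_le_ofReal (le_of_lt hω)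
  refine h2.trans ?_
  rw [mul_comm] at h1
  calc _ ≤ C / K := (ENNReal.le_div_iff_mul_le (Or.inl hK0) (Or.inl hKt)).mpr h1
    _ ≤ ε := by
      rw [ENNReal.div_le_iff hK0 hKt]
      rw [ENNReal.div_le_iff hε.ne' hεt] at hKC
      rwa [mul_comm]

/-- If the good event `S n` occurs as soon as `U n` is at most `K` and `n` is large, off the
negligible event `N n`, then its probability tends to one. -/
lemma BddAboveInProb.tendsto_measure_one [IsProbabilityMeasure μ] (hU : BddAboveInProb μ U)
    {N S : ℕ → Set Ω} (hN : Tendsto (fun n => μ (N n)) atTop (𝓝 0))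
    (h : ∀ K : ℝ, ∀ᶠ n in atTop, ∀ᵐ ω ∂μ, U n ω ≤ K → ω ∉ N n → ω ∈ S n) :
    Tendsto (fun n => μ (S n)) atTop (𝓝 1) := by
  have hc : Tendsto (fun n => μ (S n)ᶜ) atTop (𝓝 0) := by
    rw [ENNReal.tendsto_nhds_zero]
    intro ε hε
    have hε2 : 0 < ε / 2 := ENNReal.half_pos hε.ne'
    obtain ⟨K, hK⟩ := hU _ hε2
    filter_upwards [hK, h K, (ENNReal.tendsto_nhds_zero.mp hN) _ hε2] with n h1 h2 h3
    have hsub : (S n)ᶜ ≤ᵐ[μ] ({ω | K < U n ω} ∪ N n : Set Ω) := by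
      filter_upwards [h2] with ω hω hωS
      by_contra hcon
      have hcon' : ω ∉ ({ω | K < U n ω} ∪ N n : Set Ω) := hcon
      simp only [Set.mem_union, Set.mem_ofPred_eq, not_or, not_lt] at hcon'
      exact hωS (hω hcon'.1 hcon'.2)
    calc μ (S n)ᶜ ≤ μ {ω | K < U n ω} + μ (N n) :=
          (measure_mono_ae hsub).trans (measure_union_le _ _)
      _ ≤ ε / 2 + ε / 2 := add_le_add h1 h3
      _ = ε := ENNReal.add_halves ε
  have hlow : ∀ n, 1 - μ (S n)ᶜ ≤ μ (S n) := by
    intro n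
    rw [tsub_le_iff_right]
    calc (1 : ℝ≥0∞) = μ Set.univ := measure_univ.symm
      _ = μ (S n ∪ (S n)ᶜ) := by rw [Set.union_compl_self]
      _ ≤ _ := measure_union_le _ _
  have hlim : Tendsto (fun n => 1 - μ (S n)ᶜ) atTop (𝓝 1) := by
    simpa using ENNReal.Tendsto.sub (tendsto_const_nhds (x := (1 : ℝ≥0∞))) hc (by simp)
  exact tendsto_of_tendsto_of_tendsto_of_le_of_le hlim tendsto_const_nhds hlow
    fun n => prob_le_one

end BddAboveInProb

/-! ### The ridge ratio criterion -/

lemma tdrr_eq_zero {p : ℕ} {lam : ℕ → ℝ} {c₁ c₂ τ : ℝ}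
    (h : ∀ j, 1 ≤ j → j ≤ p → τ < rRatio lam c₁ c₂ j) : tdrr p lam c₁ c₂ τ = 0 := by
  classical
  unfold tdrr
  rw [Finset.filter_eq_empty_iff.mpr]
  · simp
  · intro j hj
    rw [Finset.mem_Icc] at hj
    exact not_le.mpr (h j hj.1 hj.2)

lemma tdrr_eq {p q : ℕ} {lam : ℕ → ℝ} {c₁ c₂ τ : ℝ} (hq1 : 1 ≤ q) (hqp : q ≤ p)
    (hq : rRatio lam c₁ c₂ q ≤ τ)
    (h : ∀ j, q < j → j ≤ p → τ < rRatio lam c₁ c₂ j) : tdrr p lam c₁ c₂ τ = q := by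
  classical
  unfold tdrr
  refine le_antisymm (Finset.sup_le fun j hj => ?_) ?_
  · rw [Finset.mem_filter, Finset.mem_Icc] at hj
    by_contra hlt
    exact absurd hj.2 (not_le.mpr (h j (not_le.mp hlt) hj.1.2))
  · exact Finset.le_sup (f := id)
      (Finset.mem_filter.mpr ⟨Finset.mem_Icc.mpr ⟨hq1, hqp⟩, hq⟩)

lemma sVal_nonneg {lam : ℕ → ℝ} {j : ℕ} (h : 0 ≤ lam j) : 0 ≤ sVal lam j := by
  unfold sVal; positivity

lemma sVal_le {lam : ℕ → ℝ} {j : ℕ} (h : 0 ≤ lam j) : sVal lam j ≤ lam j := by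
  unfold sVal
  exact div_le_self h (by linarith)

lemma sVal_le_sVal {lam : ℕ → ℝ} {j k : ℕ} (h0 : 0 ≤ lam j) (h : lam j ≤ lam k) :
    sVal lam j ≤ sVal lam k := by
  unfold sVal
  rw [div_le_div_iff₀ (by linarith) (by linarith)]
  nlinarith

lemma sStar_eq {lam : ℕ → ℝ} {c₁ : ℝ} (hc : 0 < c₁) (j : ℕ) :
    sStar lam c₁ j = (sVal lam j ^ 2 - sVal lam (j + 1) ^ 2) / (sVal lam (j + 1) ^ 2 + c₁) := by
  unfold sStar
  have : sVal lam (j + 1) ^ 2 + c₁ ≠ 0 := by positivity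
  field_simp
  ring

lemma sStar_nonneg {lam : ℕ → ℝ} {c₁ : ℝ} (hc : 0 < c₁) {j : ℕ} (h0 : 0 ≤ lam (j + 1))
    (h : lam (j + 1) ≤ lam j) : 0 ≤ sStar lam c₁ j := by
  rw [sStar_eq hc]
  have h1 := sVal_le_sVal h0 h
  have h2 := sVal_nonneg h0
  exact div_nonneg (by nlinarith) (by positivity)

lemma sStar_le {lam : ℕ → ℝ} {c₁ : ℝ} (hc : 0 < c₁) {j : ℕ} (h0 : 0 ≤ lam j) :
    sStar lam c₁ j ≤ lam j ^ 2 / c₁ := by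
  rw [sStar_eq hc]
  have h1 := sVal_le h0
  have h2 := sVal_nonneg h0
  have h3 : sVal lam j ^ 2 ≤ lam j ^ 2 := pow_le_pow_left₀ h2 h1 2
  refine div_le_div₀ (by positivity) ?_ hc ?_ <;> nlinarith [sq_nonneg (sVal lam (j + 1))]

/-- Eigenvalues that are small compared with the ridges keep the ratio above the threshold. -/
lemma lt_rRatio {lam : ℕ → ℝ} {c₁ c₂ τ : ℝ} (hc₁ : 0 < c₁) (hc₂ : 0 < c₂) (hτ : 0 < τ) {j : ℕ}
    (h0 : ∀ k, 0 ≤ lam k) (hanti : ∀ k, j ≤ k → lam (k + 1) ≤ lam k)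
    (hsmall : τ * lam j ^ 2 < (1 - τ) * (c₁ * c₂)) : τ < rRatio lam c₁ c₂ j := by
  have h1 : 0 ≤ sStar lam c₁ (j + 1) := sStar_nonneg hc₁ (h0 _) (hanti _ (by omega))
  have h2 : 0 ≤ sStar lam c₁ j := sStar_nonneg hc₁ (h0 _) (hanti _ le_rfl)
  have h3 := sStar_le hc₁ (h0 j)
  have h4 : τ * (lam j ^ 2 / c₁) < (1 - τ) * c₂ := by
    rw [← mul_div_assoc, div_lt_iff₀ hc₁]; linarith
  unfold rRatio
  rw [lt_div_iff₀ (by linarith)]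
  have := mul_le_mul_of_nonneg_left h3 hτ.le
  linarith

/-- A spectral gap after the `q`-th eigenvalue pushes the `q`-th ratio below the threshold. -/
lemma rRatio_le {lam : ℕ → ℝ} {c₁ c₂ τ a b : ℝ} (hc₁ : 0 < c₁) (hc₂ : 0 < c₂) (hτ : 0 < τ)
    {q : ℕ} (h0 : ∀ k, 0 ≤ lam k) (ha : 0 < a) (hlam : a ≤ lam q)
    (hb : lam (q + 1) ≤ b) (hba : b ≤ a) (hbc : b ^ 2 ≤ c₁ * c₂)
    (hgap : 2 * c₂ * (b ^ 2 + c₁) ≤ τ * ((a / (a + 1)) ^ 2 - b ^ 2)) :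
    rRatio lam c₁ c₂ q ≤ τ := by
  have hlb : lam (q + 1) ^ 2 ≤ b ^ 2 := pow_le_pow_left₀ (h0 _) hb 2
  have h1 : sStar lam c₁ (q + 1) ≤ c₂ := by
    refine (sStar_le hc₁ (h0 _)).trans ?_
    rw [div_le_iff₀ hc₁]
    linarith
  have h2 : 0 ≤ sStar lam c₁ q := sStar_nonneg hc₁ (h0 _) (by linarith)
  have hs1 : a / (a + 1) ≤ sVal lam q := by
    unfold sVal
    rw [div_le_div_iff₀ (by linarith) (by linarith)]
    nlinarith
  have hs2 : sVal lam (q + 1) ^ 2 ≤ b ^ 2 :=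
    pow_le_pow_left₀ (sVal_nonneg (h0 _)) ((sVal_le (h0 _)).trans hb) 2
  have hs3 : (a / (a + 1)) ^ 2 ≤ sVal lam q ^ 2 := pow_le_pow_left₀ (by positivity) hs1 2
  have h3 : 2 * c₂ ≤ τ * sStar lam c₁ q := by
    rw [sStar_eq hc₁, ← mul_div_assoc, le_div_iff₀ (by positivity)]
    nlinarith [mul_le_mul_of_nonneg_left hs2 hc₂.le]
  unfold rRatio
  rw [div_le_iff₀ (by linarith)]
  nlinarith

/-! ### Eigenvalues and quadratic forms -/

section Courant

open scoped InnerProductSpace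

variable {E : Type*} [NormedAddCommGroup E] [InnerProductSpace ℂ E] [FiniteDimensional ℂ E]

/-- A subspace contains a nonzero vector with vanishing coordinates at fewer places than its
dimension. -/
lemma exists_mem_forall_repr_eq_zero {n : ℕ} (b : OrthonormalBasis (Fin n) ℂ E)
    (W : Submodule ℂ E) (s : Finset (Fin n)) (h : s.card < Module.finrank ℂ W) :
    ∃ v ∈ W, v ≠ 0 ∧ ∀ i ∈ s, b.repr v i = 0 := by
  let f : W →ₗ[ℂ] (s → ℂ) :=
    LinearMap.pi fun i => (EuclideanSpace.proj (i : Fin n)).toLinearMap ∘ₗ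
      b.repr.toLinearEquiv.toLinearMap ∘ₗ W.subtype
  have hf : LinearMap.ker f ≠ ⊥ := LinearMap.ker_ne_bot_of_finrank_lt (by simpa using h)
  obtain ⟨v, hv, hv0⟩ := (Submodule.ne_bot_iff _).mp hf
  refine ⟨v, v.2, fun h0 => hv0 (Subtype.ext h0), fun i hi => ?_⟩
  exact congrFun (LinearMap.mem_ker.mp hv) ⟨i, hi⟩

variable {T : E →ₗ[ℂ] E} {n : ℕ}

lemma re_inner_eq_sum_eigenvalues (hT : T.IsSymmetric) (hn : Module.finrank ℂ E = n) (v : E) :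
    (⟪v, T v⟫_ℂ).re = ∑ i, hT.eigenvalues hn i * ‖(hT.eigenvectorBasis hn).repr v i‖ ^ 2 := by
  rw [← (hT.eigenvectorBasis hn).repr.inner_map_map v (T v), PiLp.inner_apply, Complex.re_sum]
  refine Finset.sum_congr rfl fun i _ => ?_
  rw [hT.eigenvectorBasis_apply_self_apply hn v i, ← RCLike.real_smul_eq_coe_mul, inner_smul_right_eq_smul]
  simp [inner_self_eq_norm_sq_to_K, ← Complex.ofReal_pow]

/-- The easy half of the Courant–Fischer theorem, from below. -/
lemma le_eigenvalues_of_le_on_subspace (hT : T.IsSymmetric) (hn : Module.finrank ℂ E = n)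
    (k : Fin n) (W : Submodule ℂ E) (hW : (k : ℕ) < Module.finrank ℂ W) (c : ℝ)
    (hc : ∀ v ∈ W, c * ‖v‖ ^ 2 ≤ (⟪v, T v⟫_ℂ).re) : c ≤ hT.eigenvalues hn k := by
  obtain ⟨v, hvW, hv0, hv⟩ := exists_mem_forall_repr_eq_zero (hT.eigenvectorBasis hn) W
    (Finset.Iio k) (by simpa using hW)
  have h1 := hc v hvW
  rw [re_inner_eq_sum_eigenvalues hT hn v] at h1
  have h2 : ∑ i, hT.eigenvalues hn i * ‖(hT.eigenvectorBasis hn).repr v i‖ ^ 2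
      ≤ hT.eigenvalues hn k * ‖v‖ ^ 2 := by
    rw [← (hT.eigenvectorBasis hn).repr.norm_map v, EuclideanSpace.norm_sq_eq, Finset.mul_sum]
    refine Finset.sum_le_sum fun i _ => ?_
    rcases lt_or_ge i k with hik | hik
    · simp [hv i (by simpa using hik)]
    · exact mul_le_mul_of_nonneg_right (hT.eigenvalues_antitone hn hik) (by positivity)
  have hpos : 0 < ‖v‖ ^ 2 := by positivity
  exact le_of_mul_le_mul_right (h1.trans h2) hpos

/-- The easy half of the Courant–Fischer theorem, from above. -/
lemma eigenvalues_le_of_le_on_subspace (hT : T.IsSymmetric) (hn : Module.finrank ℂ E = n)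
    (k : Fin n) (W : Submodule ℂ E) (hW : n ≤ Module.finrank ℂ W + k) (c : ℝ)
    (hc : ∀ v ∈ W, (⟪v, T v⟫_ℂ).re ≤ c * ‖v‖ ^ 2) : hT.eigenvalues hn k ≤ c := by
  have hk := k.2
  obtain ⟨v, hvW, hv0, hv⟩ := exists_mem_forall_repr_eq_zero (hT.eigenvectorBasis hn) W
    (Finset.Ioi k) (by rw [Fin.card_Ioi]; omega)
  have h1 := hc v hvW
  rw [re_inner_eq_sum_eigenvalues hT hn v] at h1
  have h2 : hT.eigenvalues hn k * ‖v‖ ^ 2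
      ≤ ∑ i, hT.eigenvalues hn i * ‖(hT.eigenvectorBasis hn).repr v i‖ ^ 2 := by
    rw [← (hT.eigenvectorBasis hn).repr.norm_map v, EuclideanSpace.norm_sq_eq, Finset.mul_sum]
    refine Finset.sum_le_sum fun i _ => ?_
    rcases lt_or_ge k i with hik | hik
    · simp [hv i (by simpa using hik)]
    · exact mul_le_mul_of_nonneg_right (hT.eigenvalues_antitone hn hik) (by positivity)
  have hpos : 0 < ‖v‖ ^ 2 := by positivity
  exact le_of_mul_le_mul_right (h2.trans h1) hpos

end Courant

section SortedEigenvalue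

open scoped InnerProductSpace

variable {p : ℕ} {A : Matrix (Fin p) (Fin p) ℂ}

/-- The real part of the Hermitian form `vᴴ A v`. -/
def quadForm (A : Matrix (Fin p) (Fin p) ℂ) (v : EuclideanSpace ℂ (Fin p)) : ℝ :=
  (star v.ofLp ⬝ᵥ A.mulVec v.ofLp).re

lemma quadForm_eq_inner (A : Matrix (Fin p) (Fin p) ℂ) (v : EuclideanSpace ℂ (Fin p)) :
    quadForm A v = (⟪v, Matrix.toEuclideanLin A v⟫_ℂ).re := by
  rw [quadForm, EuclideanSpace.inner_eq_star_dotProduct, dotProduct_comm]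
  rfl

lemma sortedEigenvalue_of_lt (hA : A.IsHermitian) {j : ℕ} (h : p < j) :
    sortedEigenvalue hA j = 0 := by
  unfold sortedEigenvalue
  rw [dif_neg (by omega)]

lemma le_sortedEigenvalue (hA : A.IsHermitian) {j : ℕ} (h1 : 1 ≤ j) (hp : j ≤ p)
    (W : Submodule ℂ (EuclideanSpace ℂ (Fin p))) (hW : j ≤ Module.finrank ℂ W) {c : ℝ}
    (hc : ∀ v ∈ W, c * ‖v‖ ^ 2 ≤ quadForm A v) : c ≤ sortedEigenvalue hA j := by
  unfold sortedEigenvalue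
  rw [dif_pos ⟨h1, hp⟩]
  refine le_eigenvalues_of_le_on_subspace _ _ _ W (by simp; omega) c fun v hv => ?_
  rw [← quadForm_eq_inner]
  exact hc v hv

lemma sortedEigenvalue_le (hA : A.IsHermitian) {j : ℕ} {c : ℝ} (hc0 : 0 ≤ c)
    (W : Submodule ℂ (EuclideanSpace ℂ (Fin p))) (hW : p + 1 ≤ Module.finrank ℂ W + j)
    (hc : ∀ v ∈ W, quadForm A v ≤ c * ‖v‖ ^ 2) : sortedEigenvalue hA j ≤ c := by
  unfold sortedEigenvalue
  split_ifs with h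
  · refine eigenvalues_le_of_le_on_subspace _ _ _ W (by simp; omega) c fun v hv => ?_
    rw [← quadForm_eq_inner]
    exact hc v hv
  · exact hc0

lemma sortedEigenvalue_nonneg (hA : A.IsHermitian) (h : ∀ v, 0 ≤ quadForm A v) (j : ℕ) :
    0 ≤ sortedEigenvalue hA j := by
  by_cases hj : 1 ≤ j ∧ j ≤ p
  · exact le_sortedEigenvalue hA hj.1 hj.2 ⊤ (by simp [hj.2]) fun v _ => by simpa using h v
  · unfold sortedEigenvalue
    rw [dif_neg hj]

lemma sortedEigenvalue_succ_le (hA : A.IsHermitian) (h : ∀ v, 0 ≤ quadForm A v) {j : ℕ}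
    (hj : 1 ≤ j) : sortedEigenvalue hA (j + 1) ≤ sortedEigenvalue hA j := by
  by_cases hjp : j + 1 ≤ p
  · unfold sortedEigenvalue
    rw [dif_pos ⟨by omega, hjp⟩, dif_pos ⟨hj, by omega⟩]
    refine hA.eigenvalues₀_antitone ?_
    rw [Fin.le_def]
    simp
  · rw [sortedEigenvalue_of_lt hA (by omega)]
    exact sortedEigenvalue_nonneg hA h j

end SortedEigenvalue

/-! ### Conditional independence and the central subspace -/

section CondIndep

variable {Ω E : Type*} {m' : MeasurableSpace Ω} {mΩ : MeasurableSpace Ω} [StandardBorelSpace Ω]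
  [mE : MeasurableSpace E] {μ : Measure Ω} [IsFiniteMeasure μ] {hm' : m' ≤ mΩ}
  {η : Ω → ℝ} {X : Ω → E}

/-- If `η` and `X` are conditionally independent given a function of `X`, then conditioning an
event about `η` on `X` amounts to conditioning it on that function. -/
lemma condExp_comap_eq_of_condIndepFun (hη : Measurable η) (hX : Measurable X)
    (hle : m' ≤ mE.comap X) (h : CondIndepFun m' hm' η X μ) {A : Set ℝ} (hA : MeasurableSet A) :
    μ[(η ⁻¹' A).indicator (fun _ => (1 : ℝ)) | m']
      =ᵐ[μ] μ[(η ⁻¹' A).indicator (fun _ => (1 : ℝ)) | mE.comap X] := by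
  have hXm : mE.comap X ≤ mΩ := hX.comap_le
  have hint : ∀ s : Set Ω, MeasurableSet s → Integrable (s.indicator fun _ => (1 : ℝ)) μ :=
    fun s hs => (integrable_const 1).indicator hs
  refine ae_eq_condExp_of_forall_setIntegral_eq hXm (hint _ (hη hA))
    (fun s _ _ => integrable_condExp.integrableOn) ?_
    (stronglyMeasurable_condExp.mono hle).aestronglyMeasurable
  rintro _ ⟨B, hB, rfl⟩ -
  have h1 := (condIndepFun_iff_condExp_inter_preimage_eq_mul hη hX).mp h A B hA hB
  set a := (η ⁻¹' A).indicator (fun _ => (1 : ℝ)) with ha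
  set b := (X ⁻¹' B).indicator (fun _ => (1 : ℝ)) with hb
  have hbound : ∀ᵐ ω ∂μ, ‖(μ[a | m']) ω‖ ≤ 1 :=
    ae_bdd_abs_condExp_of_ae_bdd_abs (R := (1 : ℝ)) (ae_of_all _ fun ω => by
      rw [ha]; by_cases hω : ω ∈ η ⁻¹' A <;> simp [hω])
  have hmul : Integrable (fun ω => (μ[a | m']) ω * b ω) μ :=
    (hint _ (hX hB)).bdd_mul integrable_condExp.aestronglyMeasurable hbound
  calc ∫ ω in X ⁻¹' B, (μ[a | m']) ω ∂μ = ∫ ω, (μ[a | m']) ω * b ω ∂μ := by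
        rw [← integral_indicator (hX hB)]
        refine integral_congr_ae (ae_of_all _ fun ω => ?_)
        by_cases hω : ω ∈ X ⁻¹' B <;> simp [hb, hω]
    _ = ∫ ω, (μ[fun ω => (μ[a | m']) ω * b ω | m']) ω ∂μ := (integral_condExp hm').symm
    _ = ∫ ω, (μ[a | m']) ω * (μ[b | m']) ω ∂μ := by
        refine integral_congr_ae ?_
        exact condExp_mul_of_stronglyMeasurable_left stronglyMeasurable_condExp hmul
          (hint _ (hX hB))
    _ = ∫ ω, (μ[(η ⁻¹' A ∩ X ⁻¹' B).indicator (fun _ => (1 : ℝ)) | m']) ω ∂μ :=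
        integral_congr_ae h1.symm
    _ = ∫ ω, (η ⁻¹' A ∩ X ⁻¹' B).indicator (fun _ => (1 : ℝ)) ω ∂μ := integral_condExp hm'
    _ = ∫ ω in X ⁻¹' B, a ω ∂μ := by
        rw [← integral_indicator (hX hB), Set.inter_comm, ← Set.indicator_indicator]

/-- If `η` and `X` are conditionally independent given a function of `X`, then a function `W` of
`X` whose conditional expectation vanishes is uncorrelated with all bounded functions of `η`. -/
lemma integral_mul_eq_zero_of_condIndepFun (hη : Measurable η) (hX : Measurable X)
    (hle : m' ≤ mE.comap X) (h : CondIndepFun m' hm' η X μ) {W : Ω → ℝ}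
    (hW : StronglyMeasurable[mE.comap X] W) (hWi : Integrable W μ) (hW0 : μ[W | m'] =ᵐ[μ] 0)
    {ψ : ℝ → ℝ} (hψ : Measurable ψ) {C : ℝ} (hC : ∀ t, ‖ψ t‖ ≤ C) :
    ∫ ω, W ω * ψ (η ω) ∂μ = 0 := by
  have hXm : mE.comap X ≤ mΩ := hX.comap_le
  have hηm : MeasurableSpace.comap η inferInstance ≤ mΩ := hη.comap_le
  have key : ∀ A : Set ℝ, MeasurableSet A → ∫ ω in η ⁻¹' A, W ω ∂μ = 0 := by
    intro A hA
    set a := (η ⁻¹' A).indicator (fun _ => (1 : ℝ)) with ha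
    have hai : Integrable a μ := (integrable_const 1).indicator (hη hA)
    have habd : ∀ ω, ‖a ω‖ ≤ 1 := fun ω => by
      rw [ha]; by_cases hω : ω ∈ η ⁻¹' A <;> simp [hω]
    have hbound : ∀ᵐ ω ∂μ, ‖(μ[a | m']) ω‖ ≤ 1 :=
      ae_bdd_abs_condExp_of_ae_bdd_abs (R := (1 : ℝ)) (ae_of_all _ fun ω => habd ω)
    have hWa : Integrable (fun ω => W ω * a ω) μ :=
      hWi.mul_bdd hai.aestronglyMeasurable (ae_of_all _ habd)
    have hWa' : Integrable (fun ω => W ω * (μ[a | m']) ω) μ :=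
      hWi.mul_bdd integrable_condExp.aestronglyMeasurable hbound
    calc ∫ ω in η ⁻¹' A, W ω ∂μ = ∫ ω, W ω * a ω ∂μ := by
          rw [← integral_indicator (hη hA)]
          refine integral_congr_ae (ae_of_all _ fun ω => ?_)
          by_cases hω : ω ∈ η ⁻¹' A <;> simp [ha, hω]
      _ = ∫ ω, (μ[fun ω => W ω * a ω | mE.comap X]) ω ∂μ := (integral_condExp hXm).symm
      _ = ∫ ω, W ω * (μ[a | mE.comap X]) ω ∂μ :=
          integral_congr_ae (condExp_mul_of_stronglyMeasurable_left hW hWa hai)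
      _ = ∫ ω, W ω * (μ[a | m']) ω ∂μ := by
          refine integral_congr_ae ?_
          filter_upwards [condExp_comap_eq_of_condIndepFun hη hX hle h hA] with ω hω
          rw [ha, hω]
      _ = ∫ ω, (μ[fun ω => W ω * (μ[a | m']) ω | m']) ω ∂μ := (integral_condExp hm').symm
      _ = ∫ ω, (μ[W | m']) ω * (μ[a | m']) ω ∂μ :=
          integral_congr_ae
            (condExp_mul_of_stronglyMeasurable_right stronglyMeasurable_condExp hWa' hWi)
      _ = ∫ _, (0 : ℝ) ∂μ := by
          refine integral_congr_ae ?_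
          filter_upwards [hW0] with ω hω
          simp [hω]
      _ = 0 := integral_zero _ _
  have hzero : (0 : Ω → ℝ) =ᵐ[μ] μ[W | MeasurableSpace.comap η inferInstance] := by
    refine ae_eq_condExp_of_forall_setIntegral_eq hηm hWi
      (fun s _ _ => (integrable_zero _ _ _).integrableOn) ?_
      stronglyMeasurable_zero.aestronglyMeasurable
    rintro _ ⟨A, hA, rfl⟩ -
    rw [key A hA]
    simp
  have hψm : StronglyMeasurable[MeasurableSpace.comap η inferInstance] fun ω => ψ (η ω) :=
    (hψ.comp (comap_measurable η)).stronglyMeasurable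
  have hint : Integrable (fun ω => W ω * ψ (η ω)) μ :=
    hWi.mul_bdd (hψ.comp hη).aestronglyMeasurable (ae_of_all _ fun ω => hC _)
  rw [← integral_condExp hηm]
  have : ∫ ω, (μ[fun ω => W ω * ψ (η ω) | MeasurableSpace.comap η inferInstance]) ω ∂μ
      = ∫ _, (0 : ℝ) ∂μ := by
    refine integral_congr_ae ?_
    filter_upwards [condExp_mul_of_stronglyMeasurable_right hψm hint hWi, hzero] with ω h1 h2
    have h3 := h1
    simp only [Pi.mul_apply, ← h2, Pi.zero_apply, zero_mul] at h3
    exact h3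
  rw [this, integral_zero]

end CondIndep

section CentralSubspace

variable {p : ℕ}

lemma comap_reduce_le {q q' : ℕ} {B : Matrix (Fin p) (Fin q) ℝ} {B' : Matrix (Fin p) (Fin q') ℝ}
    (h : colSpan B ≤ colSpan B') :
    MeasurableSpace.comap (reduce B) inferInstance
      ≤ MeasurableSpace.comap (reduce B') inferInstance := by
  have h1 : ∀ j, ∃ c : Fin q' → ℝ, ∑ l, c l • B'.transpose l = B.transpose j := fun j =>
    (Submodule.mem_span_range_iff_exists_fun ℝ).mp (h (Submodule.subset_span ⟨j, rfl⟩))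
  choose c hc using h1
  have h2 : reduce B = (fun w j => ∑ l, c j l * w l) ∘ reduce B' := by
    funext z j
    simp only [reduce, Matrix.mulVec, Function.comp_apply]
    rw [← hc j, sum_dotProduct]
    exact Finset.sum_congr rfl fun l _ => smul_dotProduct _ _ _
  rw [h2, ← MeasurableSpace.comap_comp]
  refine MeasurableSpace.comap_mono (Measurable.comap_le ?_)
  fun_prop

lemma comap_reduce_le_comap_fst {q : ℕ} (B : Matrix (Fin p) (Fin q) ℝ) :
    MeasurableSpace.comap (reduce B) inferInstance
      ≤ MeasurableSpace.comap (Prod.fst : EuclideanSpace ℝ (Fin p) × ℝ → _) inferInstance := by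
  have h2 : reduce B = (fun x : EuclideanSpace ℝ (Fin p) => B.transpose.mulVec x.ofLp) ∘
      (Prod.fst : EuclideanSpace ℝ (Fin p) × ℝ → _) := rfl
  rw [h2, ← MeasurableSpace.comap_comp]
  refine MeasurableSpace.comap_mono (Measurable.comap_le ?_)
  have : Continuous (fun x : EuclideanSpace ℝ (Fin p) => B.transpose.mulVec x.ofLp) := by fun_prop
  exact this.measurable

variable {P : Measure (EuclideanSpace ℝ (Fin p) × ℝ)} [IsProbabilityMeasure P]
  {η : EuclideanSpace ℝ (Fin p) × ℝ → ℝ}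

/-- Only the column space of `B` matters for conditioning on `Bᵀ X`. -/
lemma IsDimensionReductionSubspace.condIndepFun {q : ℕ} {B : Matrix (Fin p) (Fin q) ℝ}
    (h : IsDimensionReductionSubspace P η (colSpan B)) :
    CondIndepFun (MeasurableSpace.comap (reduce B) inferInstance) (measurable_reduce B).comap_le
      η Prod.fst P := by
  obtain ⟨q', B', hB', hci⟩ := h
  have heq : MeasurableSpace.comap (reduce B') inferInstance
      = MeasurableSpace.comap (reduce B) inferInstance :=
    le_antisymm (comap_reduce_le hB'.le) (comap_reduce_le hB'.ge)
  have aux : ∀ (m₁ m₂ : MeasurableSpace (EuclideanSpace ℝ (Fin p) × ℝ)) (h₁ : m₁ ≤ Prod.instMeasurableSpace)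
      (h₂ : m₂ ≤ Prod.instMeasurableSpace), m₁ = m₂ → CondIndepFun m₁ h₁ η Prod.fst P →
      CondIndepFun m₂ h₂ η Prod.fst P := by
    rintro m₁ m₂ h₁ h₂ rfl h
    exact h
  exact aux _ _ _ _ heq hci

/-- If the central subspace is a dimension reduction subspace and is trivial, then `η` is
independent of `X`. -/
lemma indepFun_of_indicativeDim_eq_zero (hη : Measurable η)
    (hdr : IsDimensionReductionSubspace P η (centralSubspace P η))
    (h0 : indicativeDim P η = 0) : IndepFun Prod.fst η P := by
  have hbot : centralSubspace P η = ⊥ := Submodule.finrank_eq_zero.mp h0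
  set B : Matrix (Fin p) (Fin 0) ℝ := 0
  have hB : colSpan B = centralSubspace P η := by
    rw [hbot, colSpan, Submodule.span_eq_bot]
    rintro _ ⟨j, -⟩
    exact j.elim0
  rw [← hB] at hdr
  have hci := hdr.condIndepFun
  rw [condIndepFun_iff_condExp_inter_preimage_eq_mul hη measurable_fst] at hci
  have hm : MeasurableSpace.comap (reduce B) inferInstance = ⊥ := by
    have : reduce B = fun _ => (0 : Fin 0 → ℝ) := by
      funext z
      exact Subsingleton.elim _ _
    rw [this, MeasurableSpace.comap_const]
  rw [hm] at hci
  refine IndepFun.symm ?_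
  rw [indepFun_iff_measure_inter_preimage_eq_mul]
  intro s t hs ht
  obtain ⟨z, hz⟩ := (hci s t hs ht).exists
  have hreal : ∀ S : Set (EuclideanSpace ℝ (Fin p) × ℝ), MeasurableSet S →
      (P[S.indicator (fun _ => (1 : ℝ)) | ⊥]) z = P.real S := by
    intro S hS
    rw [condExp_bot]
    simp [integral_indicator hS]
  simp only at hz
  rw [hreal _ ((hη hs).inter (measurable_fst ht)), hreal _ (hη hs),
    hreal _ (measurable_fst ht)] at hz
  rw [← ENNReal.toReal_eq_toReal_iff' (measure_ne_top _ _)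
    (ENNReal.mul_ne_top (measure_ne_top _ _) (measure_ne_top _ _)), ENNReal.toReal_mul]
  exact hz

end CentralSubspace

/-! ### The target matrix -/

section TargetMatrix

variable {p : ℕ} {P : Measure (EuclideanSpace ℝ (Fin p) × ℝ)}
  {η : EuclideanSpace ℝ (Fin p) × ℝ → ℝ}

/-- The first absolute moment of `X`, a bound for the entries of the target vector. -/
def absMean (P : Measure (EuclideanSpace ℝ (Fin p) × ℝ)) : ℝ := ∫ z, ‖z.1‖ ∂P

lemma absMean_nonneg : 0 ≤ absMean P := integral_nonneg fun _ => norm_nonneg _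

lemma isHermitian_targetMatrix : (targetMatrix P η).IsHermitian := by
  ext k l
  rw [Matrix.conjTranspose_apply]
  simp only [targetMatrix, Matrix.of_apply, RCLike.star_def]
  rw [← integral_conj]
  simp [mul_comm]

variable [IsProbabilityMeasure P]

lemma norm_exp_I_mul (t s : ℝ) : ‖Complex.exp (Complex.I * t * s)‖ = 1 := by
  rw [mul_assoc, mul_comm, ← Complex.ofReal_mul, Complex.norm_exp_ofReal_mul_I]

lemma integrable_coord (hX : MemLp (fun z : EuclideanSpace ℝ (Fin p) × ℝ => z.1) 2 P)
    (k : Fin p) : Integrable (fun z => z.1 k) P := by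
  have h1 : Integrable (fun z : EuclideanSpace ℝ (Fin p) × ℝ => z.1) P :=
    hX.integrable (by norm_num)
  refine h1.norm.mono' (by fun_prop) (ae_of_all _ fun z => ?_)
  exact PiLp.norm_apply_le z.1 k

lemma integrable_coord_mul_exp
    (hX : MemLp (fun z : EuclideanSpace ℝ (Fin p) × ℝ => z.1) 2 P) (hη : Measurable η)
    (t : ℝ) (k : Fin p) :
    Integrable (fun z => (z.1 k : ℂ) * Complex.exp (Complex.I * t * η z)) P := by
  refine (integrable_coord hX k).ofReal.mul_bdd (c := 1) ?_
    (ae_of_all _ fun z => (norm_exp_I_mul t (η z)).le)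
  exact (by fun_prop : Measurable fun z => Complex.exp (Complex.I * t * η z)).aestronglyMeasurable

lemma measurable_targetVector (hη : Measurable η) (k : Fin p) :
    Measurable fun t => targetVector P η t k := by
  unfold targetVector
  refine (StronglyMeasurable.integral_prod_right (f := fun (t : ℝ) z =>
    ((z.1 k : ℝ) : ℂ) * Complex.exp (Complex.I * t * η z)) ?_).measurable
  refine Measurable.stronglyMeasurable ?_
  simp only [Function.uncurry_def]
  fun_prop

lemma norm_targetVector_le (hX : MemLp (fun z : EuclideanSpace ℝ (Fin p) × ℝ => z.1) 2 P)
    (t : ℝ) (k : Fin p) : ‖targetVector P η t k‖ ≤ absMean P := by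
  unfold targetVector absMean
  have h1 : Integrable (fun z : EuclideanSpace ℝ (Fin p) × ℝ => z.1) P :=
    hX.integrable (by norm_num)
  refine norm_integral_le_of_norm_le h1.norm (ae_of_all _ fun z => ?_)
  rw [norm_mul, norm_exp_I_mul, mul_one, Complex.norm_real]
  exact PiLp.norm_apply_le z.1 k

lemma integrable_targetVector_mul
    (hX : MemLp (fun z : EuclideanSpace ℝ (Fin p) × ℝ => z.1) 2 P) (hη : Measurable η)
    (k l : Fin p) :
    Integrable (fun t => targetVector P η t k * starRingEnd ℂ (targetVector P η t l))
      (P.map η) := by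
  have : IsProbabilityMeasure (P.map η) := Measure.isProbabilityMeasure_map hη.aemeasurable
  refine Integrable.of_bound (C := absMean P * absMean P) ?_ (ae_of_all _ fun t => ?_)
  · have hk := measurable_targetVector (P := P) hη k
    have hl := measurable_targetVector (P := P) hη l
    exact (hk.mul (Complex.continuous_conj.measurable.comp hl)).aestronglyMeasurable
  · rw [norm_mul, RCLike.norm_conj]
    exact mul_le_mul (norm_targetVector_le hX t k) (norm_targetVector_le hX t l)
      (norm_nonneg _) absMean_nonneg

/-- The quadratic form of `∑ⱼ aⱼ aⱼᴴ` type matrices: `|vᴴ a|²`. -/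
lemma star_mul_mul_eq_normSq {ι : Type*} [Fintype ι] (v a : ι → ℂ) :
    ∑ k, ∑ l, starRingEnd ℂ (v k) * (a k * starRingEnd ℂ (a l)) * v l
      = ((‖∑ k, starRingEnd ℂ (v k) * a k‖ ^ 2 : ℝ) : ℂ) := by
  rw [Complex.ofReal_pow, ← Complex.mul_conj', map_sum, Finset.sum_mul_sum]
  refine Finset.sum_congr rfl fun k _ => Finset.sum_congr rfl fun l _ => ?_
  simp only [map_mul, Complex.conj_conj]
  ring

lemma quadForm_eq_re_sum (A : Matrix (Fin p) (Fin p) ℂ) (v : EuclideanSpace ℂ (Fin p)) :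
    quadForm A v = (∑ k, ∑ l, starRingEnd ℂ (v k) * A k l * v l).re := by
  unfold quadForm
  congr 1
  simp only [dotProduct, Matrix.mulVec, Finset.mul_sum, Pi.star_apply, RCLike.star_def]
  refine Finset.sum_congr rfl fun k _ => Finset.sum_congr rfl fun l _ => ?_
  ring

lemma quadForm_targetMatrix
    (hX : MemLp (fun z : EuclideanSpace ℝ (Fin p) × ℝ => z.1) 2 P) (hη : Measurable η)
    (v : EuclideanSpace ℂ (Fin p)) :
    quadForm (targetMatrix P η) v
      = ∫ t, ‖∑ k, starRingEnd ℂ (v k) * targetVector P η t k‖ ^ 2 ∂(P.map η) := by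
  have hi := integrable_targetVector_mul (P := P) hX hη
  rw [quadForm_eq_re_sum]
  have h1 : ∑ k, ∑ l, starRingEnd ℂ (v k) * targetMatrix P η k l * v l
      = ∫ t, ((‖∑ k, starRingEnd ℂ (v k) * targetVector P η t k‖ ^ 2 : ℝ) : ℂ) ∂(P.map η) := by
    simp_rw [← star_mul_mul_eq_normSq]
    rw [integral_finsetSum _ fun k _ => integrable_finsetSum _ fun l _ =>
      ((hi k l).const_mul _).mul_const _]
    refine Finset.sum_congr rfl fun k _ => ?_
    rw [integral_finsetSum _ fun l _ => ((hi k l).const_mul _).mul_const _]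
    refine Finset.sum_congr rfl fun l _ => ?_
    rw [integral_mul_const, integral_const_mul]
    rfl
  rw [h1, integral_complex_ofReal, Complex.ofReal_re]

lemma quadForm_targetMatrix_nonneg
    (hX : MemLp (fun z : EuclideanSpace ℝ (Fin p) × ℝ => z.1) 2 P) (hη : Measurable η)
    (v : EuclideanSpace ℂ (Fin p)) : 0 ≤ quadForm (targetMatrix P η) v := by
  rw [quadForm_targetMatrix hX hη]
  exact integral_nonneg fun _ => by positivity

/-- The kernel of the target matrix is orthogonal to almost all target vectors. -/
lemma ae_sum_targetVector_eq_zero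
    (hX : MemLp (fun z : EuclideanSpace ℝ (Fin p) × ℝ => z.1) 2 P) (hη : Measurable η)
    {v : EuclideanSpace ℂ (Fin p)} (hv : quadForm (targetMatrix P η) v = 0) :
    ∀ᵐ z ∂P, ∑ k, starRingEnd ℂ (v k) * targetVector P η (η z) k = 0 := by
  have : IsProbabilityMeasure (P.map η) := Measure.isProbabilityMeasure_map hη.aemeasurable
  rw [quadForm_targetMatrix hX hη] at hv
  have hm : Measurable fun t => ∑ k, starRingEnd ℂ (v k) * targetVector P η t k :=
    Finset.measurable_fun_sum _ fun k _ => (measurable_targetVector hη k).const_mul _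
  have hint : Integrable (fun t => ‖∑ k, starRingEnd ℂ (v k) * targetVector P η t k‖ ^ 2)
      (P.map η) := by
    refine Integrable.of_bound (C := (∑ k, ‖v k‖ * absMean P) ^ 2)
      (hm.norm.pow_const 2).aestronglyMeasurable (ae_of_all _ fun t => ?_)
    rw [Real.norm_of_nonneg (by positivity)]
    refine pow_le_pow_left₀ (norm_nonneg _) ((norm_sum_le _ _).trans ?_) 2
    refine Finset.sum_le_sum fun k _ => ?_
    rw [norm_mul, RCLike.norm_conj]
    exact mul_le_mul_of_nonneg_left (norm_targetVector_le hX t k) (norm_nonneg _)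
  have h0 := (integral_eq_zero_iff_of_nonneg (fun t => by positivity) hint).mp hv
  have h1 := ae_of_ae_map hη.aemeasurable h0
  filter_upwards [h1] with z hz
  simpa using hz

/-- Linearity and conditional independence force `m(t) = P_B(Σ)ᵀ m(t)`. -/
lemma targetVector_eq_projMatrix_mul
    (hX : MemLp (fun z : EuclideanSpace ℝ (Fin p) × ℝ => z.1) 2 P) (hη : Measurable η)
    {q : ℕ} (B : Matrix (Fin p) (Fin q) ℝ)
    (hci : CondIndepFun (MeasurableSpace.comap (reduce B) inferInstance)
      (measurable_reduce B).comap_le η Prod.fst P)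
    (Q : Matrix (Fin p) (Fin p) ℝ)
    (hlin : ∀ i : Fin p, P[fun z => z.1 i | MeasurableSpace.comap (reduce B) inferInstance]
        =ᵐ[P] fun z => (Q.mulVec z.1.ofLp) i) (t : ℝ) (k : Fin p) :
    targetVector P η t k = ∑ l, (Q k l : ℂ) * targetVector P η t l := by
  set W : EuclideanSpace ℝ (Fin p) × ℝ → ℝ := fun z => z.1 k - (Q.mulVec z.1.ofLp) k with hWdef
  have hXi := integrable_coord hX
  have hQi : Integrable (fun z : EuclideanSpace ℝ (Fin p) × ℝ => (Q.mulVec z.1.ofLp) k) P := by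
    simp only [Matrix.mulVec, dotProduct]
    exact integrable_finsetSum _ fun l _ => (hXi l).const_mul _
  have hWi : Integrable W P := (hXi k).sub hQi
  have hle := (measurable_reduce B).comap_le
  have hW0 : P[W | MeasurableSpace.comap (reduce B) inferInstance] =ᵐ[P] 0 := by
    have h1 := condExp_sub (hXi k) hQi (MeasurableSpace.comap (reduce B) inferInstance)
    have h2 := condExp_congr_ae (m := MeasurableSpace.comap (reduce B) inferInstance) (hlin k)
    rw [condExp_of_stronglyMeasurable hle stronglyMeasurable_condExp integrable_condExp] at h2
    filter_upwards [h1, h2] with z hz1 hz2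
    have hz3 : (P[W | MeasurableSpace.comap (reduce B) inferInstance]) z = _ := hz1
    rw [hz3, Pi.sub_apply, hz2, sub_self, Pi.zero_apply]
  have hWm : StronglyMeasurable[MeasurableSpace.comap
      (Prod.fst : EuclideanSpace ℝ (Fin p) × ℝ → _) inferInstance] W := by
    have hc : Continuous fun x : EuclideanSpace ℝ (Fin p) => x k - (Q.mulVec x.ofLp) k := by
      fun_prop
    exact (hc.measurable.comp (comap_measurable Prod.fst)).stronglyMeasurable
  have hcos : ∫ z, W z * Real.cos (t * η z) ∂P = 0 :=
    integral_mul_eq_zero_of_condIndepFun hη measurable_fst (comap_reduce_le_comap_fst B) hci hWm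
      hWi hW0 (ψ := fun s => Real.cos (t * s)) (by fun_prop) (C := 1)
      fun s => Real.abs_cos_le_one _
  have hsin : ∫ z, W z * Real.sin (t * η z) ∂P = 0 :=
    integral_mul_eq_zero_of_condIndepFun hη measurable_fst (comap_reduce_le_comap_fst B) hci hWm
      hWi hW0 (ψ := fun s => Real.sin (t * s)) (by fun_prop) (C := 1)
      fun s => Real.abs_sin_le_one _
  have hicos : Integrable (fun z => W z * Real.cos (t * η z)) P :=
    hWi.mul_bdd (c := 1) (by fun_prop) (ae_of_all _ fun z => Real.abs_cos_le_one _)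
  have hisin : Integrable (fun z => W z * Real.sin (t * η z)) P :=
    hWi.mul_bdd (c := 1) (by fun_prop) (ae_of_all _ fun z => Real.abs_sin_le_one _)
  have hexp : ∫ z, (W z : ℂ) * Complex.exp (Complex.I * t * η z) ∂P = 0 := by
    have h1 : ∀ z, (W z : ℂ) * Complex.exp (Complex.I * t * η z)
        = ((W z * Real.cos (t * η z) : ℝ) : ℂ)
          + ((W z * Real.sin (t * η z) : ℝ) : ℂ) * Complex.I := by
      intro z
      rw [mul_assoc, mul_comm Complex.I, Complex.exp_mul_I]
      push_cast
      ring
    simp_rw [h1]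
    rw [integral_add hicos.ofReal (hisin.ofReal.mul_const _), integral_mul_const,
      integral_complex_ofReal, integral_complex_ofReal, hcos, hsin]
    simp
  have hi := integrable_coord_mul_exp hX hη t
  have hsplit : ∫ z, (W z : ℂ) * Complex.exp (Complex.I * t * η z) ∂P
      = targetVector P η t k - ∑ l, (Q k l : ℂ) * targetVector P η t l := by
    have h1 : ∀ z, (W z : ℂ) * Complex.exp (Complex.I * t * η z)
        = (z.1 k : ℂ) * Complex.exp (Complex.I * t * η z)
          - ∑ l, (Q k l : ℂ) * ((z.1 l : ℂ) * Complex.exp (Complex.I * t * η z)) := by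
      intro z
      simp only [hWdef, Matrix.mulVec, dotProduct]
      push_cast
      rw [sub_mul, Finset.sum_mul]
      congr 1
      exact Finset.sum_congr rfl fun l _ => by ring
    simp_rw [h1]
    rw [integral_sub (hi k) (integrable_finsetSum _ fun l _ => (hi l).const_mul _),
      integral_finsetSum _ fun l _ => (hi l).const_mul _]
    congr 1
    exact Finset.sum_congr rfl fun l _ => integral_const_mul _ _
  rw [hsplit] at hexp
  exact sub_eq_zero.mp hexp

/-- Under linearity the rank of the target matrix is at most the indicative dimension. -/
lemma rank_targetMatrix_le
    (hX : MemLp (fun z : EuclideanSpace ℝ (Fin p) × ℝ => z.1) 2 P) (hη : Measurable η)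
    (hlin : LinearityCondition P η)
    (hdr : IsDimensionReductionSubspace P η (centralSubspace P η)) :
    (targetMatrix P η).rank ≤ indicativeDim P η := by
  let b := Module.finBasis ℝ (centralSubspace P η)
  let B : Matrix (Fin p) (Fin (indicativeDim P η)) ℝ := Matrix.of fun i j => (b j : Fin p → ℝ) i
  have hBt : ∀ j, B.transpose j = (b j : Fin p → ℝ) := fun j => rfl
  have hBli : LinearIndependent ℝ B.transpose :=
    b.linearIndependent.map' (centralSubspace P η).subtype (Submodule.ker_subtype _)
  have hBspan : colSpan B = centralSubspace P η := by
    have h1 : Set.range B.transpose = (centralSubspace P η).subtype '' Set.range b := by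
      rw [← Set.range_comp]
      rfl
    rw [colSpan, h1, Submodule.span_image, b.span_eq, Submodule.map_top, Submodule.range_subtype]
  have hci := (hBspan.symm ▸ hdr : IsDimensionReductionSubspace P η (colSpan B)).condIndepFun
  set S := covX P
  set Q : Matrix (Fin p) (Fin p) ℝ := (projMatrix B S).transpose with hQ
  have hm := targetVector_eq_projMatrix_mul hX hη B hci Q (hlin _ B hBli hBspan)
  have hmat : targetMatrix P η = (Q.map Complex.ofRealHom) * targetMatrix P η := by
    ext k l
    rw [Matrix.mul_apply]
    simp only [targetMatrix, Matrix.of_apply, Matrix.map_apply]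
    have hi := integrable_targetVector_mul (P := P) hX hη
    calc _ = ∫ t, ∑ j, (Q k j : ℂ) *
            (targetVector P η t j * starRingEnd ℂ (targetVector P η t l)) ∂(P.map η) := by
          refine integral_congr_ae (ae_of_all _ fun t => ?_)
          simp only
          rw [hm t k, Finset.sum_mul]
          exact Finset.sum_congr rfl fun j _ => mul_assoc _ _ _
      _ = _ := by
          rw [integral_finsetSum _ fun j _ => (hi j l).const_mul _]
          exact Finset.sum_congr rfl fun j _ => integral_const_mul _ _
  have hfac : projMatrix B S = B * ((B.transpose * S * B)⁻¹ * B.transpose * S) := by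
    simp only [projMatrix, Matrix.mul_assoc]
  have hQr : Q.map Complex.ofRealHom = (((B.transpose * S * B)⁻¹ * B.transpose * S).transpose.map
      Complex.ofRealHom) * (B.transpose.map Complex.ofRealHom) := by
    rw [hQ, hfac, Matrix.transpose_mul, Matrix.map_mul]
  rw [hmat]
  calc _ ≤ (Q.map Complex.ofRealHom).rank := Matrix.rank_mul_le_left _ _
    _ ≤ (B.transpose.map Complex.ofRealHom).rank := by
        rw [hQr]; exact Matrix.rank_mul_le_right _ _
    _ ≤ indicativeDim P η := Matrix.rank_le_height _

end TargetMatrix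

/-! ### Chaining -/

section Chaining

variable {Ω : Type*} [MeasurableSpace Ω] {μ : Measure Ω}

/-- A bound for `x` by a slack `s` and a power of `x`, through which a maximum is estimated by a sum
of moments. -/
lemma le_add_pow_div_pow {x s : ℝ} (hx : 0 ≤ x) (hs : 0 < s) (k : ℕ) :
    x ≤ s + x ^ (k + 1) / s ^ k := by
  rcases le_total x s with h | h
  · have : 0 ≤ x ^ (k + 1) / s ^ k := by positivity
    linarith
  · have h1 : x * s ^ k ≤ x ^ (k + 1) := by
      rw [pow_succ, mul_comm]
      exact mul_le_mul_of_nonneg_right (pow_le_pow_left₀ hs.le h k) hx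
    have h2 : x ≤ x ^ (k + 1) / s ^ k := by rwa [le_div_iff₀ (by positivity)]
    linarith

/-- Chaining along projections `π j`: the `j`-th links are finitely many, and at each level the
maximum over the links is bounded through a moment of order `k + 1`. -/
lemma lintegral_sup_le_of_links [IsProbabilityMeasure μ] {E : Type*} [DecidableEq E]
    (S : E → Ω → ℝ) (hS : ∀ t, AEMeasurable (S t) μ)
    (T : Finset E) (t₀ : E) (π : ℕ → E → E) (hπ0 : ∀ t ∈ T, π 0 t = t₀) {K : ℕ}
    (hπK : ∀ t ∈ T, π K t = t) (k : ℕ) (N : ℕ → ℕ) (s B : ℕ → ℝ) (hs : ∀ j, 0 < s j)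
    (hN : ∀ j, (T.image fun t => (π j t, π (j + 1) t)).card ≤ N j)
    (hB : ∀ j, ∀ t ∈ T, ∫⁻ ω, ENNReal.ofReal (|S (π (j + 1) t) ω - S (π j t) ω| ^ (k + 1)) ∂μ
      ≤ ENNReal.ofReal (B j)) (hB0 : ∀ j, 0 ≤ B j) :
    ∫⁻ ω, T.sup (fun t => ENNReal.ofReal |S t ω - S t₀ ω|) ∂μ
      ≤ ENNReal.ofReal (∑ j ∈ Finset.range K, (s j + N j * (B j / s j ^ k))) := by
  classical
  set L : ℕ → Finset (E × E) := fun j => T.image fun t => (π j t, π (j + 1) t) with hL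
  set D : E × E → Ω → ℝ := fun e ω => |S e.2 ω - S e.1 ω| with hD
  have hDm : ∀ e, AEMeasurable (D e) μ := fun e => ((hS e.2).sub (hS e.1)).norm
  have hpt : ∀ ω, T.sup (fun t => ENNReal.ofReal |S t ω - S t₀ ω|)
      ≤ ∑ j ∈ Finset.range K, (ENNReal.ofReal (s j)
          + ∑ e ∈ L j, ENNReal.ofReal (D e ω ^ (k + 1) / s j ^ k)) := by
    intro ω
    refine Finset.sup_le fun t ht => ?_
    have h1 : S t ω - S t₀ ω
        = ∑ j ∈ Finset.range K, (S (π (j + 1) t) ω - S (π j t) ω) := by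
      rw [Finset.sum_range_sub (fun j => S (π j t) ω), hπ0 t ht, hπK t ht]
    have h2 : |S t ω - S t₀ ω| ≤ ∑ j ∈ Finset.range K, (s j
          + ∑ e ∈ L j, D e ω ^ (k + 1) / s j ^ k) := by
      rw [h1]
      refine (Finset.abs_sum_le_sum_abs _ _).trans (Finset.sum_le_sum fun j _ => ?_)
      refine (le_add_pow_div_pow (abs_nonneg _) (hs j) k).trans ?_
      refine add_le_add le_rfl ?_
      have hmem : (π j t, π (j + 1) t) ∈ L j := Finset.mem_image_of_mem _ ht
      refine Finset.single_le_sum (f := fun e => D e ω ^ (k + 1) / s j ^ k) (fun e _ => ?_) hmem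
      have := hs j
      positivity
    refine (ENNReal.ofReal_le_ofReal h2).trans ?_
    rw [ENNReal.ofReal_sum_of_nonneg]
    · refine Finset.sum_le_sum fun j _ => ?_
      have := hs j
      rw [ENNReal.ofReal_add this.le (Finset.sum_nonneg fun e _ => by positivity),
        ENNReal.ofReal_sum_of_nonneg fun e _ => by positivity]
    · intro j _
      have := hs j
      exact add_nonneg this.le (Finset.sum_nonneg fun e _ => by positivity)
  refine (lintegral_mono hpt).trans ?_
  have hm1 : ∀ j e, AEMeasurable (fun ω => ENNReal.ofReal (D e ω ^ (k + 1) / s j ^ k)) μ :=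
    fun j e => (((hDm e).pow_const _).div_const _).ennreal_ofReal
  have hm2 : ∀ j, AEMeasurable
      (fun ω => ∑ e ∈ L j, ENNReal.ofReal (D e ω ^ (k + 1) / s j ^ k)) μ :=
    fun j => Finset.aemeasurable_fun_sum _ fun e _ => hm1 j e
  have hm3 : ∀ j, AEMeasurable (fun ω => ENNReal.ofReal (s j)
      + ∑ e ∈ L j, ENNReal.ofReal (D e ω ^ (k + 1) / s j ^ k)) μ :=
    fun j => aemeasurable_const.add (hm2 j)
  rw [lintegral_finsetSum' _ fun j _ => hm3 j,
    ENNReal.ofReal_sum_of_nonneg]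
  · refine Finset.sum_le_sum fun j _ => ?_
    have hsj := hs j
    have hBj := hB0 j
    rw [lintegral_add_left measurable_const, lintegral_const, measure_univ, mul_one,
      lintegral_finsetSum' _ fun e _ => hm1 j e, ENNReal.ofReal_add hsj.le (by positivity)]
    refine add_le_add le_rfl ?_
    have hterm : ∀ e ∈ L j, ∫⁻ ω, ENNReal.ofReal (D e ω ^ (k + 1) / s j ^ k) ∂μ
        ≤ ENNReal.ofReal (B j / s j ^ k) := by
      intro e he
      obtain ⟨t, ht, rfl⟩ := Finset.mem_image.mp he
      have h3 : ∀ ω, ENNReal.ofReal (D (π j t, π (j + 1) t) ω ^ (k + 1) / s j ^ k)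
          = ENNReal.ofReal (D (π j t, π (j + 1) t) ω ^ (k + 1))
            * ENNReal.ofReal ((s j ^ k)⁻¹) := fun ω => by
        rw [← ENNReal.ofReal_mul (by positivity), div_eq_mul_inv]
      simp_rw [h3]
      rw [lintegral_mul_const'' _ ((hDm _).pow_const _).ennreal_ofReal, div_eq_mul_inv,
        ENNReal.ofReal_mul hBj]
      exact mul_le_mul_left (hB j t ht) _
    refine (Finset.sum_le_sum hterm).trans ?_
    rw [Finset.sum_const, nsmul_eq_mul, ENNReal.ofReal_mul (by positivity),
      ENNReal.ofReal_natCast]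
    exact mul_le_mul_left (by exact_mod_cast hN j) _
  · intro j _
    have hsj := hs j
    have hBj := hB0 j
    positivity

/-- The cell of the grid of mesh `r 2⁻ʲ` around `t₀` that contains `t`. -/
def gridCode {d : ℕ} (t₀ : EuclideanSpace ℝ (Fin d)) (r : ℝ) (j : ℕ)
    (t : EuclideanSpace ℝ (Fin d)) : Fin d → ℤ :=
  fun i => ⌊(t i - t₀ i) * (2 ^ j / r)⌋

lemma gridCode_mem {d : ℕ} {t₀ t : EuclideanSpace ℝ (Fin d)} {r : ℝ} (hr : 0 < r)
    (ht : ‖t - t₀‖ ≤ r) (j : ℕ) :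
    gridCode t₀ r j t ∈ Fintype.piFinset fun _ : Fin d => Finset.Icc (-(2 ^ j) : ℤ) (2 ^ j) := by
  rw [Fintype.mem_piFinset]
  intro i
  have h1 : |t i - t₀ i| ≤ r := (PiLp.norm_apply_le (t - t₀) i).trans ht
  have h2 : |(t i - t₀ i) * (2 ^ j / r)| ≤ 2 ^ j := by
    rw [abs_mul, abs_of_pos (by positivity : (0 : ℝ) < 2 ^ j / r)]
    calc _ ≤ r * (2 ^ j / r) := mul_le_mul_of_nonneg_right h1 (by positivity)
      _ = 2 ^ j := by field_simp
  rw [abs_le] at h2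
  rw [Finset.mem_Icc, gridCode, Int.le_floor]
  refine ⟨by push_cast; exact h2.1, ?_⟩
  have h3 : ((⌊(t i - t₀ i) * (2 ^ j / r)⌋ : ℤ) : ℝ) ≤ ((2 ^ j : ℤ) : ℝ) :=
    (Int.floor_le _).trans (by push_cast; exact h2.2)
  exact_mod_cast h3

/-- The grid at level `j` has at most `(3 · 2ʲ)ᵈ` cells in the ball of radius `r`. -/
lemma card_gridCodes_le (d j : ℕ) :
    (Fintype.piFinset fun _ : Fin d => Finset.Icc (-(2 ^ j) : ℤ) (2 ^ j)).card
      ≤ (3 * 2 ^ j) ^ d := by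
  rw [Fintype.card_piFinset, Finset.prod_const, Finset.card_univ, Fintype.card_fin]
  refine Nat.pow_le_pow_left ?_ d
  rw [Int.card_Icc]
  have : (1 : ℤ) ≤ 2 ^ j := one_le_pow₀ (by norm_num)
  zify
  rw [Int.toNat_of_nonneg (by linarith)]
  linarith

lemma norm_sub_le_of_gridCode_eq {d : ℕ} {t₀ s t : EuclideanSpace ℝ (Fin d)} {r : ℝ}
    (hr : 0 < r) {j : ℕ} (h : gridCode t₀ r j s = gridCode t₀ r j t) :
    ‖s - t‖ ≤ Real.sqrt d * (r / 2 ^ j) := by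
  have hpos : (0 : ℝ) < 2 ^ j / r := by positivity
  have h1 : ∀ i, (s i - t i) ^ 2 ≤ (r / 2 ^ j) ^ 2 := by
    intro i
    have h2 := Int.abs_sub_lt_one_of_floor_eq_floor (congrFun h i)
    have h3 : (s i - t₀ i) * (2 ^ j / r) - (t i - t₀ i) * (2 ^ j / r)
        = (s i - t i) * (2 ^ j / r) := by ring
    rw [h3, abs_mul, abs_of_pos hpos, ← lt_div_iff₀ hpos, one_div_div] at h2
    exact sq_le_sq' (by linarith [neg_abs_le (s i - t i)]) (by linarith [le_abs_self (s i - t i)])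
  rw [EuclideanSpace.norm_eq]
  calc Real.sqrt (∑ i, ‖(s - t) i‖ ^ 2) ≤ Real.sqrt (d * (r / 2 ^ j) ^ 2) := by
        refine Real.sqrt_le_sqrt ?_
        calc ∑ i, ‖(s - t) i‖ ^ 2 ≤ ∑ _i : Fin d, (r / 2 ^ j) ^ 2 := by
              refine Finset.sum_le_sum fun i _ => ?_
              rw [Real.norm_eq_abs, sq_abs]
              exact h1 i
          _ = d * (r / 2 ^ j) ^ 2 := by simp
    _ = Real.sqrt d * (r / 2 ^ j) := by
        rw [Real.sqrt_mul (by positivity), Real.sqrt_sq (by positivity)]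

/-- The constant in the maximal inequality `lintegral_sup_le_of_moment_increments`. -/
def chainingConst (d : ℕ) (A : ℝ) : ℝ :=
  3 + 2 * (6 ^ d * 3 ^ d * A * (2 * Real.sqrt d + 1) ^ (5 * d + 1))

/-- **Maximal inequality by chaining.** If the increments of a process indexed by a subset of
`ℝᵈ` have moments of order `5 d + 1` controlled by the distance, then the expected maximal increment
over a finite set of radius `r` is of order `r`, uniformly in the cardinality. -/
lemma lintegral_sup_le_of_moment_increments [IsProbabilityMeasure μ] {d : ℕ}
    (S : EuclideanSpace ℝ (Fin d) → Ω → ℝ) (hS : ∀ t, AEMeasurable (S t) μ)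
    {Θ : Set (EuclideanSpace ℝ (Fin d))} {A : ℝ} (hA : 0 ≤ A)
    (hinc : ∀ s ∈ Θ, ∀ t ∈ Θ, ∫⁻ ω, ENNReal.ofReal (|S s ω - S t ω| ^ (5 * d + 1)) ∂μ
      ≤ ENNReal.ofReal (A * ‖s - t‖ ^ (5 * d + 1)))
    (T : Finset (EuclideanSpace ℝ (Fin d))) {t₀ : EuclideanSpace ℝ (Fin d)} (ht₀ : t₀ ∈ Θ)
    (hT : ∀ t ∈ T, t ∈ Θ) {r : ℝ} (hr : 0 < r) (hTr : ∀ t ∈ T, ‖t - t₀‖ ≤ r) :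
    ∫⁻ ω, T.sup (fun t => ENNReal.ofReal |S t ω - S t₀ ω|) ∂μ
      ≤ ENNReal.ofReal (chainingConst d A * r) := by
  classical
  -- `rep j c` is a point of `T` in the cell `c`
  let rep : ℕ → (Fin d → ℤ) → EuclideanSpace ℝ (Fin d) := fun j c =>
    if h : ∃ t ∈ T, gridCode t₀ r j t = c then h.choose else t₀
  have hrep : ∀ j, ∀ t ∈ T, rep j (gridCode t₀ r j t) ∈ T ∧
      gridCode t₀ r j (rep j (gridCode t₀ r j t)) = gridCode t₀ r j t := by
    intro j t ht
    have h : ∃ s ∈ T, gridCode t₀ r j s = gridCode t₀ r j t := ⟨t, ht, rfl⟩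
    have h1 : rep j (gridCode t₀ r j t) = h.choose := dif_pos h
    rw [h1]
    exact h.choose_spec
  let ρ : ℕ → (Fin d → ℤ) → EuclideanSpace ℝ (Fin d) := fun j c => if j = 0 then t₀ else rep j c
  let π : ℕ → EuclideanSpace ℝ (Fin d) → EuclideanSpace ℝ (Fin d) :=
    fun j t => ρ j (gridCode t₀ r j t)
  have hdist : ∀ j, ∀ t ∈ T, ‖π j t - t‖ ≤ (Real.sqrt d + (if j = 0 then 1 else 0)) *
      (r / 2 ^ j) := by
    intro j t ht
    by_cases hj : j = 0
    · subst hj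
      have h1 : π 0 t = t₀ := if_pos rfl
      rw [h1, norm_sub_rev]
      have := hTr t ht
      have h2 : 0 ≤ Real.sqrt d * r := by positivity
      simp only [if_true, pow_zero, div_one]
      linarith
    · have h1 : π j t = rep j (gridCode t₀ r j t) := if_neg hj
      rw [h1, if_neg hj, add_zero]
      exact norm_sub_le_of_gridCode_eq hr (hrep j t ht).2
  have hmemΘ : ∀ j, ∀ t ∈ T, π j t ∈ Θ := by
    intro j t ht
    by_cases hj : j = 0
    · have h1 : π j t = t₀ := if_pos hj
      rw [h1]; exact ht₀
    · have h1 : π j t = rep j (gridCode t₀ r j t) := if_neg hj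
      rw [h1]; exact hT _ (hrep j t ht).1
  -- a level at which the grid separates the points of `T`
  obtain ⟨K, hK⟩ : ∃ K : ℕ, ∀ t ∈ T, π K t = t := by
    have hsep : ∃ δ : ℝ, 0 < δ ∧ ∀ s ∈ T, ∀ t ∈ T, ‖s - t‖ < δ → s = t := by
      set F : Finset ℝ := ((T ×ˢ T).filter fun e => e.1 ≠ e.2).image fun e => ‖e.1 - e.2‖ with hF
      by_cases hFe : F.Nonempty
      · refine ⟨F.min' hFe, ?_, fun s hs t ht hlt => ?_⟩
        · obtain ⟨e, he, heq⟩ := Finset.mem_image.mp (F.min'_mem hFe)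
          rw [← heq, norm_pos_iff, sub_ne_zero]
          exact (Finset.mem_filter.mp he).2
        · by_contra hne
          have : ‖s - t‖ ∈ F := Finset.mem_image.mpr
            ⟨(s, t), Finset.mem_filter.mpr ⟨Finset.mk_mem_product hs ht, hne⟩, rfl⟩
          exact absurd (F.min'_le _ this) (not_le.mpr hlt)
      · refine ⟨1, one_pos, fun s hs t ht _ => ?_⟩
        by_contra hne
        exact hFe ⟨‖s - t‖, Finset.mem_image.mpr
          ⟨(s, t), Finset.mem_filter.mpr ⟨Finset.mk_mem_product hs ht, hne⟩, rfl⟩⟩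
    obtain ⟨δ, hδ, hδT⟩ := hsep
    have hlim : Tendsto (fun j : ℕ => Real.sqrt d * (r / 2 ^ j)) atTop (𝓝 0) := by
      have h1 : Tendsto (fun j : ℕ => Real.sqrt d * r * (1 / 2 : ℝ) ^ j) atTop (𝓝 0) := by
        simpa using (tendsto_pow_atTop_nhds_zero_of_lt_one (by norm_num : (0 : ℝ) ≤ 1 / 2)
          (by norm_num)).const_mul (Real.sqrt d * r)
      refine h1.congr fun j => ?_
      rw [one_div, inv_pow]
      ring
    obtain ⟨K, hK1, hK2⟩ := ((hlim.eventually_lt_const hδ).and (eventually_ge_atTop 1)).exists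
    refine ⟨K, fun t ht => ?_⟩
    have hK0 : K ≠ 0 := by omega
    have h1 : π K t = rep K (gridCode t₀ r K t) := if_neg hK0
    refine hδT _ (by rw [h1]; exact (hrep K t ht).1) _ ht ?_
    have h2 := hdist K t ht
    rw [if_neg hK0, add_zero] at h2
    exact h2.trans_lt hK1
  set D : ℝ := 2 * Real.sqrt d + 1 with hD
  have hD0 : 0 < D := by positivity
  have hlink : ∀ j, ∀ t ∈ T, ‖π (j + 1) t - π j t‖ ≤ D * (r / 2 ^ j) := by
    intro j t ht
    have h1 := hdist j t ht
    have h2 := hdist (j + 1) t ht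
    rw [if_neg (Nat.succ_ne_zero j), add_zero] at h2
    have h3 : ‖π (j + 1) t - π j t‖ ≤ ‖π (j + 1) t - t‖ + ‖π j t - t‖ := by
      rw [norm_sub_rev (π j t) t]
      exact norm_sub_le_norm_sub_add_norm_sub _ _ _
    have h4 : (Real.sqrt d + (if j = 0 then 1 else 0)) * (r / 2 ^ j)
        ≤ (Real.sqrt d + 1) * (r / 2 ^ j) := by
      refine mul_le_mul_of_nonneg_right ?_ (by positivity)
      split_ifs <;> linarith
    have h5 : Real.sqrt d * (r / 2 ^ (j + 1)) ≤ Real.sqrt d * (r / 2 ^ j) := by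
      refine mul_le_mul_of_nonneg_left ?_ (Real.sqrt_nonneg _)
      exact div_le_div_of_nonneg_left hr.le (by positivity)
        (pow_le_pow_right₀ (by norm_num) (Nat.le_succ j))
    calc _ ≤ Real.sqrt d * (r / 2 ^ j) + (Real.sqrt d + 1) * (r / 2 ^ j) := by linarith
      _ = D * (r / 2 ^ j) := by rw [hD]; ring
  set N : ℕ → ℕ := fun j => (3 * 2 ^ j) ^ d * (3 * 2 ^ (j + 1)) ^ d with hN
  have hcard : ∀ j, (T.image fun t => (π j t, π (j + 1) t)).card ≤ N j := by
    intro j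
    set box : ℕ → Finset (Fin d → ℤ) :=
      fun j => Fintype.piFinset fun _ : Fin d => Finset.Icc (-(2 ^ j) : ℤ) (2 ^ j) with hbox
    have hsub : (T.image fun t => (π j t, π (j + 1) t))
        ⊆ (box j ×ˢ box (j + 1)).image fun c => (ρ j c.1, ρ (j + 1) c.2) := by
      intro e he
      obtain ⟨t, ht, rfl⟩ := Finset.mem_image.mp he
      exact Finset.mem_image.mpr ⟨(gridCode t₀ r j t, gridCode t₀ r (j + 1) t),
        Finset.mk_mem_product (gridCode_mem hr (hTr t ht) j) (gridCode_mem hr (hTr t ht) (j + 1)),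
        rfl⟩
    refine (Finset.card_le_card hsub).trans (Finset.card_image_le.trans ?_)
    rw [Finset.card_product]
    exact Nat.mul_le_mul (card_gridCodes_le d j) (card_gridCodes_le d (j + 1))
  -- the slacks `r (2/3)ʲ` are summable, and decay more slowly than the lengths `D r 2⁻ʲ` of the links
  have hmain := lintegral_sup_le_of_links (μ := μ) S hS T t₀ π (fun t _ => if_pos rfl) hK (5 * d) N
    (fun j => r * (2 / 3) ^ j) (fun j => A * (D * (r / 2 ^ j)) ^ (5 * d + 1))
    (fun j => by positivity) hcard
    (fun j t ht => (hinc _ (hmemΘ _ t ht) _ (hmemΘ _ t ht)).trans (ENNReal.ofReal_le_ofReal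
      (mul_le_mul_of_nonneg_left (pow_le_pow_left₀ (norm_nonneg _) (hlink j t ht) _) hA)))
    (fun j => by positivity)
  refine hmain.trans (ENNReal.ofReal_le_ofReal ?_)
  -- the entropy `4ᵈʲ` is beaten by the gain `(3/4)⁵ᵈʲ` of the higher moments
  have hterm : ∀ j, (N j : ℝ) * (A * (D * (r / 2 ^ j)) ^ (5 * d + 1) / (r * (2 / 3) ^ j) ^ (5 * d))
      ≤ 6 ^ d * 3 ^ d * A * D ^ (5 * d + 1) * r * (1 / 2) ^ j := by
    intro j
    have e1 : (N j : ℝ) = 6 ^ d * 3 ^ d * (4 ^ j) ^ d := by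
      simp only [hN]
      push_cast
      rw [← mul_pow, ← mul_pow, ← mul_pow]
      congr 1
      have : (4 : ℝ) ^ j = 2 ^ j * 2 ^ j := by rw [← mul_pow]; norm_num
      rw [this, pow_succ]
      ring
    have e2 : A * (D * (r / 2 ^ j)) ^ (5 * d + 1) / (r * (2 / 3) ^ j) ^ (5 * d)
        = A * D ^ (5 * d + 1) * r * (1 / 2) ^ j * (((3 / 4) ^ 5) ^ j) ^ d := by
      have h1 : (((3 / 4 : ℝ) ^ 5) ^ j) ^ d = (((1 / 2) ^ j) / ((2 / 3) ^ j)) ^ (5 * d) := by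
        have h0 : (1 / 2 : ℝ) ^ j / (2 / 3) ^ j = (3 / 4) ^ j := by
          rw [← div_pow]; norm_num
        rw [h0, ← pow_mul, ← pow_mul, ← pow_mul]
        congr 1
        ring
      have h2 : r / 2 ^ j = r * (1 / 2) ^ j := by
        rw [one_div, inv_pow]; rfl
      rw [h1, h2, pow_succ]
      have h3 : (D * (r * (1 / 2) ^ j)) ^ (5 * d) / (r * (2 / 3) ^ j) ^ (5 * d)
          = D ^ (5 * d) * (((1 / 2) ^ j) / ((2 / 3) ^ j)) ^ (5 * d) := by
        rw [← div_pow, ← mul_pow]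
        congr 1
        field_simp
      calc _ = A * (D * (r * (1 / 2) ^ j)) *
            ((D * (r * (1 / 2) ^ j)) ^ (5 * d) / (r * (2 / 3) ^ j) ^ (5 * d)) := by ring
        _ = _ := by rw [h3]; ring
    rw [e1, e2]
    have e3 : ((4 : ℝ) ^ j) ^ d * (((3 / 4) ^ 5) ^ j) ^ d ≤ 1 := by
      rw [← mul_pow, ← mul_pow]
      exact pow_le_one₀ (by positivity) (pow_le_one₀ (by norm_num) (by norm_num))
    calc _ = 6 ^ d * 3 ^ d * A * D ^ (5 * d + 1) * r * (1 / 2) ^ j *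
          (((4 : ℝ) ^ j) ^ d * (((3 / 4) ^ 5) ^ j) ^ d) := by ring
      _ ≤ _ := mul_le_of_le_one_right (by positivity) e3
  have hg1 : ∑ j ∈ Finset.range K, (2 / 3 : ℝ) ^ j ≤ 3 := by
    rw [geom_sum_eq (by norm_num)]
    have : (0 : ℝ) ≤ (2 / 3) ^ K := by positivity
    norm_num
    linarith
  have hg2 : ∑ j ∈ Finset.range K, (1 / 2 : ℝ) ^ j ≤ 2 := by
    rw [geom_sum_eq (by norm_num), div_le_iff_of_neg (by norm_num)]
    have : (0 : ℝ) ≤ (1 / 2) ^ K := by positivity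
    linarith
  calc _ ≤ ∑ j ∈ Finset.range K, (r * (2 / 3) ^ j
          + 6 ^ d * 3 ^ d * A * D ^ (5 * d + 1) * r * (1 / 2) ^ j) :=
        Finset.sum_le_sum fun j _ => add_le_add le_rfl (hterm j)
    _ = r * ∑ j ∈ Finset.range K, (2 / 3 : ℝ) ^ j + 6 ^ d * 3 ^ d * A * D ^ (5 * d + 1) * r *
          ∑ j ∈ Finset.range K, (1 / 2 : ℝ) ^ j := by
        rw [Finset.sum_add_distrib, Finset.mul_sum, Finset.mul_sum]
    _ ≤ r * 3 + 6 ^ d * 3 ^ d * A * D ^ (5 * d + 1) * r * 2 :=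
        add_le_add (mul_le_mul_of_nonneg_left hg1 hr.le)
          (mul_le_mul_of_nonneg_left hg2 (by positivity))
    _ = chainingConst d A * r := by rw [chainingConst, hD]; ring

end Chaining

/-! ### Moments of bounded independent sums -/

section Bernstein

variable {Ω : Type*} [MeasurableSpace Ω] {μ : Measure Ω} [IsProbabilityMeasure μ]

/-- The exponential moment estimate behind Bernstein's inequality. -/
lemma mgf_one_le_exp {X : Ω → ℝ} (hm : AEMeasurable X μ) (hb : ∀ ω, |X ω| ≤ 1)
    (h0 : ∫ ω, X ω ∂μ = 0) {v : ℝ} (hv : ∫ ω, X ω ^ 2 ∂μ ≤ v) : mgf X μ 1 ≤ Real.exp v := by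
  have hXi : Integrable X μ := Integrable.of_bound (C := 1) hm.aestronglyMeasurable (ae_of_all _ hb)
  have hX2 : Integrable (fun ω => X ω ^ 2) μ :=
    Integrable.of_bound (C := 1) (hm.pow_const 2).aestronglyMeasurable (ae_of_all _ fun ω => by
      rw [norm_pow]; exact pow_le_one₀ (norm_nonneg _) (hb ω))
  have hle : ∀ ω, Real.exp (1 * X ω) ≤ 1 + X ω + X ω ^ 2 := fun ω => by
    have := (abs_le.mp (Real.abs_exp_sub_one_sub_id_le (hb ω))).2
    rw [one_mul]; linarith
  have hei : Integrable (fun ω => Real.exp (1 * X ω)) μ :=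
    Integrable.of_bound (C := Real.exp 1)
      (Real.measurable_exp.comp_aemeasurable (hm.const_mul 1)).aestronglyMeasurable
      (ae_of_all _ fun ω => by
        rw [Real.norm_of_nonneg (Real.exp_nonneg _), one_mul]
        exact Real.exp_le_exp.mpr ((le_abs_self _).trans (hb ω)))
  have h1i : Integrable (fun ω => 1 + X ω) μ := (integrable_const 1).add hXi
  calc mgf X μ 1 ≤ ∫ ω, (1 + X ω + X ω ^ 2) ∂μ := integral_mono hei (h1i.add hX2) hle
    _ = 1 + ∫ ω, X ω ^ 2 ∂μ := by
        rw [integral_add h1i hX2, integral_add (integrable_const 1) hXi, h0]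
        simp
    _ ≤ 1 + v := by linarith
    _ ≤ Real.exp v := by linarith [Real.add_one_le_exp v]

/-- All moments of a sum of `n` independent centred variables bounded by one are controlled by `n`
times the variance. -/
lemma lintegral_abs_sum_pow_le {ξ : ℕ → Ω → ℝ} (hind : iIndepFun ξ μ)
    (hm : ∀ j, AEMeasurable (ξ j) μ) (hb : ∀ j ω, |ξ j ω| ≤ 1) (h0 : ∀ j, ∫ ω, ξ j ω ∂μ = 0)
    {v : ℝ} (hv : ∀ j, ∫ ω, ξ j ω ^ 2 ∂μ ≤ v) (n k : ℕ) :
    ∫⁻ ω, ENNReal.ofReal (|∑ j ∈ Finset.range n, ξ j ω| ^ k) ∂μ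
      ≤ ENNReal.ofReal (k.factorial * (2 * Real.exp (n * v))) := by
  set Sn : Ω → ℝ := fun ω => ∑ j ∈ Finset.range n, ξ j ω with hSn
  have hSnm : AEMeasurable Sn μ := Finset.aemeasurable_fun_sum _ fun j _ => hm j
  have hSnb : ∀ ω, |Sn ω| ≤ n := fun ω => by
    refine (Finset.abs_sum_le_sum_abs _ _).trans ?_
    refine (Finset.sum_le_sum fun j _ => hb j ω).trans ?_
    simp
  have hexp : ∀ ζ : ℕ → Ω → ℝ, iIndepFun ζ μ → (∀ j, AEMeasurable (ζ j) μ) →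
      (∀ j ω, |ζ j ω| ≤ 1) → (∀ j, ∫ ω, ζ j ω ∂μ = 0) → (∀ j, ∫ ω, ζ j ω ^ 2 ∂μ ≤ v) →
      ∫ ω, Real.exp (∑ j ∈ Finset.range n, ζ j ω) ∂μ ≤ Real.exp (n * v) := by
    intro ζ hi hzm hzb hz0 hzv
    have h1 : ∫ ω, Real.exp (∑ j ∈ Finset.range n, ζ j ω) ∂μ
        = mgf (∑ j ∈ Finset.range n, ζ j) μ 1 := by
      simp [mgf, Finset.sum_apply]
    rw [h1, hi.mgf_sum₀ hzm]
    calc _ ≤ ∏ _j ∈ Finset.range n, Real.exp v :=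
          Finset.prod_le_prod (fun j _ => mgf_nonneg)
            fun j _ => mgf_one_le_exp (hzm j) (hzb j) (hz0 j) (hzv j)
      _ = Real.exp (n * v) := by
          rw [Finset.prod_const, Finset.card_range, ← Real.exp_nat_mul]
  have hp : ∫ ω, Real.exp (Sn ω) ∂μ ≤ Real.exp (n * v) := hexp ξ hind hm hb h0 hv
  have hn : ∫ ω, Real.exp (-Sn ω) ∂μ ≤ Real.exp (n * v) := by
    have := hexp (fun j ω => -ξ j ω) (hind.comp (fun _ x => -x) fun _ => measurable_neg)
      (fun j => (hm j).neg) (fun j ω => by rw [abs_neg]; exact hb j ω)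
      (fun j => by rw [integral_neg, h0, neg_zero]) (fun j => by simpa using hv j)
    simpa [hSn, Finset.sum_neg_distrib] using this
  have hei : ∀ s : ℝ, |s| = 1 → Integrable (fun ω => Real.exp (s * Sn ω)) μ := fun s hs =>
    Integrable.of_bound (C := Real.exp n)
      (Real.measurable_exp.comp_aemeasurable (hSnm.const_mul s)).aestronglyMeasurable
      (ae_of_all _ fun ω => by
        rw [Real.norm_of_nonneg (Real.exp_nonneg _)]
        refine Real.exp_le_exp.mpr ((le_abs_self _).trans ?_)
        rw [abs_mul, hs, one_mul]
        exact hSnb ω)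
  have hpi : Integrable (fun ω => Real.exp (Sn ω)) μ := by simpa using hei 1 (by simp)
  have hni : Integrable (fun ω => Real.exp (-Sn ω)) μ := by simpa using hei (-1) (by simp)
  have hle : ∀ ω, |Sn ω| ^ k ≤ k.factorial * (Real.exp (Sn ω) + Real.exp (-Sn ω)) := by
    intro ω
    have h1 := Real.pow_div_factorial_le_exp _ (abs_nonneg (Sn ω)) k
    rw [div_le_iff₀ (by positivity)] at h1
    have h2 := Real.exp_abs_le (Sn ω)
    have h3 : (0 : ℝ) ≤ k.factorial := by positivity
    nlinarith
  have hint : Integrable (fun ω => (k.factorial : ℝ) * (Real.exp (Sn ω) + Real.exp (-Sn ω))) μ :=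
    (hpi.add hni).const_mul _
  calc _ ≤ ∫⁻ ω, ENNReal.ofReal (k.factorial * (Real.exp (Sn ω) + Real.exp (-Sn ω))) ∂μ :=
        lintegral_mono fun ω => ENNReal.ofReal_le_ofReal (hle ω)
    _ = ENNReal.ofReal (∫ ω, k.factorial * (Real.exp (Sn ω) + Real.exp (-Sn ω)) ∂μ) :=
        (ofReal_integral_eq_lintegral_ofReal hint (ae_of_all _ fun ω => by positivity)).symm
    _ ≤ _ := by
        refine ENNReal.ofReal_le_ofReal ?_
        rw [integral_const_mul, integral_add hpi hni]
        refine mul_le_mul_of_nonneg_left ?_ (by positivity)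
        linarith

end Bernstein

/-! ### The empirical process of a Lipschitz family -/

section EmpiricalMeans

variable {Ω 𝓩 : Type*} [MeasurableSpace Ω] {μ : Measure Ω} [IsProbabilityMeasure μ]
  [MeasurableSpace 𝓩] {P : Measure 𝓩} [IsProbabilityMeasure P] {d : ℕ}

/-- The increment `f θ - f θ₀`, cut off where the Lipschitz constant `L` exceeds `√n`. -/
def truncIncr (f : EuclideanSpace ℝ (Fin d) → 𝓩 → ℝ) (L : 𝓩 → ℝ)
    (θ₀ : EuclideanSpace ℝ (Fin d)) (n : ℕ) (θ : EuclideanSpace ℝ (Fin d)) : 𝓩 → ℝ :=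
  {z | L z ≤ Real.sqrt n}.indicator fun z => f θ z - f θ₀ z

/-- The empirical process `n^{-1/2} ∑ⱼ (h θ (Zⱼ) - E h θ)` of the truncated increments `h θ`. -/
def truncSum (P : Measure 𝓩) (f : EuclideanSpace ℝ (Fin d) → 𝓩 → ℝ) (L : 𝓩 → ℝ)
    (θ₀ : EuclideanSpace ℝ (Fin d)) (Z : ℕ → Ω → 𝓩) (n : ℕ) (θ : EuclideanSpace ℝ (Fin d))
    (ω : Ω) : ℝ :=
  (Real.sqrt n)⁻¹ * ∑ j ∈ Finset.range n,
    (truncIncr f L θ₀ n θ (Z j ω) - ∫ z, truncIncr f L θ₀ n θ z ∂P)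

variable {f : EuclideanSpace ℝ (Fin d) → 𝓩 → ℝ} {L : 𝓩 → ℝ} {θ₀ : EuclideanSpace ℝ (Fin d)}
  {Θ : Set (EuclideanSpace ℝ (Fin d))} {Z : ℕ → Ω → 𝓩}

lemma measurable_truncIncr (hf : ∀ θ, Measurable (f θ)) (hL : Measurable L) (n : ℕ)
    (θ : EuclideanSpace ℝ (Fin d)) : Measurable (truncIncr f L θ₀ n θ) :=
  ((hf θ).sub (hf θ₀)).indicator (measurableSet_le hL measurable_const)

omit [MeasurableSpace 𝓩] in
lemma abs_truncIncr_sub_le (hlip : ∀ z, ∀ s ∈ Θ, ∀ t ∈ Θ, |f s z - f t z| ≤ L z * ‖s - t‖)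
    (hL0 : ∀ z, 0 ≤ L z) (n : ℕ) {s t : EuclideanSpace ℝ (Fin d)} (hs : s ∈ Θ) (ht : t ∈ Θ)
    (z : 𝓩) :
    |truncIncr f L θ₀ n s z - truncIncr f L θ₀ n t z| ≤ min (Real.sqrt n) (L z) * ‖s - t‖ := by
  unfold truncIncr
  by_cases hz : z ∈ {z | L z ≤ Real.sqrt n}
  · rw [Set.indicator_of_mem hz, Set.indicator_of_mem hz, sub_sub_sub_cancel_right,
      min_eq_right hz]
    exact hlip z s hs t ht
  · rw [Set.indicator_of_notMem hz, Set.indicator_of_notMem hz, sub_zero, abs_zero]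
    have := hL0 z
    positivity

omit [MeasurableSpace 𝓩] in
lemma truncIncr_self (n : ℕ) (z : 𝓩) : truncIncr f L θ₀ n θ₀ z = 0 := by
  simp [truncIncr]

lemma integrable_truncIncr (hf : ∀ θ, Measurable (f θ)) (hL : Measurable L)
    (hlip : ∀ z, ∀ s ∈ Θ, ∀ t ∈ Θ, |f s z - f t z| ≤ L z * ‖s - t‖) (hL0 : ∀ z, 0 ≤ L z)
    (hθ₀ : θ₀ ∈ Θ) (n : ℕ) {s : EuclideanSpace ℝ (Fin d)} (hs : s ∈ Θ) :
    Integrable (truncIncr f L θ₀ n s) P := by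
  refine Integrable.of_bound (C := Real.sqrt n * ‖s - θ₀‖)
    (measurable_truncIncr hf hL n s).aestronglyMeasurable (ae_of_all _ fun z => ?_)
  have h := abs_truncIncr_sub_le (θ₀ := θ₀) hlip hL0 n hs hθ₀ z
  rw [truncIncr_self, sub_zero] at h
  exact h.trans (mul_le_mul_of_nonneg_right (min_le_left _ _) (norm_nonneg _))

omit [MeasurableSpace Ω] [IsProbabilityMeasure P] in
lemma truncSum_self (n : ℕ) (ω : Ω) : truncSum P f L θ₀ Z n θ₀ ω = 0 := by
  simp [truncSum, truncIncr_self]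

omit [IsProbabilityMeasure μ] [IsProbabilityMeasure P] in
lemma aemeasurable_truncSum (hf : ∀ θ, Measurable (f θ)) (hL : Measurable L)
    (hZ : ∀ j, AEMeasurable (Z j) μ) (n : ℕ) (θ : EuclideanSpace ℝ (Fin d)) :
    AEMeasurable (truncSum P f L θ₀ Z n θ) μ := by
  unfold truncSum
  exact (Finset.aemeasurable_fun_sum _ fun j _ =>
    ((measurable_truncIncr hf hL n θ).comp_aemeasurable (hZ j)).sub_const _).const_mul _

omit [MeasurableSpace Ω] in
lemma truncSum_sub_eq (hf : ∀ θ, Measurable (f θ)) (hL : Measurable L)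
    (hlip : ∀ z, ∀ s ∈ Θ, ∀ t ∈ Θ, |f s z - f t z| ≤ L z * ‖s - t‖) (hL0 : ∀ z, 0 ≤ L z)
    (hθ₀ : θ₀ ∈ Θ) (n : ℕ) {s t : EuclideanSpace ℝ (Fin d)} (hs : s ∈ Θ) (ht : t ∈ Θ) (ω : Ω) :
    truncSum P f L θ₀ Z n s ω - truncSum P f L θ₀ Z n t ω
      = (Real.sqrt n)⁻¹ * ∑ j ∈ Finset.range n,
        ((truncIncr f L θ₀ n s (Z j ω) - truncIncr f L θ₀ n t (Z j ω))
          - ∫ z, (truncIncr f L θ₀ n s z - truncIncr f L θ₀ n t z) ∂P) := by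
  rw [integral_sub (integrable_truncIncr hf hL hlip hL0 hθ₀ n hs)
    (integrable_truncIncr hf hL hlip hL0 hθ₀ n ht)]
  unfold truncSum
  rw [← mul_sub, ← Finset.sum_sub_distrib]
  congr 1
  exact Finset.sum_congr rfl fun j _ => by ring

lemma abs_centred_le (hlip : ∀ z, ∀ s ∈ Θ, ∀ t ∈ Θ, |f s z - f t z| ≤ L z * ‖s - t‖)
    (hL0 : ∀ z, 0 ≤ L z) (n : ℕ) {s t : EuclideanSpace ℝ (Fin d)} (hs : s ∈ Θ) (ht : t ∈ Θ)
    (z : 𝓩) :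
    |(truncIncr f L θ₀ n s z - truncIncr f L θ₀ n t z)
      - ∫ z, (truncIncr f L θ₀ n s z - truncIncr f L θ₀ n t z) ∂P|
      ≤ 2 * (Real.sqrt n * ‖s - t‖) := by
  have h1 : ∀ z, |truncIncr f L θ₀ n s z - truncIncr f L θ₀ n t z| ≤ Real.sqrt n * ‖s - t‖ :=
    fun z => (abs_truncIncr_sub_le hlip hL0 n hs ht z).trans
      (mul_le_mul_of_nonneg_right (min_le_left _ _) (norm_nonneg _))
  have h2 : |∫ z, (truncIncr f L θ₀ n s z - truncIncr f L θ₀ n t z) ∂P|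
      ≤ Real.sqrt n * ‖s - t‖ := by
    have := norm_integral_le_of_norm_le_const (μ := P)
      (ae_of_all P fun z => (Real.norm_eq_abs _).trans_le (h1 z))
    simpa using this
  refine (abs_sub _ _).trans ?_
  linarith [h1 z]

/-- The moments of the increments of the truncated process are of the order of the powers of the
distance of the parameters, uniformly in `n`: after division by `2 √n ‖s - t‖` the summands are bounded
by one, and have variance of order `n⁻¹`. -/
lemma lintegral_truncSum_increment_le (hf : ∀ θ, Measurable (f θ)) (hL : Measurable L)
    (hlip : ∀ z, ∀ s ∈ Θ, ∀ t ∈ Θ, |f s z - f t z| ≤ L z * ‖s - t‖) (hL0 : ∀ z, 0 ≤ L z)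
    (hL2 : Integrable (fun z => L z ^ 2) P) (hθ₀ : θ₀ ∈ Θ)
    (hind : iIndepFun Z μ) (hlaw : ∀ j, HasLaw (Z j) P μ) {n : ℕ} (hn : 0 < n) (k : ℕ)
    {s t : EuclideanSpace ℝ (Fin d)} (hs : s ∈ Θ) (ht : t ∈ Θ) :
    ∫⁻ ω, ENNReal.ofReal (|truncSum P f L θ₀ Z n s ω - truncSum P f L θ₀ Z n t ω| ^ k) ∂μ
      ≤ ENNReal.ofReal (2 ^ k * (k.factorial * (2 * Real.exp (∫ z, L z ^ 2 ∂P))) * ‖s - t‖ ^ k) := by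
  set W : 𝓩 → ℝ := fun z => (truncIncr f L θ₀ n s z - truncIncr f L θ₀ n t z)
      - ∫ z, (truncIncr f L θ₀ n s z - truncIncr f L θ₀ n t z) ∂P with hW
  have hWm : Measurable W :=
    ((measurable_truncIncr hf hL n s).sub (measurable_truncIncr hf hL n t)).sub_const _
  have hnpos : (0 : ℝ) < n := by exact_mod_cast hn
  have hsn : 0 < Real.sqrt n := Real.sqrt_pos.mpr hnpos
  have hWb : ∀ z, |W z| ≤ 2 * (Real.sqrt n * ‖s - t‖) := abs_centred_le hlip hL0 n hs ht
  rcases eq_or_ne s t with rfl | hst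
  · simp only [sub_self, abs_zero, norm_zero]
    rcases k with _ | k
    · simp only [pow_zero, mul_one, lintegral_const, measure_univ]
      refine ENNReal.ofReal_le_ofReal ?_
      have : 1 ≤ Real.exp (∫ z, L z ^ 2 ∂P) :=
        Real.one_le_exp (integral_nonneg fun _ => by positivity)
      simp
      linarith
    · simp
  have hst' : 0 < ‖s - t‖ := norm_pos_iff.mpr (sub_ne_zero.mpr hst)
  set a : ℝ := 2 * (Real.sqrt n * ‖s - t‖) with ha
  have ha0 : 0 < a := by positivity
  set ξ : ℕ → Ω → ℝ := fun j ω => W (Z j ω) / a with hξ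
  have hpull : ∀ (φ : 𝓩 → ℝ), Measurable φ → ∀ j, ∫ ω, φ (Z j ω) ∂μ = ∫ z, φ z ∂P :=
    fun φ hφ j => (hlaw j).integral_comp hφ.aestronglyMeasurable
  have hi : Integrable (fun z => truncIncr f L θ₀ n s z - truncIncr f L θ₀ n t z) P :=
    (integrable_truncIncr hf hL hlip hL0 hθ₀ n hs).sub
      (integrable_truncIncr hf hL hlip hL0 hθ₀ n ht)
  have hW0 : ∫ z, W z ∂P = 0 := by
    rw [hW, integral_sub hi (integrable_const _)]
    simp
  have hsq : ∫ z, W z ^ 2 ∂P ≤ ‖s - t‖ ^ 2 * ∫ z, L z ^ 2 ∂P := by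
    set V : 𝓩 → ℝ := fun z => truncIncr f L θ₀ n s z - truncIncr f L θ₀ n t z with hV
    have hVb : ∀ z, |V z| ≤ L z * ‖s - t‖ := fun z =>
      (abs_truncIncr_sub_le hlip hL0 n hs ht z).trans
        (mul_le_mul_of_nonneg_right (min_le_right _ _) (norm_nonneg _))
    have hVsq : ∀ z, V z ^ 2 ≤ ‖s - t‖ ^ 2 * L z ^ 2 := fun z => by
      rw [← sq_abs]
      calc |V z| ^ 2 ≤ (L z * ‖s - t‖) ^ 2 := pow_le_pow_left₀ (abs_nonneg _) (hVb z) 2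
        _ = _ := by ring
    have hVm : Measurable V := (measurable_truncIncr hf hL n s).sub (measurable_truncIncr hf hL n t)
    have hV2 : Integrable (fun z => V z ^ 2) P :=
      (hL2.const_mul (‖s - t‖ ^ 2)).mono' (hVm.pow_const 2).aestronglyMeasurable
        (ae_of_all _ fun z => by
          rw [Real.norm_of_nonneg (by positivity)]; exact hVsq z)
    set m : ℝ := ∫ z, V z ∂P with hm
    have hexpand : ∫ z, W z ^ 2 ∂P = ∫ z, V z ^ 2 ∂P - m ^ 2 := by
      have h1 : ∀ z, W z ^ 2 = V z ^ 2 - 2 * m * V z + m ^ 2 := fun z => by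
        simp only [hW]; ring
      simp_rw [h1]
      have h2 : Integrable (fun z => V z ^ 2 - 2 * m * V z) P := hV2.sub (hi.const_mul _)
      rw [integral_add h2 (integrable_const _), integral_sub hV2 (hi.const_mul _),
        integral_const_mul]
      simp
      ring
    rw [hexpand, ← integral_const_mul]
    have := integral_mono hV2 (hL2.const_mul (‖s - t‖ ^ 2)) hVsq
    nlinarith [sq_nonneg m]
  have hξm : ∀ j, AEMeasurable (ξ j) μ := fun j =>
    (hWm.comp_aemeasurable (hlaw j).aemeasurable).div_const a
  have hξind : iIndepFun ξ μ := hind.comp (fun _ z => W z / a) fun _ => hWm.div_const a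
  have hbern := lintegral_abs_sum_pow_le (μ := μ) (ξ := ξ) hξind hξm
    (fun j ω => by
      rw [hξ, abs_div, abs_of_pos ha0, div_le_one ha0]
      exact hWb _)
    (fun j => by
      have := hpull (fun z => W z / a) (hWm.div_const a) j
      rw [this, integral_div, hW0, zero_div])
    (v := (∫ z, L z ^ 2 ∂P) / n)
    (fun j => by
      have h1 := hpull (fun z => (W z / a) ^ 2) ((hWm.div_const a).pow_const 2) j
      rw [h1]
      simp_rw [div_pow]
      rw [integral_div, div_le_div_iff₀ (by positivity) hnpos]
      have h2 : a ^ 2 = 4 * n * ‖s - t‖ ^ 2 := by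
        rw [ha, mul_pow, mul_pow, Real.sq_sqrt hnpos.le]; ring
      rw [h2]
      have h3 : 0 ≤ ∫ z, L z ^ 2 ∂P := integral_nonneg fun _ => by positivity
      have h4 := mul_le_mul_of_nonneg_right hsq hnpos.le
      nlinarith [mul_nonneg (mul_nonneg h3 hnpos.le) (sq_nonneg ‖s - t‖)])
    n k
  rw [mul_div_cancel₀ _ hnpos.ne'] at hbern
  have heq : ∀ ω, |truncSum P f L θ₀ Z n s ω - truncSum P f L θ₀ Z n t ω| ^ k
      = (2 * ‖s - t‖) ^ k * |∑ j ∈ Finset.range n, ξ j ω| ^ k := by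
    intro ω
    rw [truncSum_sub_eq hf hL hlip hL0 hθ₀ n hs ht, ← mul_pow]
    congr 1
    have h1 : ∑ j ∈ Finset.range n, ξ j ω = (∑ j ∈ Finset.range n, W (Z j ω)) / a := by
      rw [Finset.sum_div]
    rw [h1, abs_mul, abs_div, abs_of_pos ha0, abs_of_pos (inv_pos.mpr hsn)]
    change (Real.sqrt n)⁻¹ * |∑ j ∈ Finset.range n, W (Z j ω)| = _
    rw [ha]
    field_simp
  simp_rw [heq]
  have hpos : (0 : ℝ) ≤ (2 * ‖s - t‖) ^ k := by positivity
  simp_rw [ENNReal.ofReal_mul hpos]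
  rw [lintegral_const_mul' _ _ ENNReal.ofReal_ne_top]
  refine (mul_le_mul_right hbern _).trans ?_
  rw [← ENNReal.ofReal_mul hpos]
  refine ENNReal.ofReal_le_ofReal (le_of_eq ?_)
  rw [mul_pow]
  ring

end EmpiricalMeans

/-! ### The rate of convergence of minimum contrast estimators -/

section Rate

variable {Ω 𝓩 : Type*} [MeasurableSpace Ω] {μ : Measure Ω} [IsProbabilityMeasure μ]
  [MeasurableSpace 𝓩] {P : Measure 𝓩} [IsProbabilityMeasure P] {d : ℕ}
  {f : EuclideanSpace ℝ (Fin d) → 𝓩 → ℝ} {L : 𝓩 → ℝ} {θ₀ : EuclideanSpace ℝ (Fin d)}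
  {Θ : Set (EuclideanSpace ℝ (Fin d))} {Z : ℕ → Ω → 𝓩}

/-- **Local maximal inequality**: over the ball of radius `r` around `θ₀` the truncated process has
an envelope whose mean is of order `r`, uniformly in `n`. -/
lemma exists_local_envelope (hf : ∀ θ, Measurable (f θ)) (hL : Measurable L)
    (hlip : ∀ z, ∀ s ∈ Θ, ∀ t ∈ Θ, |f s z - f t z| ≤ L z * ‖s - t‖) (hL0 : ∀ z, 0 ≤ L z)
    (hL2 : Integrable (fun z => L z ^ 2) P) (hθ₀ : θ₀ ∈ Θ)
    (hind : iIndepFun Z μ) (hlaw : ∀ j, HasLaw (Z j) P μ) :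
    ∃ C : ℝ, 0 < C ∧ ∀ n : ℕ, 0 < n → ∀ r : ℝ, 0 < r → ∃ F : Ω → ℝ≥0∞, AEMeasurable F μ ∧
      ∫⁻ ω, F ω ∂μ ≤ ENNReal.ofReal (C * r) ∧ ∀ ω, ∀ θ ∈ Θ, ‖θ - θ₀‖ ≤ r →
        ENNReal.ofReal |truncSum P f L θ₀ Z n θ ω| ≤ F ω := by
  set A : ℝ := 2 ^ (5 * d + 1) * ((5 * d + 1).factorial * (2 * Real.exp (∫ z, L z ^ 2 ∂P))) with hA
  have hA0 : 0 ≤ A := by positivity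
  refine ⟨chainingConst d A, by unfold chainingConst; positivity, fun n hn r hr => ?_⟩
  set S := truncSum P f L θ₀ Z n with hS
  have hSm : ∀ t, AEMeasurable (S t) μ :=
    aemeasurable_truncSum hf hL (fun j => (hlaw j).aemeasurable) n
  have hS0 : ∀ ω, S θ₀ ω = 0 := fun ω => truncSum_self n ω
  let U : Set (EuclideanSpace ℝ (Fin d)) := {θ | θ ∈ Θ ∧ ‖θ - θ₀‖ ≤ r}
  have hU : Nonempty U := ⟨⟨θ₀, hθ₀, by simpa using hr.le⟩⟩
  let u : ℕ → U := TopologicalSpace.denseSeq U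
  have hudense : DenseRange u := TopologicalSpace.denseRange_denseSeq U
  classical
  let T : ℕ → Finset (EuclideanSpace ℝ (Fin d)) :=
    fun N => (Finset.range N).image fun i => (u i : EuclideanSpace ℝ (Fin d))
  have hTU : ∀ N, ∀ t ∈ T N, t ∈ U := by
    intro N t ht
    obtain ⟨i, -, rfl⟩ := Finset.mem_image.mp ht
    exact (u i).2
  set G : ℕ → Ω → ℝ≥0∞ := fun N ω => (T N).sup fun t => ENNReal.ofReal |S t ω| with hG
  have hGm : ∀ N, AEMeasurable (G N) μ := by
    intro N
    have h1 : ∀ T : Finset (EuclideanSpace ℝ (Fin d)),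
        AEMeasurable (fun ω => T.sup fun t => ENNReal.ofReal |S t ω|) μ := by
      intro T
      induction T using Finset.induction_on with
      | empty => simp only [Finset.sup_empty]; exact aemeasurable_const
      | insert a s _ ih =>
        simp only [Finset.sup_insert]
        exact (hSm a).norm.ennreal_ofReal.sup ih
    exact h1 _
  have hGle : ∀ N, ∫⁻ ω, G N ω ∂μ ≤ ENNReal.ofReal (chainingConst d A * r) := by
    intro N
    have h1 := lintegral_sup_le_of_moment_increments (μ := μ) S hSm hA0
      (fun s hs t ht => lintegral_truncSum_increment_le hf hL hlip hL0 hL2 hθ₀ hind hlaw hn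
        (5 * d + 1) hs ht) (T N) hθ₀ (fun t ht => (hTU N t ht).1) hr (fun t ht => (hTU N t ht).2)
    simpa [hS0] using h1
  refine ⟨fun ω => ⨆ N, G N ω, AEMeasurable.iSup hGm, ?_, ?_⟩
  · rw [lintegral_iSup' hGm]
    · exact iSup_le hGle
    · refine ae_of_all _ fun ω N M hNM => ?_
      exact Finset.sup_mono (Finset.image_subset_image (Finset.range_mono hNM))
  · intro ω θ hθ hθr
    -- `S · ω` is continuous on `Θ`, so its supremum is determined by a dense sequence
    have hcont : Continuous fun t : U => ENNReal.ofReal |S t ω| := by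
      have hlipS : LipschitzWith (Real.toNNReal (2 * n)) fun t : U => S t ω := by
        refine LipschitzWith.of_dist_le_mul fun s t => ?_
        rw [Real.coe_toNNReal _ (by positivity), Real.dist_eq, Subtype.dist_eq, dist_eq_norm]
        rw [hS, truncSum_sub_eq hf hL hlip hL0 hθ₀ n s.2.1 t.2.1]
        have hsn : 0 < Real.sqrt n := Real.sqrt_pos.mpr (by exact_mod_cast hn)
        rw [abs_mul, abs_of_pos (inv_pos.mpr hsn), inv_mul_le_iff₀ hsn]
        refine (Finset.abs_sum_le_sum_abs _ _).trans ?_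
        refine (Finset.sum_le_sum fun j _ =>
          abs_centred_le (P := P) hlip hL0 n s.2.1 t.2.1 (Z j ω)).trans (le_of_eq ?_)
        rw [Finset.sum_const, Finset.card_range, nsmul_eq_mul]
        ring
      exact ENNReal.continuous_ofReal.comp hlipS.continuous.abs
    have hclosed : IsClosed {t : U | ENNReal.ofReal |S t ω| ≤ ⨆ N, G N ω} :=
      isClosed_le hcont continuous_const
    have hall : ∀ t : U, ENNReal.ofReal |S t ω| ≤ ⨆ N, G N ω := by
      intro t
      refine hudense.induction_on (p := fun t : U => ENNReal.ofReal |S t ω| ≤ ⨆ N, G N ω) t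
        hclosed fun i => ?_
      refine le_trans ?_ (le_iSup _ (i + 1))
      exact Finset.le_sup (f := fun t => ENNReal.ofReal |S t ω|)
        (Finset.mem_image.mpr ⟨i, Finset.mem_range.mpr (Nat.lt_succ_self i), rfl⟩)
    exact hall ⟨θ, hθ, hθr⟩

/-- `√n` times the sum of the empirical and the population mean of the part of the Lipschitz
constant `L` above `√n`. -/
def tailMean (P : Measure 𝓩) (L : 𝓩 → ℝ) (Z : ℕ → Ω → 𝓩) (n : ℕ) (ω : Ω) : ℝ :=
  Real.sqrt n * ((n : ℝ)⁻¹ * ∑ j ∈ Finset.range n,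
    {z | Real.sqrt n < L z}.indicator L (Z j ω) + ∫ z, {z | Real.sqrt n < L z}.indicator L z ∂P)

omit [MeasurableSpace 𝓩] in
lemma sqrt_mul_indicator_le (n : ℕ) {L : 𝓩 → ℝ} (z : 𝓩) :
    Real.sqrt n * {z | Real.sqrt n < L z}.indicator L z ≤ L z ^ 2 := by
  by_cases hz : Real.sqrt n < L z
  · rw [Set.indicator_of_mem (show z ∈ {z | Real.sqrt n < L z} from hz), sq]
    exact mul_le_mul_of_nonneg_right hz.le ((Real.sqrt_nonneg _).trans hz.le)
  · rw [Set.indicator_of_notMem (show z ∉ {z | Real.sqrt n < L z} from hz), mul_zero]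
    positivity

omit [IsProbabilityMeasure P] in
lemma lintegral_tailMean_le (hL : Measurable L) (hL0 : ∀ z, 0 ≤ L z)
    (hL2 : Integrable (fun z => L z ^ 2) P) (hlaw : ∀ j, HasLaw (Z j) P μ) (n : ℕ) :
    ∫⁻ ω, ENNReal.ofReal (tailMean P L Z n ω) ∂μ ≤ ENNReal.ofReal (2 * ∫ z, L z ^ 2 ∂P) := by
  set V : ℝ := ∫ z, L z ^ 2 ∂P with hV
  have hV0 : 0 ≤ V := integral_nonneg fun _ => by positivity
  set I : 𝓩 → ℝ := fun z => Real.sqrt n * {z | Real.sqrt n < L z}.indicator L z with hI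
  have hI0 : ∀ z, 0 ≤ I z := fun z =>
    mul_nonneg (Real.sqrt_nonneg _) (Set.indicator_nonneg (fun z _ => hL0 z) z)
  have hIm : Measurable I := (hL.indicator (measurableSet_lt measurable_const hL)).const_mul _
  have hII : Integrable I P := hL2.mono' hIm.aestronglyMeasurable (ae_of_all _ fun z => by
    rw [Real.norm_of_nonneg (hI0 z)]; exact sqrt_mul_indicator_le n z)
  have hIV : ∫ z, I z ∂P ≤ V := integral_mono hII hL2 (sqrt_mul_indicator_le n)
  have hIl : ∫⁻ z, ENNReal.ofReal (I z) ∂P ≤ ENNReal.ofReal V := by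
    rw [← ofReal_integral_eq_lintegral_ofReal hII (ae_of_all _ hI0)]
    exact ENNReal.ofReal_le_ofReal hIV
  have heq : ∀ ω, ENNReal.ofReal (tailMean P L Z n ω)
      = ENNReal.ofReal (n : ℝ)⁻¹ * ∑ j ∈ Finset.range n, ENNReal.ofReal (I (Z j ω))
        + ENNReal.ofReal (∫ z, I z ∂P) := by
    intro ω
    rw [← ENNReal.ofReal_sum_of_nonneg fun j _ => hI0 _, ← ENNReal.ofReal_mul (by positivity),
      ← ENNReal.ofReal_add (mul_nonneg (by positivity) (Finset.sum_nonneg fun j _ => hI0 _))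
        (integral_nonneg hI0)]
    congr 1
    simp only [tailMean, hI, integral_const_mul, ← Finset.mul_sum]
    ring
  have hIZ : ∀ j, AEMeasurable (fun ω => ENNReal.ofReal (I (Z j ω))) μ := fun j =>
    (hIm.comp_aemeasurable (hlaw j).aemeasurable).ennreal_ofReal
  simp_rw [heq]
  rw [lintegral_add_right _ measurable_const, lintegral_const_mul' _ _ ENNReal.ofReal_ne_top,
    lintegral_finsetSum' _ fun j _ => hIZ j]
  have hj : ∀ j, ∫⁻ ω, ENNReal.ofReal (I (Z j ω)) ∂μ ≤ ENNReal.ofReal V := fun j =>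
    ((hlaw j).lintegral_comp hIm.ennreal_ofReal.aemeasurable).trans_le hIl
  have hsum : ENNReal.ofReal (n : ℝ)⁻¹ * ∑ j ∈ Finset.range n,
      ∫⁻ ω, ENNReal.ofReal (I (Z j ω)) ∂μ ≤ ENNReal.ofReal V := by
    calc _ ≤ ENNReal.ofReal (n : ℝ)⁻¹ * ∑ _j ∈ Finset.range n, ENNReal.ofReal V :=
          mul_le_mul_right (Finset.sum_le_sum fun j _ => hj j) _
      _ = ENNReal.ofReal ((n : ℝ)⁻¹ * (n * V)) := by
          rw [Finset.sum_const, Finset.card_range, nsmul_eq_mul, ENNReal.ofReal_mul (by positivity),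
            ENNReal.ofReal_mul (by positivity), ENNReal.ofReal_natCast]
      _ ≤ ENNReal.ofReal V := by
          refine ENNReal.ofReal_le_ofReal ?_
          rcases eq_or_ne (n : ℝ) 0 with h | h
          · rw [h]; simpa using hV0
          · rw [inv_mul_cancel_left₀ h]
  calc _ ≤ ENNReal.ofReal V + ENNReal.ofReal V := by
        refine add_le_add hsum ?_
        rw [lintegral_const, measure_univ, mul_one]
        exact ENNReal.ofReal_le_ofReal hIV
    _ = _ := by rw [← ENNReal.ofReal_add hV0 hV0, two_mul]

omit [IsProbabilityMeasure μ] [IsProbabilityMeasure P] in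
lemma aemeasurable_tailMean (hL : Measurable L) (hlaw : ∀ j, HasLaw (Z j) P μ) (n : ℕ) :
    AEMeasurable (tailMean P L Z n) μ := by
  have hIm : Measurable ({z | Real.sqrt n < L z}.indicator L) :=
    hL.indicator (measurableSet_lt measurable_const hL)
  unfold tailMean
  exact (((Finset.aemeasurable_fun_sum _ fun j _ =>
    hIm.comp_aemeasurable (hlaw j).aemeasurable).const_mul _).add_const _).const_mul _

omit [MeasurableSpace Ω] in
/-- The basic inequality for a minimum contrast estimator, in terms of the truncated process. -/
lemma basic_inequality (hf : ∀ θ, Measurable (f θ)) (hL : Measurable L)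
    (hlip : ∀ z, ∀ s ∈ Θ, ∀ t ∈ Θ, |f s z - f t z| ≤ L z * ‖s - t‖) (hL0 : ∀ z, 0 ≤ L z)
    (hL2 : Integrable (fun z => L z ^ 2) P) (hfi : ∀ θ ∈ Θ, Integrable (f θ) P)
    (hθ₀ : θ₀ ∈ Θ) {c : ℝ} {n : ℕ} (hn : 0 < n) {θ : EuclideanSpace ℝ (Fin d)} (hθ : θ ∈ Θ)
    (hc : ∫ z, f θ₀ z ∂P + c * ‖θ - θ₀‖ ^ 2 ≤ ∫ z, f θ z ∂P) {ω : Ω}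
    (hmin : ∑ j ∈ Finset.range n, f θ (Z j ω) ≤ ∑ j ∈ Finset.range n, f θ₀ (Z j ω)) :
    c * (Real.sqrt n * ‖θ - θ₀‖) ^ 2 ≤ Real.sqrt n * |truncSum P f L θ₀ Z n θ ω|
      + Real.sqrt n * ‖θ - θ₀‖ * tailMean P L Z n ω := by
  have hnpos : (0 : ℝ) < n := by exact_mod_cast hn
  have hsn : 0 < Real.sqrt n := Real.sqrt_pos.mpr hnpos
  have hsq : Real.sqrt n * Real.sqrt n = n := Real.mul_self_sqrt hnpos.le
  set h := truncIncr f L θ₀ n θ with hh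
  set I := {z | Real.sqrt n < L z}.indicator L with hI
  set δ := ‖θ - θ₀‖ with hδ
  have hδ0 : 0 ≤ δ := norm_nonneg _
  have hI0 : ∀ z, 0 ≤ I z := Set.indicator_nonneg fun z _ => hL0 z
  have hIm : Measurable I := hL.indicator (measurableSet_lt measurable_const hL)
  have hIi : Integrable I P := by
    refine (hL2.const_mul ((Real.sqrt n)⁻¹)).mono' hIm.aestronglyMeasurable (ae_of_all _ fun z => ?_)
    rw [Real.norm_of_nonneg (hI0 z), ← div_eq_inv_mul, le_div_iff₀ hsn, mul_comm]
    exact sqrt_mul_indicator_le n z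
  have hhi : Integrable h P := integrable_truncIncr hf hL hlip hL0 hθ₀ n hθ
  have hdiff : ∀ z, |(f θ z - f θ₀ z) - h z| ≤ δ * I z := by
    intro z
    by_cases hz : L z ≤ Real.sqrt n
    · have h1 : h z = f θ z - f θ₀ z := Set.indicator_of_mem (s := {z | L z ≤ Real.sqrt n}) hz _
      rw [h1, sub_self, abs_zero]
      exact mul_nonneg hδ0 (hI0 z)
    · have h1 : h z = 0 := Set.indicator_of_notMem (s := {z | L z ≤ Real.sqrt n}) hz _
      have h2 : I z = L z :=
        Set.indicator_of_mem (s := {z | Real.sqrt n < L z}) (not_le.mp hz) _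
      rw [h1, h2, sub_zero, mul_comm]
      exact hlip z θ hθ θ₀ hθ₀
  have hpop : ∫ z, f θ z ∂P - ∫ z, f θ₀ z ∂P ≤ ∫ z, h z ∂P + δ * ∫ z, I z ∂P := by
    rw [← integral_sub (hfi θ hθ) (hfi θ₀ hθ₀), ← integral_const_mul,
      ← integral_add hhi (hIi.const_mul _)]
    refine integral_mono ((hfi θ hθ).sub (hfi θ₀ hθ₀)) (hhi.add (hIi.const_mul _)) fun z => ?_
    have := (abs_le.mp (hdiff z)).2
    simp only
    linarith
  have hemp : ∑ j ∈ Finset.range n, h (Z j ω) ≤ δ * ∑ j ∈ Finset.range n, I (Z j ω) := by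
    rw [Finset.mul_sum]
    have h1 : ∑ j ∈ Finset.range n, h (Z j ω) ≤ ∑ j ∈ Finset.range n,
        ((f θ (Z j ω) - f θ₀ (Z j ω)) + δ * I (Z j ω)) := by
      refine Finset.sum_le_sum fun j _ => ?_
      have := (abs_le.mp (hdiff (Z j ω))).1
      linarith
    rw [Finset.sum_add_distrib, Finset.sum_sub_distrib] at h1
    linarith
  have hproc : Real.sqrt n * truncSum P f L θ₀ Z n θ ω
      = ∑ j ∈ Finset.range n, h (Z j ω) - n * ∫ z, h z ∂P := by
    unfold truncSum
    rw [mul_inv_cancel_left₀ hsn.ne', Finset.sum_sub_distrib, Finset.sum_const, Finset.card_range,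
      nsmul_eq_mul]
  have htail : Real.sqrt n * δ * tailMean P L Z n ω
      = δ * ∑ j ∈ Finset.range n, I (Z j ω) + n * (δ * ∫ z, I z ∂P) := by
    unfold tailMean
    rw [← hI]
    have : Real.sqrt n * δ * (Real.sqrt n * ((n : ℝ)⁻¹ * ∑ j ∈ Finset.range n, I (Z j ω)
        + ∫ z, I z ∂P)) = (Real.sqrt n * Real.sqrt n) * δ *
          ((n : ℝ)⁻¹ * ∑ j ∈ Finset.range n, I (Z j ω) + ∫ z, I z ∂P) := by ring
    rw [this, hsq]
    field_simp
  have habs := neg_abs_le (truncSum P f L θ₀ Z n θ ω)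
  have h2 := mul_le_mul_of_nonneg_left habs hsn.le
  rw [mul_neg, hproc] at h2
  rw [htail, mul_pow, sq (Real.sqrt n), hsq]
  nlinarith [mul_le_mul_of_nonneg_left hpop hnpos.le]

/-- **Rate of convergence** of minimum contrast estimators: a contrast that is Lipschitz in the
parameter, with a square integrable constant, and whose mean grows quadratically away from `θ₀`, is
minimized at distance `O_p(n^{-1/2})` from `θ₀`. The proof peels the parameter space into dyadic
shells around `θ₀`. -/
lemma bddAboveInProb_sqrt_mul_norm_sub (hf : ∀ θ, Measurable (f θ)) (hL : Measurable L)
    (hlip : ∀ z, ∀ s ∈ Θ, ∀ t ∈ Θ, |f s z - f t z| ≤ L z * ‖s - t‖) (hL0 : ∀ z, 0 ≤ L z)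
    (hL2 : Integrable (fun z => L z ^ 2) P) (hfi : ∀ θ ∈ Θ, Integrable (f θ) P)
    (hθ₀ : θ₀ ∈ Θ) (hind : iIndepFun Z μ) (hlaw : ∀ j, HasLaw (Z j) P μ)
    {c : ℝ} (hc0 : 0 < c) (hc : ∀ θ ∈ Θ, ∫ z, f θ₀ z ∂P + c * ‖θ - θ₀‖ ^ 2 ≤ ∫ z, f θ z ∂P)
    {θhat : ℕ → Ω → EuclideanSpace ℝ (Fin d)} (hmem : ∀ n ω, θhat n ω ∈ Θ)
    (hmin : ∀ n ω, ∑ j ∈ Finset.range n, f (θhat n ω) (Z j ω)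
      ≤ ∑ j ∈ Finset.range n, f θ₀ (Z j ω)) :
    BddAboveInProb μ (fun n ω => Real.sqrt n * ‖θhat n ω - θ₀‖) := by
  obtain ⟨C, hC, henv⟩ := exists_local_envelope hf hL hlip hL0 hL2 hθ₀ hind hlaw
  have htail : BddAboveInProb μ (tailMean P L Z) :=
    bddAboveInProb_of_lintegral_le (C := ENNReal.ofReal (2 * ∫ z, L z ^ 2 ∂P))
      ENNReal.ofReal_ne_top (aemeasurable_tailMean hL hlaw)
      (Eventually.of_forall (lintegral_tailMean_le hL hL0 hL2 hlaw))
  intro ε hε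
  by_cases hεt : ε = ∞
  · exact ⟨0, by simp [hεt]⟩
  have hε2 : 0 < ε / 2 := ENNReal.half_pos hε.ne'
  obtain ⟨R, hR⟩ := htail _ hε2
  have hε2r : 0 < (ε / 2).toReal :=
    ENNReal.toReal_pos hε2.ne' (ENNReal.div_ne_top hεt (by norm_num))
  -- the first bound lets the quadratic term dominate the tail term, the second one makes the sum of the
  -- probabilities of the bad events over all shells at most `ε / 2`
  set K : ℝ := max (2 * |R| / c + 1) (8 * C / (c * (ε / 2).toReal)) with hK
  have hK1 : 2 * R / c ≤ K := by
    have h1 : 2 * R / c ≤ 2 * |R| / c :=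
      div_le_div_of_nonneg_right (by linarith [le_abs_self R]) hc0.le
    linarith [le_max_left (2 * |R| / c + 1) (8 * C / (c * (ε / 2).toReal))]
  have hK0 : 0 < K := lt_of_lt_of_le (by positivity) (le_max_left _ _)
  have hK2 : 8 * C / (c * K) ≤ (ε / 2).toReal := by
    have h1 := le_max_right (2 * |R| / c + 1) (8 * C / (c * (ε / 2).toReal))
    rw [← hK, div_le_iff₀ (by positivity)] at h1
    rw [div_le_iff₀ (by positivity)]
    linarith
  refine ⟨K, ?_⟩
  filter_upwards [hR, eventually_gt_atTop 0] with n hRn hn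
  have hnpos : (0 : ℝ) < n := by exact_mod_cast hn
  have hsn : 0 < Real.sqrt n := Real.sqrt_pos.mpr hnpos
  set r : ℕ → ℝ := fun i => 2 ^ (i + 1) * K / Real.sqrt n with hr
  have hr0 : ∀ i, 0 < r i := fun i => by positivity
  -- the `i`-th shell is `2ⁱ K ≤ √n ‖θ - θ₀‖ < 2ⁱ⁺¹ K`; it lies in the ball of radius `r i`, and as
  -- long as the tail term is at most `R`, the estimator is in it only if the process reaches `a i`
  choose F hFm hFint hFle using fun i => henv n hn (r i) (hr0 i)
  set a : ℕ → ℝ := fun i => c / 4 * (2 ^ i * K) * r i with ha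
  have ha0 : ∀ i, 0 < a i := fun i => by
    have := hr0 i
    positivity
  have hsub : {ω | K < Real.sqrt n * ‖θhat n ω - θ₀‖}
      ⊆ {ω | R < tailMean P L Z n ω} ∪ ⋃ i, {ω | ENNReal.ofReal (a i) ≤ F i ω} := by
    intro ω hω
    by_contra hcon
    simp only [Set.mem_union, Set.mem_iUnion, Set.mem_ofPred_eq, not_or, not_lt, not_exists,
      not_le] at hcon
    obtain ⟨hR', hF'⟩ := hcon
    set θ := θhat n ω with hθ
    set u := Real.sqrt n * ‖θ - θ₀‖ with hu
    have hω' : K < u := hω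
    have hu0 : 0 < u := hK0.trans hω'
    have hbasic := basic_inequality (n := n) hf hL hlip hL0 hL2 hfi hθ₀ hn (hmem n ω)
      (hc _ (hmem n ω)) (hmin n ω)
    rw [← hθ, ← hu] at hbasic
    -- on the good event the tail term absorbs at most half of the quadratic term
    have h1 : c * u ^ 2 / 2 ≤ Real.sqrt n * |truncSum P f L θ₀ Z n θ ω| := by
      have h2 : tailMean P L Z n ω ≤ c * u / 2 := by
        rw [div_le_iff₀ hc0] at hK1
        nlinarith
      nlinarith [mul_le_mul_of_nonneg_left h2 hu0.le]
    obtain ⟨i, hi1, hi2⟩ : ∃ i : ℕ, 2 ^ i * K ≤ u ∧ u < 2 ^ (i + 1) * K := by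
      obtain ⟨i, hi1, hi2⟩ := exists_nat_pow_near (x := u / K) (y := (2 : ℝ))
        ((one_le_div hK0).mpr hω'.le) (by norm_num)
      exact ⟨i, (le_div_iff₀ hK0).mp hi1, (div_lt_iff₀ hK0).mp hi2⟩
    have hri : ‖θ - θ₀‖ ≤ r i := by
      rw [hr, le_div_iff₀ hsn, mul_comm]
      exact hi2.le
    have h3 := (hFle i ω θ (hmem n ω) hri).trans_lt (hF' i)
    rw [ENNReal.ofReal_lt_ofReal_iff (ha0 i)] at h3
    have h4 : Real.sqrt n * a i = c / 2 * (2 ^ i * K) ^ 2 := by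
      simp only [ha, hr]
      field_simp
      ring
    have h5 : (2 ^ i * K) ^ 2 ≤ u ^ 2 := pow_le_pow_left₀ (by positivity) hi1 2
    have h6 := mul_lt_mul_of_pos_left h3 hsn
    rw [h4] at h6
    nlinarith
  have hterm : ∀ i, μ {ω | ENNReal.ofReal (a i) ≤ F i ω}
      ≤ ENNReal.ofReal (4 * C / (c * K)) * (2⁻¹) ^ i := by
    intro i
    have h1 := (mul_meas_ge_le_lintegral₀ (hFm i) (ENNReal.ofReal (a i))).trans (hFint i)
    have hai : ENNReal.ofReal (a i) ≠ 0 := by simpa using ha0 i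
    rw [mul_comm, ← ENNReal.le_div_iff_mul_le (Or.inl hai) (Or.inl ENNReal.ofReal_ne_top),
      ← ENNReal.ofReal_div_of_pos (ha0 i)] at h1
    refine h1.trans (le_of_eq ?_)
    have h2 : (2⁻¹ : ℝ≥0∞) ^ i = ENNReal.ofReal ((1 / 2) ^ i) := by
      rw [ENNReal.ofReal_pow (by norm_num), one_div, ENNReal.ofReal_inv_of_pos (by norm_num)]
      simp
    rw [h2, ← ENNReal.ofReal_mul (by positivity)]
    congr 1
    have := (hr0 i).ne'
    simp only [ha]
    rw [one_div, inv_pow]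
    field_simp
  calc _ ≤ μ {ω | R < tailMean P L Z n ω} + μ (⋃ i, {ω | ENNReal.ofReal (a i) ≤ F i ω}) :=
        (measure_mono hsub).trans (measure_union_le _ _)
    _ ≤ ε / 2 + ∑' i, ENNReal.ofReal (4 * C / (c * K)) * (2⁻¹) ^ i :=
        add_le_add hRn ((measure_iUnion_le _).trans (ENNReal.tsum_le_tsum hterm))
    _ ≤ ε / 2 + ε / 2 := by
        refine add_le_add le_rfl ?_
        rw [ENNReal.tsum_mul_left, ENNReal.tsum_geometric, ENNReal.one_sub_inv_two, inv_inv]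
        have h1 : ENNReal.ofReal (4 * C / (c * K)) * 2 = ENNReal.ofReal (8 * C / (c * K)) := by
          rw [← ENNReal.ofReal_ofNat 2, ← ENNReal.ofReal_mul (by positivity)]
          congr 1
          ring
        rw [h1]
        exact (ENNReal.ofReal_le_ofReal hK2).trans ENNReal.ofReal_toReal_le
    _ = ε := ENNReal.add_halves ε

end Rate

/-! ### Lipschitz constants from gradient bounds -/

section Envelope

variable {𝓩 : Type*} [MeasurableSpace 𝓩] {P : Measure 𝓩} {d : ℕ}

/-- A family that is differentiable in the parameter, with a square integrable bound for the
gradient, is Lipschitz in the parameter with a measurable, square integrable constant. The constant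
is the supremum of the difference quotients over a countable dense set of parameters, so that it is
measurable although the bound for the gradient need not be. -/
lemma exists_lipschitz_envelope {h : EuclideanSpace ℝ (Fin d) → 𝓩 → ℝ}
    {Θ : Set (EuclideanSpace ℝ (Fin d))} (hΘc : IsCompact Θ) (hΘ : Convex ℝ Θ) (hne : Θ.Nonempty)
    (hm : ∀ θ, Measurable (h θ)) (hd : ∀ z, ∀ θ ∈ Θ, ContDiffAt ℝ 1 (fun θ => h θ z) θ)
    {B : 𝓩 → EuclideanSpace ℝ (Fin d) → ℝ}
    (hB : ∀ z, ∀ θ ∈ Θ, ‖fderiv ℝ (fun θ => h θ z) θ‖ ^ 2 ≤ B z θ)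
    (hint : ∫⁻ z, ⨆ θ ∈ Θ, ENNReal.ofReal (B z θ) ∂P < ∞) :
    ∃ L : 𝓩 → ℝ, Measurable L ∧ (∀ z, 0 ≤ L z) ∧ Integrable (fun z => L z ^ 2) P ∧
      ∀ z, ∀ s ∈ Θ, ∀ t ∈ Θ, |h s z - h t z| ≤ L z * ‖s - t‖ := by
  have hne' : Nonempty Θ := hne.to_subtype
  let u : ℕ → Θ := TopologicalSpace.denseSeq Θ
  have hu : DenseRange u := TopologicalSpace.denseRange_denseSeq Θ
  let Q : ℕ × ℕ → 𝓩 → ℝ :=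
    fun e z => |h (u e.1) z - h (u e.2) z| / ‖(u e.1 : EuclideanSpace ℝ (Fin d)) - u e.2‖
  have hQm : ∀ e, Measurable (Q e) := fun e =>
    (((hm (u e.1)).sub (hm (u e.2))).norm).div_const _
  have hQ0 : ∀ e z, 0 ≤ Q e z := fun e z => by positivity
  let S : 𝓩 → ℝ≥0∞ := fun z => ⨆ e, ENNReal.ofReal (Q e z)
  have hSm : Measurable S := Measurable.iSup fun e => (hQm e).ennreal_ofReal
  have hQle : ∀ z (C : ℝ), (∀ θ ∈ Θ, ‖fderiv ℝ (fun θ => h θ z) θ‖ ≤ C) → 0 ≤ C →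
      ∀ e, Q e z ≤ C := by
    intro z C hC hC0 e
    have h1 := hΘ.norm_image_sub_le_of_norm_fderiv_le (𝕜 := ℝ) (f := fun θ => h θ z)
      (fun θ hθ => (hd z θ hθ).differentiableAt (by norm_num)) hC (u e.2).2 (u e.1).2
    exact div_le_of_le_mul₀ (norm_nonneg _) hC0 h1
  have hSfin : ∀ z, S z ≠ ∞ := by
    intro z
    obtain ⟨C, hC⟩ := hΘc.exists_bound_of_continuousOn (f := fderiv ℝ fun θ => h θ z)
      fun θ hθ => (((hd z θ hθ).fderiv_right (m := 0)
        (by norm_num)).continuousAt).continuousWithinAt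
    have h1 : S z ≤ ENNReal.ofReal (max C 0) := iSup_le fun e =>
      ENNReal.ofReal_le_ofReal
        (hQle z _ (fun θ hθ => (hC θ hθ).trans (le_max_left _ _)) (le_max_right _ _) e)
    exact ne_top_of_le_ne_top ENNReal.ofReal_ne_top h1
  have hSle : ∀ z, S z ^ 2 ≤ ⨆ θ ∈ Θ, ENNReal.ofReal (B z θ) := by
    intro z
    set M := ⨆ θ ∈ Θ, ENNReal.ofReal (B z θ) with hM
    by_cases hMt : M = ∞
    · rw [hMt]; exact le_top
    have h1 : ∀ θ ∈ Θ, ‖fderiv ℝ (fun θ => h θ z) θ‖ ≤ Real.sqrt M.toReal := by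
      intro θ hθ
      refine Real.le_sqrt_of_sq_le ((hB z θ hθ).trans ?_)
      have h2 : ENNReal.ofReal (B z θ) ≤ M :=
        le_iSup₂ (f := fun θ (_ : θ ∈ Θ) => ENNReal.ofReal (B z θ)) θ hθ
      exact (ENNReal.ofReal_le_iff_le_toReal hMt).mp h2
    have h2 : S z ≤ ENNReal.ofReal (Real.sqrt M.toReal) := iSup_le fun e =>
      ENNReal.ofReal_le_ofReal (hQle z _ h1 (Real.sqrt_nonneg _) e)
    calc S z ^ 2 ≤ ENNReal.ofReal (Real.sqrt M.toReal) ^ 2 := pow_le_pow_left₀ zero_le h2 2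
      _ = M := by
        rw [← ENNReal.ofReal_pow (Real.sqrt_nonneg _), Real.sq_sqrt ENNReal.toReal_nonneg,
          ENNReal.ofReal_toReal hMt]
  refine ⟨fun z => (S z).toReal, hSm.ennreal_toReal, fun z => ENNReal.toReal_nonneg, ?_, ?_⟩
  · refine ⟨(hSm.ennreal_toReal.pow_const 2).aestronglyMeasurable, ?_⟩
    rw [hasFiniteIntegral_iff_ofReal (ae_of_all _ fun z => by positivity)]
    refine (lintegral_mono fun z => ?_).trans_lt hint
    rw [ENNReal.ofReal_pow ENNReal.toReal_nonneg, ENNReal.ofReal_toReal (hSfin z)]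
    exact hSle z
  · intro z s hs t ht
    have hcont : Continuous fun θ : Θ => h θ z := continuous_iff_continuousAt.mpr fun θ =>
      ((hd z θ θ.2).continuousAt).comp continuous_subtype_val.continuousAt
    have hdense : DenseRange (Prod.map u u) := hu.prodMap hu
    have hclosed : IsClosed {e : Θ × Θ | |h e.1 z - h e.2 z|
        ≤ (S z).toReal * ‖(e.1 : EuclideanSpace ℝ (Fin d)) - e.2‖} :=
      isClosed_le ((hcont.comp continuous_fst).sub (hcont.comp continuous_snd)).abs
        (by fun_prop)
    refine hdense.induction_on (p := fun e : Θ × Θ => |h e.1 z - h e.2 z|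
        ≤ (S z).toReal * ‖(e.1 : EuclideanSpace ℝ (Fin d)) - e.2‖) (⟨s, hs⟩, ⟨t, ht⟩)
      hclosed fun e => ?_
    have h1 : Q e z ≤ (S z).toReal := by
      rw [← ENNReal.ofReal_le_iff_le_toReal (hSfin z)]
      exact le_iSup (fun e => ENNReal.ofReal (Q e z)) e
    by_cases h0 : ‖(u e.1 : EuclideanSpace ℝ (Fin d)) - u e.2‖ = 0
    · have h2 : (u e.1 : EuclideanSpace ℝ (Fin d)) = u e.2 :=
        sub_eq_zero.mp (norm_eq_zero.mp h0)
      simp [Prod.map, h2]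
    · have hpos : 0 < ‖(u e.1 : EuclideanSpace ℝ (Fin d)) - u e.2‖ :=
        lt_of_le_of_ne (norm_nonneg _) (Ne.symm h0)
      exact (div_le_iff₀ hpos).mp h1

end Envelope

/-! ### Consequences of the regularity conditions -/

section Regularity

variable {p d : ℕ} {P : Measure (EuclideanSpace ℝ (Fin p) × ℝ)} [IsProbabilityMeasure P]
  {g : EuclideanSpace ℝ (Fin p) → EuclideanSpace ℝ (Fin d) → ℝ}
  {Θ : Set (EuclideanSpace ℝ (Fin d))} {θs : EuclideanSpace ℝ (Fin d)}

lemma norm_gradient_eq (f : EuclideanSpace ℝ (Fin d) → ℝ) (θ : EuclideanSpace ℝ (Fin d)) :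
    ‖gradient f θ‖ = ‖fderiv ℝ f θ‖ := by
  unfold gradient
  exact LinearIsometryEquiv.norm_map _ _

lemma RegularityConditions.measurable_g_fst (hreg : RegularityConditions P g Θ θs)
    (θ : EuclideanSpace ℝ (Fin d)) :
    Measurable fun z : EuclideanSpace ℝ (Fin p) × ℝ => g z.1 θ :=
  (hreg.measurable_g θ).comp measurable_fst

lemma RegularityConditions.measurable_residual (hreg : RegularityConditions P g Θ θs)
    (θ : EuclideanSpace ℝ (Fin d)) : Measurable (residual g θ) :=
  measurable_snd.sub (hreg.measurable_g_fst θ)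

lemma RegularityConditions.memLp_g (hreg : RegularityConditions P g Θ θs)
    {θ : EuclideanSpace ℝ (Fin d)} (hθ : θ ∈ Θ) :
    MemLp (fun z : EuclideanSpace ℝ (Fin p) × ℝ => g z.1 θ) 2 P := by
  refine (memLp_two_iff_integrable_sq (hreg.measurable_g_fst θ).aestronglyMeasurable).mpr
    ⟨((hreg.measurable_g_fst θ).pow_const 2).aestronglyMeasurable, ?_⟩
  rw [hasFiniteIntegral_iff_ofReal (ae_of_all _ fun z => by positivity)]
  refine (lintegral_mono fun z => ?_).trans_lt hreg.moment_g
  exact le_iSup₂ (f := fun θ (_ : θ ∈ Θ) => ENNReal.ofReal (g z.1 θ ^ 2)) θ hθ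

lemma RegularityConditions.memLp_residual (hreg : RegularityConditions P g Θ θs)
    {θ : EuclideanSpace ℝ (Fin d)} (hθ : θ ∈ Θ) : MemLp (residual g θ) 2 P :=
  hreg.memLp_Y.sub (hreg.memLp_g hθ)

lemma RegularityConditions.exists_lipschitz_g (hreg : RegularityConditions P g Θ θs) :
    ∃ G : EuclideanSpace ℝ (Fin p) × ℝ → ℝ, Measurable G ∧ (∀ z, 0 ≤ G z) ∧
      Integrable (fun z => G z ^ 2) P ∧
      ∀ z, ∀ s ∈ Θ, ∀ t ∈ Θ, |g z.1 s - g z.1 t| ≤ G z * ‖s - t‖ := by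
  refine exists_lipschitz_envelope (𝓩 := EuclideanSpace ℝ (Fin p) × ℝ) (P := P)
    (h := fun θ z => g z.1 θ) hreg.compact hreg.convex
    ⟨θs, hreg.mem_Θ⟩ hreg.measurable_g_fst
    (fun z θ hθ => (hreg.contDiff_g z.1 θ hθ).of_le (by norm_num))
    (B := fun z θ => ‖gradient (g z.1) θ‖ ^ 2) (fun z θ _ => ?_) ?_
  · rw [norm_gradient_eq]
  · exact hreg.moment_grad

lemma RegularityConditions.exists_lipschitz_sq_residual (hreg : RegularityConditions P g Θ θs) :
    ∃ L : EuclideanSpace ℝ (Fin p) × ℝ → ℝ, Measurable L ∧ (∀ z, 0 ≤ L z) ∧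
      Integrable (fun z => L z ^ 2) P ∧ ∀ z, ∀ s ∈ Θ, ∀ t ∈ Θ,
        |residual g s z ^ 2 - residual g t z ^ 2| ≤ L z * ‖s - t‖ := by
  refine exists_lipschitz_envelope (h := fun θ z => residual g θ z ^ 2) hreg.compact hreg.convex
    ⟨θs, hreg.mem_Θ⟩ (fun θ => (hreg.measurable_residual θ).pow_const 2) (fun z θ hθ => ?_)
    (B := fun z θ => 4 * (residual g θ z ^ 2 * ‖gradient (g z.1) θ‖ ^ 2)) (fun z θ hθ => ?_) ?_
  · have h1 : ContDiffAt ℝ 1 (g z.1) θ := (hreg.contDiff_g z.1 θ hθ).of_le (by norm_num)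
    exact (contDiffAt_const.sub h1).pow 2
  · have h1 : HasFDerivAt (g z.1) (fderiv ℝ (g z.1) θ) θ :=
      ((hreg.contDiff_g z.1 θ hθ).differentiableAt (by norm_num)).hasFDerivAt
    have h2 : HasFDerivAt (fun θ => residual g θ z ^ 2)
        (-(2 * residual g θ z) • fderiv ℝ (g z.1) θ) θ := by
      have h3 := ((hasFDerivAt_const z.2 θ).sub h1).pow 2
      refine h3.congr_fderiv ?_
      ext v
      simp [residual]
    rw [h2.fderiv, norm_smul, norm_gradient_eq, norm_neg, norm_mul, mul_pow, mul_pow,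
      Real.norm_eq_abs, Real.norm_eq_abs, sq_abs, sq_abs]
    refine le_of_eq ?_
    ring
  · have h4 : ∀ z, ⨆ θ ∈ Θ, ENNReal.ofReal (4 * (residual g θ z ^ 2 * ‖gradient (g z.1) θ‖ ^ 2))
        = 4 * ⨆ θ ∈ Θ, ENNReal.ofReal (residual g θ z ^ 2 * ‖gradient (g z.1) θ‖ ^ 2) := by
      intro z
      simp_rw [ENNReal.ofReal_mul (by norm_num : (0 : ℝ) ≤ 4), ENNReal.mul_iSup]
      simp
    simp_rw [h4]
    rw [lintegral_const_mul' _ _ (by norm_num)]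
    exact ENNReal.mul_lt_top (by norm_num) hreg.moment_residual_grad

lemma RegularityConditions.integrable_residual_sq (hreg : RegularityConditions P g Θ θs)
    {θ : EuclideanSpace ℝ (Fin d)} (hθ : θ ∈ Θ) : Integrable (fun z => residual g θ z ^ 2) P :=
  (hreg.memLp_residual hθ).integrable_sq

/-- The least squares estimator converges at rate `n^{-1/2}`. -/
lemma RegularityConditions.bddAboveInProb_leastSquares (hreg : RegularityConditions P g Θ θs)
    (hnd : NondegenerateMin P g Θ θs)
    {Ω : Type*} [MeasurableSpace Ω] {μ : Measure Ω} [IsProbabilityMeasure μ]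
    {x : ℕ → Ω → EuclideanSpace ℝ (Fin p)} {y : ℕ → Ω → ℝ}
    (hindep : iIndepFun (fun j ω => (x j ω, y j ω)) μ)
    (hlaw : ∀ j, HasLaw (fun ω => (x j ω, y j ω)) P μ)
    {θhat : ℕ → Ω → EuclideanSpace ℝ (Fin d)}
    (hθ : ∀ n ω, IsLeastSquares g Θ (fun j => x j ω) (fun j => y j ω) n (θhat n ω)) :
    BddAboveInProb μ (fun n ω => Real.sqrt n * ‖θhat n ω - θs‖) := by
  obtain ⟨L, hLm, hL0, hL2, hLlip⟩ := hreg.exists_lipschitz_sq_residual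
  obtain ⟨c, hc0, hc⟩ := hnd
  exact bddAboveInProb_sqrt_mul_norm_sub (f := fun θ z => residual g θ z ^ 2)
    (fun θ => (hreg.measurable_residual θ).pow_const 2) hLm hLlip hL0 hL2
    (fun θ hθ => hreg.integrable_residual_sq hθ) hreg.mem_Θ hindep hlaw hc0 hc
    (fun n ω => (hθ n ω).1) (fun n ω => (hθ n ω).2 θs hreg.mem_Θ)

/-- Under the null hypothesis the excess risk is the mean squared distance of the regression
functions. -/
lemma RegularityConditions.risk_eq_add (hreg : RegularityConditions P g Θ θs)
    {θ₀ θ : EuclideanSpace ℝ (Fin d)} (hθ₀ : θ₀ ∈ Θ) (hθ : θ ∈ Θ)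
    (hind : IndepFun Prod.fst (residual g θ₀) P) (h0 : ∫ z, residual g θ₀ z ∂P = 0) :
    risk P g θ = risk P g θ₀ + ∫ z, (g z.1 θ - g z.1 θ₀) ^ 2 ∂P := by
  have hD : MemLp (fun z : EuclideanSpace ℝ (Fin p) × ℝ => g z.1 θ - g z.1 θ₀) 2 P :=
    (hreg.memLp_g hθ).sub (hreg.memLp_g hθ₀)
  have hcross : ∫ z, (g z.1 θ - g z.1 θ₀) * residual g θ₀ z ∂P = 0 := by
    have h1 : IndepFun (fun z : EuclideanSpace ℝ (Fin p) × ℝ => g z.1 θ - g z.1 θ₀)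
        (residual g θ₀) P :=
      hind.comp ((hreg.measurable_g θ).sub (hreg.measurable_g θ₀)) measurable_id
    rw [h1.integral_fun_mul_eq_mul_integral hD.aestronglyMeasurable
      (hreg.memLp_residual hθ₀).aestronglyMeasurable, h0, mul_zero]
  have hci : Integrable (fun z => (g z.1 θ - g z.1 θ₀) * residual g θ₀ z) P :=
    hD.integrable_mul (hreg.memLp_residual hθ₀)
  have h1 : ∀ z, residual g θ z ^ 2 = residual g θ₀ z ^ 2 + (g z.1 θ - g z.1 θ₀) ^ 2
      - 2 * ((g z.1 θ - g z.1 θ₀) * residual g θ₀ z) := fun z => by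
    simp only [residual]; ring
  have h2 : Integrable (fun z => residual g θ₀ z ^ 2 + (g z.1 θ - g z.1 θ₀) ^ 2) P :=
    (hreg.integrable_residual_sq hθ₀).add hD.integrable_sq
  unfold risk
  simp_rw [h1]
  rw [integral_sub h2 (hci.const_mul 2), integral_const_mul, hcross,
    integral_add (hreg.integrable_residual_sq hθ₀) hD.integrable_sq]
  ring

/-- Under the null hypothesis the error at the least squares parameter is independent of `X`. -/
lemma RegularityConditions.indepFun_of_null (hreg : RegularityConditions P g Θ θs)
    (hnull : NullHypothesis P g Θ) :
    IndepFun Prod.fst (residual g θs) P ∧ ∫ z, residual g θs z ∂P = 0 := by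
  obtain ⟨θ₀, hθ₀, hind, h0⟩ := hnull
  have heq : θ₀ = θs := by
    by_contra hne
    have h1 := hreg.unique_min θ₀ hθ₀ hne
    have h2 := hreg.risk_eq_add hθ₀ hreg.mem_Θ hind h0
    have h3 : 0 ≤ ∫ z, (g z.1 θs - g z.1 θ₀) ^ 2 ∂P := integral_nonneg fun _ => by positivity
    linarith
  rw [← heq]
  exact ⟨hind, h0⟩

/-- The directional derivative of the regression function vanishes almost surely in no direction,
because the second moment matrix of its gradient is nonsingular. -/
lemma RegularityConditions.eq_zero_of_ae_fderiv_eq_zero (hreg : RegularityConditions P g Θ θs)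
    {u : EuclideanSpace ℝ (Fin d)} (hu : ∀ᵐ z ∂P, fderiv ℝ (g z.1) θs u = 0) : u = 0 := by
  have hgrad : ∀ z : EuclideanSpace ℝ (Fin p) × ℝ, ∀ v,
      fderiv ℝ (g z.1) θs v = inner ℝ (gradient (g z.1) θs) v := by
    intro z v
    simp [gradient]
  have hdiff : ∀ z : EuclideanSpace ℝ (Fin p) × ℝ, HasFDerivAt (g z.1) (fderiv ℝ (g z.1) θs) θs :=
    fun z => ((hreg.contDiff_g z.1 θs hreg.mem_Θ).differentiableAt (by norm_num)).hasFDerivAt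
  have hcoord : ∀ (z : EuclideanSpace ℝ (Fin p) × ℝ) i, gradient (g z.1) θs i
      = fderiv ℝ (g z.1) θs (EuclideanSpace.single i 1) := by
    intro z i
    rw [hgrad, EuclideanSpace.inner_single_right]
    simp
  have hmeas : ∀ i, Measurable fun z : EuclideanSpace ℝ (Fin p) × ℝ => gradient (g z.1) θs i := by
    intro i
    simp_rw [hcoord]
    refine measurable_of_tendsto_metrizable (f := fun (n : ℕ)
      (z : EuclideanSpace ℝ (Fin p) × ℝ) => (n : ℝ) • (g z.1 (θs + (n : ℝ)⁻¹ •
        EuclideanSpace.single i 1) - g z.1 θs)) (fun n => ?_) ?_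
    · simp only [smul_eq_mul]
      exact ((hreg.measurable_g_fst _).sub (hreg.measurable_g_fst _)).const_mul _
    · rw [tendsto_pi_nhds]
      intro z
      refine (hdiff z).lim _ ?_
      simpa using tendsto_natCast_atTop_atTop (R := ℝ)
  have hL2 : ∀ i, MemLp (fun z : EuclideanSpace ℝ (Fin p) × ℝ => gradient (g z.1) θs i) 2 P := by
    intro i
    refine (memLp_two_iff_integrable_sq (hmeas i).aestronglyMeasurable).mpr
      ⟨((hmeas i).pow_const 2).aestronglyMeasurable, ?_⟩
    rw [hasFiniteIntegral_iff_ofReal (ae_of_all _ fun z => by positivity)]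
    refine (lintegral_mono fun z => ?_).trans_lt hreg.moment_grad
    refine le_trans (ENNReal.ofReal_le_ofReal ?_)
      (le_iSup₂ (f := fun θ (_ : θ ∈ Θ) => ENNReal.ofReal (‖gradient (g z.1) θ‖ ^ 2)) θs hreg.mem_Θ)
    have h1 : |gradient (g z.1) θs i| ≤ ‖gradient (g z.1) θs‖ :=
      PiLp.norm_apply_le (gradient (g z.1) θs) i
    rw [← sq_abs]
    exact pow_le_pow_left₀ (abs_nonneg _) h1 2
  set A := Matrix.of fun i j : Fin d =>
    ∫ z, gradient (g z.1) θs i * gradient (g z.1) θs j ∂P with hA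
  have hAu : A.mulVec u.ofLp = 0 := by
    funext i
    have h1 : ∀ j, Integrable (fun z : EuclideanSpace ℝ (Fin p) × ℝ =>
        gradient (g z.1) θs i * gradient (g z.1) θs j) P :=
      fun j => (hL2 i).integrable_mul (hL2 j)
    simp only [Matrix.mulVec, dotProduct, hA, Matrix.of_apply, Pi.zero_apply]
    simp_rw [← integral_mul_const]
    rw [← integral_finsetSum _ fun j _ => (h1 j).mul_const _]
    rw [← integral_zero (EuclideanSpace ℝ (Fin p) × ℝ) ℝ (μ := P)]
    refine integral_congr_ae ?_
    filter_upwards [hu] with z hz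
    rw [hgrad, PiLp.inner_apply] at hz
    simp only [RCLike.inner_apply, conj_trivial] at hz
    simp_rw [mul_assoc]
    rw [← Finset.mul_sum]
    have : ∑ j, gradient (g z.1) θs j * u j = 0 := by
      rw [← hz]
      exact Finset.sum_congr rfl fun j _ => mul_comm _ _
    rw [this, mul_zero]
  have h2 : u.ofLp = 0 :=
    Matrix.eq_zero_of_mulVec_eq_zero (hreg.nonsingular.ne_zero) hAu
  ext i
  exact congrFun h2 i

/-- Under the null hypothesis the minimizer is nondegenerate. By compactness a failure would
produce, through Fatou's lemma, either a second minimizer of the risk or a direction in which the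
derivative of the regression function vanishes. -/
lemma RegularityConditions.nondegenerateMin_of_null (hreg : RegularityConditions P g Θ θs)
    (hnull : NullHypothesis P g Θ) : NondegenerateMin P g Θ θs := by
  obtain ⟨hind, h0⟩ := hreg.indepFun_of_null hnull
  have hrisk : ∀ θ ∈ Θ, risk P g θ = risk P g θs + ∫ z, (g z.1 θ - g z.1 θs) ^ 2 ∂P :=
    fun θ hθ => hreg.risk_eq_add hreg.mem_Θ hθ hind h0
  by_contra hcon
  have hex : ∀ k : ℕ, ∃ θ ∈ Θ, ∫ z, (g z.1 θ - g z.1 θs) ^ 2 ∂P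
      < ((k : ℝ) + 1)⁻¹ * ‖θ - θs‖ ^ 2 := by
    intro k
    by_contra hk
    refine hcon ⟨((k : ℝ) + 1)⁻¹, by positivity, fun θ hθ => ?_⟩
    rw [hrisk θ hθ]
    by_contra hlt
    exact hk ⟨θ, hθ, by linarith⟩
  choose t htΘ ht using hex
  have hpos : ∀ k, 0 < ‖t k - θs‖ := by
    intro k
    rcases (norm_nonneg (t k - θs)).eq_or_lt with h | h
    · have h1 := ht k
      rw [← h] at h1
      have h2 : 0 ≤ ∫ z, (g z.1 (t k) - g z.1 θs) ^ 2 ∂P := integral_nonneg fun _ => by positivity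
      norm_num at h1
      linarith
    · exact h
  set u : ℕ → EuclideanSpace ℝ (Fin d) := fun k => ‖t k - θs‖⁻¹ • (t k - θs) with hu
  have hu1 : ∀ k, ‖u k‖ = 1 := fun k => by
    rw [hu, norm_smul, norm_inv, norm_norm, inv_mul_cancel₀ (hpos k).ne']
  obtain ⟨θ', hθ', φ, hφ, hφlim⟩ := hreg.compact.tendsto_subseq htΘ
  obtain ⟨u', hu', ψ, hψ, hψlim⟩ := (isCompact_sphere (0 : EuclideanSpace ℝ (Fin d)) 1).tendsto_subseq
    (x := u ∘ φ) (fun k => by simp [hu1])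
  set s : ℕ → ℕ := φ ∘ ψ with hs
  have hsmono : StrictMono s := hφ.comp hψ
  have htlim : Tendsto (fun k => t (s k)) atTop (𝓝 θ') := hφlim.comp hψ.tendsto_atTop
  have hulim : Tendsto (fun k => u (s k)) atTop (𝓝 u') := hψlim
  set q : ℕ → EuclideanSpace ℝ (Fin p) × ℝ → ℝ :=
    fun k z => (‖t (s k) - θs‖⁻¹ * (g z.1 (t (s k)) - g z.1 θs)) ^ 2 with hq
  have hqm : ∀ k, Measurable (q k) := fun k =>
    (((hreg.measurable_g_fst _).sub (hreg.measurable_g_fst _)).const_mul _).pow_const 2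
  -- Fatou's lemma: an almost sure limit of the difference quotients vanishes
  have hfatou : ∀ Q : EuclideanSpace ℝ (Fin p) × ℝ → ℝ,
      (∀ z, Tendsto (fun k => q k z) atTop (𝓝 (Q z))) → ∀ᵐ z ∂P, Q z = 0 := by
    intro Q hQ
    have hQ0 : ∀ z, 0 ≤ Q z := fun z =>
      ge_of_tendsto' (hQ z) fun k => by simp only [hq]; positivity
    have h1 : ∫⁻ z, ENNReal.ofReal (Q z) ∂P ≤ 0 := by
      have h2 : ∀ z, liminf (fun k => ENNReal.ofReal (q k z)) atTop = ENNReal.ofReal (Q z) :=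
        fun z => ((ENNReal.continuous_ofReal.tendsto _).comp (hQ z)).liminf_eq
      calc _ = ∫⁻ z, liminf (fun k => ENNReal.ofReal (q k z)) atTop ∂P :=
            lintegral_congr fun z => (h2 z).symm
        _ ≤ liminf (fun k => ∫⁻ z, ENNReal.ofReal (q k z) ∂P) atTop :=
            lintegral_liminf_le fun k => (hqm k).ennreal_ofReal
        _ = 0 := by
            refine Tendsto.liminf_eq ?_
            have h3 : ∀ k, ∫⁻ z, ENNReal.ofReal (q k z) ∂P
                ≤ ENNReal.ofReal (((s k : ℝ) + 1)⁻¹) := by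
              intro k
              have hD : Integrable (fun z : EuclideanSpace ℝ (Fin p) × ℝ =>
                  (g z.1 (t (s k)) - g z.1 θs) ^ 2) P :=
                ((hreg.memLp_g (htΘ _)).sub (hreg.memLp_g hreg.mem_Θ)).integrable_sq
              have h4 : ∀ z, q k z = (‖t (s k) - θs‖⁻¹) ^ 2 * (g z.1 (t (s k)) - g z.1 θs) ^ 2 :=
                fun z => by simp only [hq]; ring
              have h5 : Integrable (q k) P := by
                rw [show q k = _ from funext h4]
                exact hD.const_mul _
              rw [← ofReal_integral_eq_lintegral_ofReal h5
                (ae_of_all _ fun z => by simp only [hq]; positivity)]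
              refine ENNReal.ofReal_le_ofReal ?_
              simp_rw [h4]
              rw [integral_const_mul, inv_pow, inv_mul_le_iff₀ (by have := hpos (s k); positivity),
                mul_comm]
              exact (ht (s k)).le
            have h6 : Tendsto (fun k => ENNReal.ofReal (((s k : ℝ) + 1)⁻¹)) atTop (𝓝 0) := by
              have h7 : Tendsto (fun k => ((s k : ℝ) + 1)⁻¹) atTop (𝓝 0) :=
                (tendsto_inv_atTop_zero.comp (tendsto_atTop_add_const_right _ _
                  tendsto_natCast_atTop_atTop)).comp hsmono.tendsto_atTop
              have h8 := (ENNReal.continuous_ofReal.tendsto _).comp h7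
              rwa [ENNReal.ofReal_zero] at h8
            exact tendsto_of_tendsto_of_tendsto_of_le_of_le tendsto_const_nhds h6
              (fun _ => zero_le) h3
    have hQm : Measurable Q := measurable_of_tendsto_metrizable hqm (tendsto_pi_nhds.mpr hQ)
    have h8 := (lintegral_eq_zero_iff hQm.ennreal_ofReal).mp (le_antisymm h1 zero_le)
    filter_upwards [h8] with z hz
    exact le_antisymm (by simpa using hz) (hQ0 z)
  by_cases hθ's : θ' = θs
  · have hae := hfatou (fun z => (fderiv ℝ (g z.1) θs u') ^ 2) fun z => by
      have hd : HasFDerivAt (g z.1) (fderiv ℝ (g z.1) θs) θs :=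
        ((hreg.contDiff_g z.1 θs hreg.mem_Θ).differentiableAt (by norm_num)).hasFDerivAt
      rw [hθ's] at htlim
      have ho := hd.isLittleO.comp_tendsto htlim
      have h1 : Tendsto (fun k => ‖t (s k) - θs‖⁻¹ * (g z.1 (t (s k)) - g z.1 θs
          - fderiv ℝ (g z.1) θs (t (s k) - θs))) atTop (𝓝 0) := by
        have h2 := ho.norm_right.tendsto_div_nhds_zero
        refine h2.congr fun k => ?_
        simp only [Function.comp_apply, div_eq_inv_mul]
      have h3 : Tendsto (fun k => fderiv ℝ (g z.1) θs (u (s k))) atTop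
          (𝓝 (fderiv ℝ (g z.1) θs u')) :=
        ((fderiv ℝ (g z.1) θs).continuous.tendsto _).comp hulim
      have h4 := (h1.add h3).pow 2
      rw [zero_add] at h4
      refine h4.congr fun k => ?_
      simp only [hq, hu, map_smul, smul_eq_mul]
      ring
    have hu0 : u' = 0 := hreg.eq_zero_of_ae_fderiv_eq_zero (by
      filter_upwards [hae] with z hz
      exact pow_eq_zero_iff (two_ne_zero) |>.mp hz)
    have hn : ‖u'‖ = 1 := by simpa using hu'
    rw [hu0, norm_zero] at hn
    exact zero_ne_one hn
  · have hnz : ‖θ' - θs‖ ≠ 0 := norm_ne_zero_iff.mpr (sub_ne_zero.mpr hθ's)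
    have hae := hfatou (fun z => (‖θ' - θs‖⁻¹ * (g z.1 θ' - g z.1 θs)) ^ 2) fun z => by
      have h1 : Tendsto (fun k => ‖t (s k) - θs‖⁻¹) atTop (𝓝 ‖θ' - θs‖⁻¹) :=
        (htlim.sub_const θs).norm.inv₀ hnz
      have h2 : Tendsto (fun k => g z.1 (t (s k))) atTop (𝓝 (g z.1 θ')) :=
        ((hreg.contDiff_g z.1 θ' hθ').continuousAt.tendsto).comp htlim
      exact (h1.mul (h2.sub_const _)).pow 2
    have hzero : ∫ z, (g z.1 θ' - g z.1 θs) ^ 2 ∂P = 0 := by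
      rw [← integral_zero (EuclideanSpace ℝ (Fin p) × ℝ) ℝ (μ := P)]
      refine integral_congr_ae ?_
      filter_upwards [hae] with z hz
      rw [mul_pow, mul_eq_zero] at hz
      rcases hz with hz | hz
      · exact absurd hz (pow_ne_zero 2 (inv_ne_zero hnz))
      · exact hz
    have h1 := hreg.unique_min θ' hθ' hθ's
    rw [hrisk θ' hθ', hzero, add_zero] at h1
    exact lt_irrefl _ h1

end Regularity

/-! ### Sample averages -/

section Averages

variable {Ω 𝓩 : Type*} [MeasurableSpace Ω] {μ : Measure Ω} [IsProbabilityMeasure μ]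
  [MeasurableSpace 𝓩] {P : Measure 𝓩} {Z : ℕ → Ω → 𝓩}

omit [IsProbabilityMeasure μ] in
/-- Sample means of a non-negative integrable function are bounded in probability. -/
lemma bddAboveInProb_average (hlaw : ∀ j, HasLaw (Z j) P μ) {φ : 𝓩 → ℝ} (hφm : Measurable φ)
    (hφ0 : ∀ z, 0 ≤ φ z) (hφ : Integrable φ P) :
    BddAboveInProb μ (fun n ω => (n : ℝ)⁻¹ * ∑ j ∈ Finset.range n, φ (Z j ω)) := by
  have hZm : ∀ j, AEMeasurable (fun ω => φ (Z j ω)) μ :=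
    fun j => hφm.comp_aemeasurable (hlaw j).aemeasurable
  refine bddAboveInProb_of_lintegral_le (C := ENNReal.ofReal (∫ z, φ z ∂P)) ENNReal.ofReal_ne_top
    (fun n => (Finset.aemeasurable_fun_sum _ fun j _ => hZm j).const_mul _)
    (Eventually.of_forall fun n => ?_)
  have h0 : 0 ≤ ∫ z, φ z ∂P := integral_nonneg hφ0
  have h1 : ∀ ω, ENNReal.ofReal ((n : ℝ)⁻¹ * ∑ j ∈ Finset.range n, φ (Z j ω))
      = ENNReal.ofReal (n : ℝ)⁻¹ * ∑ j ∈ Finset.range n, ENNReal.ofReal (φ (Z j ω)) := fun ω => by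
    rw [ENNReal.ofReal_mul (by positivity), ENNReal.ofReal_sum_of_nonneg fun j _ => hφ0 _]
  have h2 : ∀ j, ∫⁻ ω, ENNReal.ofReal (φ (Z j ω)) ∂μ = ENNReal.ofReal (∫ z, φ z ∂P) := fun j => by
    rw [ofReal_integral_eq_lintegral_ofReal hφ (ae_of_all _ hφ0)]
    exact (hlaw j).lintegral_comp hφm.ennreal_ofReal.aemeasurable
  simp_rw [h1]
  rw [lintegral_const_mul' _ _ ENNReal.ofReal_ne_top,
    lintegral_finsetSum' _ fun j _ => (hZm j).ennreal_ofReal]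
  simp_rw [h2]
  rw [Finset.sum_const, Finset.card_range, nsmul_eq_mul, ← ENNReal.ofReal_natCast,
    ← ENNReal.ofReal_mul (by positivity), ← ENNReal.ofReal_mul (by positivity)]
  refine ENNReal.ofReal_le_ofReal ?_
  rcases eq_or_ne (n : ℝ) 0 with h | h
  · rw [h]; simpa using h0
  · rw [inv_mul_cancel_left₀ h]

variable [IsProbabilityMeasure P]

/-- The terms `Φ(Zᵢ, Zⱼ)` and `Φ(Zₖ, Zⱼ)` are uncorrelated when `Φ` is centred in its first
argument and `k` differs from `i` and `j`. -/
lemma integral_mul_conj_eq_zero (hind : iIndepFun Z μ) (hlaw : ∀ j, HasLaw (Z j) P μ)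
    {Φ : 𝓩 → 𝓩 → ℂ} (hΦ : Measurable (Function.uncurry Φ)) {b : 𝓩 → ℝ} (hbm : Measurable b)
    (hb : ∀ z w, ‖Φ z w‖ ≤ b z) (hb2 : Integrable (fun z => b z ^ 2) P)
    (hcent : ∀ w, ∫ z, Φ z w ∂P = 0) {i j k : ℕ} (hik : i ≠ k) (hjk : j ≠ k) :
    ∫ ω, Φ (Z i ω) (Z j ω) * starRingEnd ℂ (Φ (Z k ω) (Z j ω)) ∂μ = 0 := by
  have hZm : ∀ j, AEMeasurable (Z j) μ := fun j => (hlaw j).aemeasurable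
  have hpm : AEMeasurable (fun ω => (Z i ω, Z j ω)) μ := (hZm i).prodMk (hZm j)
  have hmap := (indepFun_iff_map_prod_eq_prod_map_map hpm (hZm k)).mp
    (hind.indepFun_prodMk₀ hZm i j k hik hjk)
  rw [(hlaw k).map_eq] at hmap
  set ν := μ.map fun ω => (Z i ω, Z j ω) with hν
  have : IsProbabilityMeasure ν := Measure.isProbabilityMeasure_map hpm
  set F : (𝓩 × 𝓩) × 𝓩 → ℂ := fun e => Φ e.1.1 e.1.2 * starRingEnd ℂ (Φ e.2 e.1.2) with hF
  have hFm : Measurable F := by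
    have h1 : Measurable fun e : (𝓩 × 𝓩) × 𝓩 => Φ e.1.1 e.1.2 := hΦ.comp measurable_fst
    have h2 : Measurable fun e : (𝓩 × 𝓩) × 𝓩 => Φ e.2 e.1.2 :=
      hΦ.comp (measurable_snd.prodMk (measurable_snd.comp measurable_fst))
    exact h1.mul (Complex.continuous_conj.measurable.comp h2)
  have htm : AEMeasurable (fun ω => ((Z i ω, Z j ω), Z k ω)) μ := hpm.prodMk (hZm k)
  have hbZ : ∀ l, MemLp (fun ω => b (Z l ω)) 2 μ := fun l => by
    refine (memLp_two_iff_integrable_sq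
      (hbm.comp_aemeasurable (hZm l)).aestronglyMeasurable).mpr ?_
    have h1 := (integrable_map_measure (μ := μ) (f := Z l) (g := fun z => b z ^ 2)
      (hbm.pow_const 2).aestronglyMeasurable (hZm l)).mp (by rw [(hlaw l).map_eq]; exact hb2)
    exact h1
  have hFi : Integrable F (ν.prod P) := by
    rw [← hmap, integrable_map_measure hFm.aestronglyMeasurable htm]
    refine ((hbZ i).integrable_mul (hbZ k)).mono'
      (hFm.comp_aemeasurable htm).aestronglyMeasurable (ae_of_all _ fun ω => ?_)
    simp only [hF, Function.comp_apply, norm_mul, RCLike.norm_conj, Pi.mul_apply]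
    exact mul_le_mul (hb _ _) (hb _ _) (norm_nonneg _) ((norm_nonneg _).trans (hb _ (Z j ω)))
  calc _ = ∫ e, F e ∂(μ.map fun ω => ((Z i ω, Z j ω), Z k ω)) :=
        (integral_map htm hFm.aestronglyMeasurable).symm
    _ = ∫ e, ∫ z, F (e, z) ∂P ∂ν := by rw [hmap, integral_prod F hFi]
    _ = ∫ _, (0 : ℂ) ∂ν := by
        refine integral_congr_ae (ae_of_all _ fun e => ?_)
        simp only [hF]
        rw [integral_const_mul, integral_conj, hcent, map_zero, mul_zero]
    _ = 0 := integral_zero _ _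

/-- The second moment of `∑ᵢ Φ(Zᵢ, Zⱼ)` is of order `n` when `Φ` is centred in its first argument:
the off-diagonal terms of the square vanish. -/
lemma integral_norm_sum_sq_le (hind : iIndepFun Z μ) (hlaw : ∀ j, HasLaw (Z j) P μ)
    {Φ : 𝓩 → 𝓩 → ℂ} (hΦ : Measurable (Function.uncurry Φ)) {b : 𝓩 → ℝ} (hbm : Measurable b)
    (hb : ∀ z w, ‖Φ z w‖ ≤ b z) (hb2 : Integrable (fun z => b z ^ 2) P)
    (hcent : ∀ w, ∫ z, Φ z w ∂P = 0) (n j : ℕ) :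
    Integrable (fun ω => ‖∑ i ∈ Finset.range n, Φ (Z i ω) (Z j ω)‖ ^ 2) μ ∧
      ∫ ω, ‖∑ i ∈ Finset.range n, Φ (Z i ω) (Z j ω)‖ ^ 2 ∂μ ≤ n * ∫ z, b z ^ 2 ∂P := by
  have hZm : ∀ j, AEMeasurable (Z j) μ := fun j => (hlaw j).aemeasurable
  have hΦm : ∀ i, AEMeasurable (fun ω => Φ (Z i ω) (Z j ω)) μ := fun i =>
    hΦ.comp_aemeasurable ((hZm i).prodMk (hZm j))
  have hbi : ∀ l, Integrable (fun ω => b (Z l ω) ^ 2) μ := fun l =>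
    (integrable_map_measure (μ := μ) (f := Z l) (g := fun z => b z ^ 2)
      (hbm.pow_const 2).aestronglyMeasurable (hZm l)).mp (by rw [(hlaw l).map_eq]; exact hb2)
  have hΦ2 : ∀ i, MemLp (fun ω => Φ (Z i ω) (Z j ω)) 2 μ := fun i => by
    refine (memLp_two_iff_integrable_sq_norm (hΦm i).aestronglyMeasurable).mpr ?_
    refine (hbi i).mono' ((hΦm i).norm.pow_const 2).aestronglyMeasurable (ae_of_all _ fun ω => ?_)
    rw [Real.norm_of_nonneg (by positivity)]
    exact pow_le_pow_left₀ (norm_nonneg _) (hb _ _) 2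
  have hconj : ∀ k, MemLp (fun ω => starRingEnd ℂ (Φ (Z k ω) (Z j ω))) 2 μ := fun k => by
    refine (memLp_congr_norm (Complex.continuous_conj.measurable.comp_aemeasurable
      (hΦm k)).aestronglyMeasurable (hΦm k).aestronglyMeasurable
      (ae_of_all _ fun ω => ?_)).mpr (hΦ2 k)
    exact RCLike.norm_conj _
  have hii : ∀ i k, Integrable
      (fun ω => Φ (Z i ω) (Z j ω) * starRingEnd ℂ (Φ (Z k ω) (Z j ω))) μ := fun i k =>
    (hΦ2 i).integrable_mul (hconj k)
  have hexp : ∀ ω, ((‖∑ i ∈ Finset.range n, Φ (Z i ω) (Z j ω)‖ ^ 2 : ℝ) : ℂ)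
      = ∑ i ∈ Finset.range n, ∑ k ∈ Finset.range n,
        Φ (Z i ω) (Z j ω) * starRingEnd ℂ (Φ (Z k ω) (Z j ω)) := fun ω => by
    rw [Complex.ofReal_pow, ← Complex.mul_conj', map_sum, Finset.sum_mul_sum]
  have hint : Integrable (fun ω => ‖∑ i ∈ Finset.range n, Φ (Z i ω) (Z j ω)‖ ^ 2) μ :=
    (memLp_finsetSum (Finset.range n) fun i _ => hΦ2 i).integrable_norm_pow (by norm_num)
  refine ⟨hint, ?_⟩
  have hoff : ∀ i k, i ≠ k →
      ∫ ω, Φ (Z i ω) (Z j ω) * starRingEnd ℂ (Φ (Z k ω) (Z j ω)) ∂μ = 0 := by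
    intro i k hik
    by_cases hjk : j = k
    · have hji : j ≠ i := fun h => hik (h.symm.trans hjk)
      have h1 := integral_mul_conj_eq_zero hind hlaw hΦ hbm hb hb2 hcent (Ne.symm hik) hji
      have h2 := congrArg (starRingEnd ℂ) h1
      rw [← integral_conj, map_zero] at h2
      rw [← h2]
      refine integral_congr_ae (ae_of_all _ fun ω => ?_)
      simp [mul_comm]
    · exact integral_mul_conj_eq_zero hind hlaw hΦ hbm hb hb2 hcent hik hjk
  have hsum : ((∫ ω, ‖∑ i ∈ Finset.range n, Φ (Z i ω) (Z j ω)‖ ^ 2 ∂μ : ℝ) : ℂ)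
      = ∑ i ∈ Finset.range n, ((∫ ω, ‖Φ (Z i ω) (Z j ω)‖ ^ 2 ∂μ : ℝ) : ℂ) := by
    rw [← integral_complex_ofReal]
    simp_rw [hexp]
    rw [integral_finsetSum _ fun i _ => integrable_finsetSum _ fun k _ => hii i k]
    refine Finset.sum_congr rfl fun i hi => ?_
    rw [integral_finsetSum _ fun k _ => hii i k,
      Finset.sum_eq_single_of_mem i hi fun k _ hki => hoff i k (Ne.symm hki),
      ← integral_complex_ofReal]
    refine integral_congr_ae (ae_of_all _ fun ω => ?_)
    simp only
    rw [Complex.mul_conj', Complex.ofReal_pow]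
  rw [← Complex.ofReal_sum, Complex.ofReal_inj] at hsum
  rw [hsum]
  have hdiag : ∀ i, ∫ ω, ‖Φ (Z i ω) (Z j ω)‖ ^ 2 ∂μ ≤ ∫ z, b z ^ 2 ∂P := fun i => by
    have h1 : ∫ ω, b (Z i ω) ^ 2 ∂μ = ∫ z, b z ^ 2 ∂P :=
      (hlaw i).integral_comp (hbm.pow_const 2).aestronglyMeasurable
    rw [← h1]
    refine integral_mono ((hΦ2 i).integrable_norm_pow (by norm_num)) (hbi i) fun ω => ?_
    exact pow_le_pow_left₀ (norm_nonneg _) (hb _ _) 2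
  calc _ ≤ ∑ _i ∈ Finset.range n, ∫ z, b z ^ 2 ∂P := Finset.sum_le_sum fun i _ => hdiag i
    _ = _ := by rw [Finset.sum_const, Finset.card_range, nsmul_eq_mul]

end Averages

/-! ### The empirical target vectors -/

section EmpiricalVectors

variable {p d : ℕ}

lemma norm_exp_sub_exp_le (a b : ℝ) :
    ‖Complex.exp (Complex.I * a) - Complex.exp (Complex.I * b)‖ ≤ |a - b| := by
  have h1 : Complex.exp (Complex.I * a) - Complex.exp (Complex.I * b)
      = Complex.exp (Complex.I * b) * (Complex.exp (Complex.I * ((a - b : ℝ) : ℂ)) - 1) := by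
    rw [mul_sub, ← Complex.exp_add, mul_one]
    congr 2
    push_cast
    ring
  rw [h1, norm_mul, Complex.norm_exp_I_mul_ofReal, one_mul]
  exact Real.norm_exp_I_mul_ofReal_sub_one_le

/-- Effect of an error in the residuals on the empirical target vector. -/
lemma norm_mHat_sub_mHat_le (x : ℕ → EuclideanSpace ℝ (Fin p)) {e η G : ℕ → ℝ} {δ : ℝ}
    (h : ∀ j, |e j - η j| ≤ G j * δ) (n j : ℕ) (k : Fin p) :
    ‖mHat x e n (e j) k - mHat x η n (η j) k‖
      ≤ δ * (|e j| * ((n : ℝ)⁻¹ * ∑ i ∈ Finset.range n, ‖x i‖ * G i)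
        + G j * ((n : ℝ)⁻¹ * ∑ i ∈ Finset.range n, ‖x i‖ * |η i|)) := by
  have h1 : mHat x e n (e j) k - mHat x η n (η j) k = ((n : ℝ)⁻¹ : ℂ) * ∑ i ∈ Finset.range n,
      (x i k : ℂ) * (Complex.exp (Complex.I * ((e j * e i : ℝ) : ℂ))
        - Complex.exp (Complex.I * ((η j * η i : ℝ) : ℂ))) := by
    unfold mHat
    rw [← mul_sub, ← Finset.sum_sub_distrib, one_div]
    push_cast
    congr 1
    refine Finset.sum_congr rfl fun i _ => ?_
    rw [mul_sub, mul_assoc, mul_assoc]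
  rw [h1, norm_mul, norm_inv, Complex.norm_real, Real.norm_of_nonneg (Nat.cast_nonneg n)]
  have h2 : ‖∑ i ∈ Finset.range n, (x i k : ℂ) * (Complex.exp (Complex.I * ((e j * e i : ℝ) : ℂ))
        - Complex.exp (Complex.I * ((η j * η i : ℝ) : ℂ)))‖
      ≤ ∑ i ∈ Finset.range n, ‖x i‖ * (δ * (|e j| * G i + G j * |η i|)) := by
    refine (norm_sum_le _ _).trans (Finset.sum_le_sum fun i _ => ?_)
    rw [norm_mul, Complex.norm_real]
    refine mul_le_mul (PiLp.norm_apply_le (x i) k) ((norm_exp_sub_exp_le _ _).trans ?_)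
      (norm_nonneg _) (norm_nonneg _)
    calc |e j * e i - η j * η i| = |e j * (e i - η i) + (e j - η j) * η i| := by ring_nf
      _ ≤ |e j| * |e i - η i| + |e j - η j| * |η i| := by
          rw [← abs_mul, ← abs_mul]; exact abs_add_le _ _
      _ ≤ |e j| * (G i * δ) + G j * δ * |η i| :=
          add_le_add (mul_le_mul_of_nonneg_left (h i) (abs_nonneg _))
            (mul_le_mul_of_nonneg_right (h j) (abs_nonneg _))
      _ = _ := by ring
  refine (mul_le_mul_of_nonneg_left h2 (by positivity)).trans (le_of_eq ?_)
  have h3 : ∑ i ∈ Finset.range n, ‖x i‖ * (δ * (|e j| * G i + G j * |η i|))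
      = δ * (|e j| * ∑ i ∈ Finset.range n, ‖x i‖ * G i
        + G j * ∑ i ∈ Finset.range n, ‖x i‖ * |η i|) := by
    rw [Finset.mul_sum, Finset.mul_sum, ← Finset.sum_add_distrib, Finset.mul_sum]
    exact Finset.sum_congr rfl fun i _ => by ring
  rw [h3]
  ring

/-- The mean squared distance between the empirical target vectors `m̂ₙ(ê_j)`, for residuals `ê`, and
vectors `m_j`. -/
def meanSqDev (x : ℕ → EuclideanSpace ℝ (Fin p)) (e : ℕ → ℝ) (m : ℕ → Fin p → ℂ) (n : ℕ) : ℝ :=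
  (n : ℝ)⁻¹ * ∑ j ∈ Finset.range n, ∑ k, ‖mHat x e n (e j) k - m j k‖ ^ 2

lemma meanSqDev_nonneg (x : ℕ → EuclideanSpace ℝ (Fin p)) (e : ℕ → ℝ) (m : ℕ → Fin p → ℂ)
    (n : ℕ) : 0 ≤ meanSqDev x e m n := by
  unfold meanSqDev; positivity

/-- Replacing the true residuals by the estimated ones. -/
lemma meanSqDev_le (x : ℕ → EuclideanSpace ℝ (Fin p)) {e η G : ℕ → ℝ} {δ : ℝ}
    (h : ∀ j, |e j - η j| ≤ G j * δ) (m : ℕ → Fin p → ℂ) (n : ℕ)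
    (hls : ∑ j ∈ Finset.range n, e j ^ 2 ≤ ∑ j ∈ Finset.range n, η j ^ 2) :
    meanSqDev x e m n ≤ 4 * p * (δ ^ 2 *
      (((n : ℝ)⁻¹ * ∑ i ∈ Finset.range n, ‖x i‖ * G i) ^ 2
          * ((n : ℝ)⁻¹ * ∑ j ∈ Finset.range n, η j ^ 2)
        + ((n : ℝ)⁻¹ * ∑ i ∈ Finset.range n, ‖x i‖ * |η i|) ^ 2
          * ((n : ℝ)⁻¹ * ∑ j ∈ Finset.range n, G j ^ 2)))
      + 2 * meanSqDev x η m n := by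
  set a := (n : ℝ)⁻¹ * ∑ i ∈ Finset.range n, ‖x i‖ * G i with ha
  set b := (n : ℝ)⁻¹ * ∑ i ∈ Finset.range n, ‖x i‖ * |η i| with hb
  have h1 : ∀ j k, ‖mHat x e n (e j) k - m j k‖ ^ 2
      ≤ 4 * (δ ^ 2 * (a ^ 2 * e j ^ 2 + b ^ 2 * G j ^ 2))
        + 2 * ‖mHat x η n (η j) k - m j k‖ ^ 2 := by
    intro j k
    have h2 := norm_mHat_sub_mHat_le x h n j k
    rw [← ha, ← hb] at h2
    have h3 : ‖mHat x e n (e j) k - m j k‖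
        ≤ ‖mHat x e n (e j) k - mHat x η n (η j) k‖ + ‖mHat x η n (η j) k - m j k‖ :=
      norm_sub_le_norm_sub_add_norm_sub _ _ _
    have h4 : ‖mHat x e n (e j) k - mHat x η n (η j) k‖ ^ 2
        ≤ (δ * (|e j| * a + G j * b)) ^ 2 := pow_le_pow_left₀ (norm_nonneg _) h2 2
    have h5 : (δ * (|e j| * a + G j * b)) ^ 2
        ≤ 2 * (δ ^ 2 * (a ^ 2 * e j ^ 2 + b ^ 2 * G j ^ 2)) := by
      have h6 : (|e j| * a + G j * b) ^ 2 ≤ 2 * (a ^ 2 * e j ^ 2 + b ^ 2 * G j ^ 2) := by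
        rw [← sq_abs (e j)]
        nlinarith [sq_nonneg (|e j| * a - G j * b)]
      rw [mul_pow]
      nlinarith [mul_le_mul_of_nonneg_left h6 (sq_nonneg δ)]
    have h7 : ‖mHat x e n (e j) k - m j k‖ ^ 2
        ≤ (‖mHat x e n (e j) k - mHat x η n (η j) k‖ + ‖mHat x η n (η j) k - m j k‖) ^ 2 :=
      pow_le_pow_left₀ (norm_nonneg _) h3 2
    nlinarith [sq_nonneg (‖mHat x e n (e j) k - mHat x η n (η j) k‖
      - ‖mHat x η n (η j) k - m j k‖)]
  have hn0 : (0 : ℝ) ≤ (n : ℝ)⁻¹ := by positivity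
  calc meanSqDev x e m n
      ≤ (n : ℝ)⁻¹ * ∑ j ∈ Finset.range n, ∑ k : Fin p,
          (4 * (δ ^ 2 * (a ^ 2 * e j ^ 2 + b ^ 2 * G j ^ 2))
            + 2 * ‖mHat x η n (η j) k - m j k‖ ^ 2) :=
        mul_le_mul_of_nonneg_left (Finset.sum_le_sum fun j _ => Finset.sum_le_sum fun k _ => h1 j k)
          hn0
    _ = 4 * p * (δ ^ 2 * (a ^ 2 * ((n : ℝ)⁻¹ * ∑ j ∈ Finset.range n, e j ^ 2)
          + b ^ 2 * ((n : ℝ)⁻¹ * ∑ j ∈ Finset.range n, G j ^ 2))) + 2 * meanSqDev x η m n := by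
        unfold meanSqDev
        simp only [Finset.sum_add_distrib, Finset.sum_const, Finset.card_univ, Fintype.card_fin,
          nsmul_eq_mul, ← Finset.mul_sum]
        ring
    _ ≤ _ := by
        have h2 : (n : ℝ)⁻¹ * ∑ j ∈ Finset.range n, e j ^ 2
            ≤ (n : ℝ)⁻¹ * ∑ j ∈ Finset.range n, η j ^ 2 := mul_le_mul_of_nonneg_left hls hn0
        gcongr

variable {P : Measure (EuclideanSpace ℝ (Fin p) × ℝ)} [IsProbabilityMeasure P]
  {Ω : Type*} [MeasurableSpace Ω] {μ : Measure Ω} [IsProbabilityMeasure μ]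
  {x : ℕ → Ω → EuclideanSpace ℝ (Fin p)} {y : ℕ → Ω → ℝ}

/-- With the true residuals, the empirical target vectors are at distance `O_p(n^{-1/2})` from the
population ones, in quadratic mean over the sample. -/
lemma bddAboveInProb_meanSqDev_true
    (hX : MemLp (fun z : EuclideanSpace ℝ (Fin p) × ℝ => z.1) 2 P)
    {η : EuclideanSpace ℝ (Fin p) × ℝ → ℝ} (hη : Measurable η)
    (hindep : iIndepFun (fun j ω => (x j ω, y j ω)) μ)
    (hlaw : ∀ j, HasLaw (fun ω => (x j ω, y j ω)) P μ) :
    BddAboveInProb μ (fun n ω => (n : ℝ) * meanSqDev (fun j => x j ω)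
      (fun j => η (x j ω, y j ω)) (fun j => targetVector P η (η (x j ω, y j ω))) n) := by
  set Φ : Fin p → EuclideanSpace ℝ (Fin p) × ℝ → EuclideanSpace ℝ (Fin p) × ℝ → ℂ :=
    fun k z w => (z.1 k : ℂ) * Complex.exp (Complex.I * η w * η z)
      - targetVector P η (η w) k with hΦ
  have hΦm : ∀ k, Measurable (Function.uncurry (Φ k)) := by
    intro k
    have h1 : Measurable fun e : (EuclideanSpace ℝ (Fin p) × ℝ) × (EuclideanSpace ℝ (Fin p) × ℝ) =>
        targetVector P η (η e.2) k :=
      (measurable_targetVector (P := P) hη k).comp (hη.comp measurable_snd)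
    have h2 : Measurable fun e : (EuclideanSpace ℝ (Fin p) × ℝ) × (EuclideanSpace ℝ (Fin p) × ℝ) =>
        (e.1.1 k : ℂ) * Complex.exp (Complex.I * η e.2 * η e.1) := by fun_prop
    exact h2.sub h1
  set b : EuclideanSpace ℝ (Fin p) × ℝ → ℝ := fun z => ‖z.1‖ + absMean P with hb
  have hbm : Measurable b := by fun_prop
  have hbΦ : ∀ k z w, ‖Φ k z w‖ ≤ b z := by
    intro k z w
    refine (norm_sub_le _ _).trans (add_le_add ?_ (norm_targetVector_le hX _ k))
    rw [norm_mul, norm_exp_I_mul, mul_one, Complex.norm_real]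
    exact PiLp.norm_apply_le z.1 k
  have hb2 : Integrable (fun z => b z ^ 2) P :=
    (hX.norm.add (memLp_const (absMean P))).integrable_sq
  have hcent : ∀ k w, ∫ z, Φ k z w ∂P = 0 := by
    intro k w
    simp only [hΦ]
    rw [integral_sub (integrable_coord_mul_exp hX hη _ k) (integrable_const _)]
    simp [targetVector]
  have hsq := fun k => integral_norm_sum_sq_le (P := P) hindep hlaw (hΦm k) hbm (hbΦ k) hb2
    (hcent k)
  set V := ∫ z, b z ^ 2 ∂P with hV
  set D : ℕ → Ω → ℝ := fun n ω => ∑ j ∈ Finset.range n, ∑ k, ((n : ℝ)⁻¹) ^ 2 *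
    ‖∑ i ∈ Finset.range n, Φ k (x i ω, y i ω) (x j ω, y j ω)‖ ^ 2 with hD
  have hDi : ∀ n, Integrable (D n) μ := fun n => integrable_finsetSum _ fun j _ =>
    integrable_finsetSum _ fun k _ => ((hsq k n j).1).const_mul _
  have hV0 : 0 ≤ V := integral_nonneg fun _ => by positivity
  have hDint : ∀ n, ∫ ω, D n ω ∂μ ≤ p * V := by
    intro n
    simp only [hD]
    rw [integral_finsetSum _ fun j _ => integrable_finsetSum _ fun k _ =>
      ((hsq k n j).1).const_mul _]
    have h1 : ∀ j, ∫ ω, ∑ k, ((n : ℝ)⁻¹) ^ 2 *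
        ‖∑ i ∈ Finset.range n, Φ k (x i ω, y i ω) (x j ω, y j ω)‖ ^ 2 ∂μ
        ≤ p * (((n : ℝ)⁻¹) ^ 2 * (n * V)) := by
      intro j
      rw [integral_finsetSum _ fun k _ => ((hsq k n j).1).const_mul _]
      calc _ ≤ ∑ _k : Fin p, ((n : ℝ)⁻¹) ^ 2 * (n * V) := by
            refine Finset.sum_le_sum fun k _ => ?_
            rw [integral_const_mul]
            exact mul_le_mul_of_nonneg_left (hsq k n j).2 (by positivity)
        _ = _ := by simp
    refine (Finset.sum_le_sum fun j _ => h1 j).trans ?_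
    rw [Finset.sum_const, Finset.card_range, nsmul_eq_mul]
    rcases eq_or_ne (n : ℝ) 0 with h | h
    · rw [h]; simp; positivity
    · refine le_of_eq ?_
      field_simp
  have hDbdd : BddAboveInProb μ D := by
    refine bddAboveInProb_of_lintegral_le (C := ENNReal.ofReal (p * V)) ENNReal.ofReal_ne_top
      (fun n => (hDi n).aestronglyMeasurable.aemeasurable) (Eventually.of_forall fun n => ?_)
    rw [← ofReal_integral_eq_lintegral_ofReal (hDi n)
      (ae_of_all _ fun ω => by simp only [hD]; positivity)]
    exact ENNReal.ofReal_le_ofReal (hDint n)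
  refine hDbdd.mono ?_
  filter_upwards [eventually_gt_atTop 0] with n hn
  refine ae_of_all _ fun ω => le_of_eq ?_
  have hn0 : (n : ℝ) ≠ 0 := by exact_mod_cast hn.ne'
  have hnc : (n : ℂ) ≠ 0 := by exact_mod_cast hn.ne'
  unfold meanSqDev
  rw [mul_inv_cancel_left₀ hn0]
  refine Finset.sum_congr rfl fun j _ => Finset.sum_congr rfl fun k _ => ?_
  have h1 : mHat (fun j => x j ω) (fun j => η (x j ω, y j ω)) n (η (x j ω, y j ω)) k
      - targetVector P η (η (x j ω, y j ω)) k
      = ((n : ℝ)⁻¹ : ℂ) * ∑ i ∈ Finset.range n, Φ k (x i ω, y i ω) (x j ω, y j ω) := by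
    simp only [hΦ, mHat, Finset.sum_sub_distrib, Finset.sum_const, Finset.card_range,
      nsmul_eq_mul, mul_sub, one_div, Complex.ofReal_natCast]
    rw [inv_mul_cancel_left₀ hnc]
  rw [h1, norm_mul, mul_pow, norm_inv, Complex.norm_real, Real.norm_of_nonneg (Nat.cast_nonneg n)]

variable {g : EuclideanSpace ℝ (Fin p) → EuclideanSpace ℝ (Fin d) → ℝ}
  {Θ : Set (EuclideanSpace ℝ (Fin d))} {θs : EuclideanSpace ℝ (Fin d)}

/-- With the residuals of the least squares fit, the empirical target vectors are still at distance
`O_p(n^{-1/2})` from the population ones, in quadratic mean over the sample. -/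
lemma RegularityConditions.bddAboveInProb_meanSqDev (hreg : RegularityConditions P g Θ θs)
    (hnd : NondegenerateMin P g Θ θs)
    (hindep : iIndepFun (fun j ω => (x j ω, y j ω)) μ)
    (hlaw : ∀ j, HasLaw (fun ω => (x j ω, y j ω)) P μ)
    {θhat : ℕ → Ω → EuclideanSpace ℝ (Fin d)}
    (hθ : ∀ n ω, IsLeastSquares g Θ (fun j => x j ω) (fun j => y j ω) n (θhat n ω)) :
    BddAboveInProb μ (fun n ω => (n : ℝ) * meanSqDev (fun j => x j ω)
      (fun j => y j ω - g (x j ω) (θhat n ω))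
      (fun j => targetVector P (residual g θs) (residual g θs (x j ω, y j ω))) n) := by
  obtain ⟨G, hGm, hG0, hG2, hGlip⟩ := hreg.exists_lipschitz_g
  have hηm := hreg.measurable_residual θs
  have hη2 := hreg.memLp_residual hreg.mem_Θ
  have hGL : MemLp G 2 P := (memLp_two_iff_integrable_sq hGm.aestronglyMeasurable).mpr hG2
  have hrate := hreg.bddAboveInProb_leastSquares hnd hindep hlaw hθ
  have htrue := bddAboveInProb_meanSqDev_true hreg.memLp_X hηm hindep hlaw
  have hA := bddAboveInProb_average (P := P) hlaw (φ := fun z => ‖z.1‖ * G z) (by fun_prop)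
    (fun z => mul_nonneg (norm_nonneg _) (hG0 z)) (hreg.memLp_X.norm.integrable_mul hGL)
  have hB := bddAboveInProb_average (P := P) hlaw (φ := fun z => ‖z.1‖ * |residual g θs z|)
    (by fun_prop) (fun z => by positivity) (hreg.memLp_X.norm.integrable_mul hη2.abs)
  have hS := bddAboveInProb_average (P := P) hlaw (φ := fun z => residual g θs z ^ 2)
    (by fun_prop) (fun z => by positivity) hη2.integrable_sq
  have hΓ := bddAboveInProb_average (P := P) hlaw (φ := fun z => G z ^ 2)
    (by fun_prop) (fun z => by positivity) hG2
  have hA0 : ∀ (n : ℕ) (ω : Ω), 0 ≤ (n : ℝ)⁻¹ * ∑ j ∈ Finset.range n,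
      ‖x j ω‖ * G (x j ω, y j ω) := fun n ω =>
    mul_nonneg (by positivity) (Finset.sum_nonneg fun j _ => mul_nonneg (norm_nonneg _) (hG0 _))
  have hsum := ((hA.pow_two hA0).mul hS (fun n ω => sq_nonneg _) fun n ω => by positivity).add
    ((hB.pow_two fun n ω => by positivity).mul hΓ (fun n ω => sq_nonneg _)
      fun n ω => by positivity)
  have hprod := ((hrate.pow_two fun n ω => by positivity).mul hsum (fun n ω => sq_nonneg _)
    fun n ω => by positivity)
  have htotal := ((bddAboveInProb_const (μ := μ) (4 * p : ℝ)).mul hprod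
    (fun n ω => by positivity) fun n ω => by positivity).add
      ((bddAboveInProb_const (μ := μ) (2 : ℝ)).mul htrue (fun n ω => by positivity)
        fun n ω => mul_nonneg (by positivity) (meanSqDev_nonneg _ _ _ _))
  refine htotal.mono (Eventually.of_forall fun n => ae_of_all _ fun ω => ?_)
  have hdet := meanSqDev_le (fun j => x j ω) (e := fun j => y j ω - g (x j ω) (θhat n ω))
    (η := fun j => residual g θs (x j ω, y j ω)) (G := fun j => G (x j ω, y j ω))
    (δ := ‖θhat n ω - θs‖) (fun j => by
      have h1 := hGlip (x j ω, y j ω) θs hreg.mem_Θ (θhat n ω) (hθ n ω).1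
      rw [norm_sub_rev] at h1
      simp only [residual]
      rw [sub_sub_sub_cancel_left]
      exact h1)
    (fun j => targetVector P (residual g θs) (residual g θs (x j ω, y j ω))) n
    ((hθ n ω).2 θs hreg.mem_Θ)
  have hn0 : (0 : ℝ) ≤ n := Nat.cast_nonneg n
  refine (mul_le_mul_of_nonneg_left hdet hn0).trans (le_of_eq ?_)
  simp only
  rw [mul_pow (Real.sqrt n), Real.sq_sqrt hn0]
  ring

end EmpiricalVectors

/-! ### Averages of outer products -/

section OuterMean

variable {p : ℕ}

/-- The matrix `n⁻¹ ∑ⱼ aⱼ aⱼᴴ`, where `j` runs over the first `n` indices. The matrix `MHat x e n` is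
the case `aⱼ = m̂ₙ(eⱼ)`, by definition. -/
def outerMean (a : ℕ → Fin p → ℂ) (n : ℕ) : Matrix (Fin p) (Fin p) ℂ :=
  Matrix.of fun k l => (1 / (n : ℂ)) * ∑ j ∈ Finset.range n, a j k * starRingEnd ℂ (a j l)

lemma quadForm_outerMean (a : ℕ → Fin p → ℂ) (n : ℕ) (v : EuclideanSpace ℂ (Fin p)) :
    quadForm (outerMean a n) v
      = (n : ℝ)⁻¹ * ∑ j ∈ Finset.range n, ‖∑ k, starRingEnd ℂ (v k) * a j k‖ ^ 2 := by
  have h : ∑ k, ∑ l, starRingEnd ℂ (v k) * outerMean a n k l * v l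
      = (((n : ℝ)⁻¹ * ∑ j ∈ Finset.range n, ‖∑ k, starRingEnd ℂ (v k) * a j k‖ ^ 2 : ℝ) : ℂ) := by
    rw [Complex.ofReal_mul, Complex.ofReal_sum]
    simp_rw [← star_mul_mul_eq_normSq]
    rw [Finset.sum_comm (s := Finset.range n), Finset.mul_sum]
    refine Finset.sum_congr rfl fun k _ => ?_
    rw [Finset.sum_comm (s := Finset.range n), Finset.mul_sum]
    refine Finset.sum_congr rfl fun l _ => ?_
    simp only [outerMean, Matrix.of_apply, Finset.mul_sum, Finset.sum_mul]
    refine Finset.sum_congr rfl fun j _ => ?_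
    push_cast
    ring
  rw [quadForm_eq_re_sum, h, Complex.ofReal_re]

lemma quadForm_outerMean_nonneg (a : ℕ → Fin p → ℂ) (n : ℕ) (v : EuclideanSpace ℂ (Fin p)) :
    0 ≤ quadForm (outerMean a n) v := by
  rw [quadForm_outerMean]
  positivity

lemma norm_sum_conj_mul_sq_le (v : EuclideanSpace ℂ (Fin p)) (w : Fin p → ℂ) :
    ‖∑ k, starRingEnd ℂ (v k) * w k‖ ^ 2 ≤ (∑ k, ‖w k‖ ^ 2) * ‖v‖ ^ 2 := by
  have h1 : ‖∑ k, starRingEnd ℂ (v k) * w k‖ ≤ ∑ k, ‖v k‖ * ‖w k‖ := by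
    refine (norm_sum_le _ _).trans (le_of_eq (Finset.sum_congr rfl fun k _ => ?_))
    rw [norm_mul, RCLike.norm_conj]
  calc _ ≤ (∑ k, ‖v k‖ * ‖w k‖) ^ 2 := pow_le_pow_left₀ (norm_nonneg _) h1 2
    _ ≤ (∑ k, ‖v k‖ ^ 2) * ∑ k, ‖w k‖ ^ 2 := Finset.sum_mul_sq_le_sq_mul_sq _ _ _
    _ = _ := by rw [EuclideanSpace.norm_sq_eq, mul_comm]

/-- The quadratic forms of two such matrices agree up to a factor `2` and the mean squared distance of
the vectors. Keeping the factor makes the remainder quadratic in the distance, which the order `n⁻¹`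
of the small eigenvalues rests on. -/
lemma quadForm_outerMean_le (a b : ℕ → Fin p → ℂ) (n : ℕ) (v : EuclideanSpace ℂ (Fin p)) :
    quadForm (outerMean a n) v ≤ 2 * quadForm (outerMean b n) v
      + 2 * ((n : ℝ)⁻¹ * ∑ j ∈ Finset.range n, ∑ k, ‖a j k - b j k‖ ^ 2) * ‖v‖ ^ 2 := by
  have h1 : ∀ j, ‖∑ k, starRingEnd ℂ (v k) * a j k‖ ^ 2
      ≤ 2 * ‖∑ k, starRingEnd ℂ (v k) * b j k‖ ^ 2
        + 2 * ((∑ k, ‖a j k - b j k‖ ^ 2) * ‖v‖ ^ 2) := by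
    intro j
    have h2 := norm_sum_conj_mul_sq_le v fun k => a j k - b j k
    have h3 : ∑ k, starRingEnd ℂ (v k) * a j k = ∑ k, starRingEnd ℂ (v k) * b j k
        + ∑ k, starRingEnd ℂ (v k) * (a j k - b j k) := by
      rw [← Finset.sum_add_distrib]
      exact Finset.sum_congr rfl fun k _ => by ring
    have h4 : ‖∑ k, starRingEnd ℂ (v k) * a j k‖ ≤ ‖∑ k, starRingEnd ℂ (v k) * b j k‖
        + ‖∑ k, starRingEnd ℂ (v k) * (a j k - b j k)‖ := by
      rw [h3]
      exact norm_add_le _ _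
    have h5 := pow_le_pow_left₀ (norm_nonneg _) h4 2
    have h6 := add_sq_le (a := ‖∑ k, starRingEnd ℂ (v k) * b j k‖)
      (b := ‖∑ k, starRingEnd ℂ (v k) * (a j k - b j k)‖)
    linarith
  rw [quadForm_outerMean, quadForm_outerMean]
  refine (mul_le_mul_of_nonneg_left (Finset.sum_le_sum fun j _ => h1 j)
    (by positivity : (0 : ℝ) ≤ (n : ℝ)⁻¹)).trans (le_of_eq ?_)
  rw [Finset.sum_add_distrib, ← Finset.mul_sum, ← Finset.mul_sum, ← Finset.sum_mul]
  ring

lemma quadForm_le_add (A B : Matrix (Fin p) (Fin p) ℂ) (v : EuclideanSpace ℂ (Fin p)) :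
    quadForm A v ≤ quadForm B v + (∑ k, ∑ l, ‖B k l - A k l‖) * ‖v‖ ^ 2 := by
  have h1 : quadForm A v - quadForm B v
      = (∑ k, ∑ l, starRingEnd ℂ (v k) * (A k l - B k l) * v l).re := by
    rw [quadForm_eq_re_sum, quadForm_eq_re_sum, ← Complex.sub_re, ← Finset.sum_sub_distrib]
    simp_rw [← Finset.sum_sub_distrib]
    congr 1
    exact Finset.sum_congr rfl fun k _ => Finset.sum_congr rfl fun l _ => by ring
  have h2 : ‖∑ k, ∑ l, starRingEnd ℂ (v k) * (A k l - B k l) * v l‖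
      ≤ (∑ k, ∑ l, ‖B k l - A k l‖) * ‖v‖ ^ 2 := by
    rw [Finset.sum_mul]
    refine (norm_sum_le _ _).trans (Finset.sum_le_sum fun k _ => ?_)
    rw [Finset.sum_mul]
    refine (norm_sum_le _ _).trans (Finset.sum_le_sum fun l _ => ?_)
    rw [norm_mul, norm_mul, RCLike.norm_conj, norm_sub_rev (A k l), mul_comm ‖v k‖, mul_assoc,
      sq]
    exact mul_le_mul_of_nonneg_left (mul_le_mul (PiLp.norm_apply_le v k) (PiLp.norm_apply_le v l)
      (norm_nonneg _) (norm_nonneg _)) (norm_nonneg _)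
  have h3 := (Complex.re_le_norm _).trans h2
  linarith

lemma finrank_ker_add_rank (A : Matrix (Fin p) (Fin p) ℂ) :
    Module.finrank ℂ (LinearMap.ker (Matrix.toEuclideanLin A)) + A.rank = p := by
  have h1 := LinearMap.finrank_range_add_finrank_ker (Matrix.toEuclideanLin A)
  have h2 := A.rank_eq_finrank_range_toLin (EuclideanSpace.basisFun (Fin p) ℂ).toBasis
    (EuclideanSpace.basisFun (Fin p) ℂ).toBasis
  rw [← Matrix.toEuclideanLin_eq_toLin_orthonormal] at h2
  rw [finrank_euclideanSpace_fin] at h1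
  omega

lemma quadForm_eq_zero_of_mem_ker {A : Matrix (Fin p) (Fin p) ℂ} {v : EuclideanSpace ℂ (Fin p)}
    (hv : v ∈ LinearMap.ker (Matrix.toEuclideanLin A)) : quadForm A v = 0 := by
  rw [quadForm_eq_inner, LinearMap.mem_ker.mp hv]
  simp

open scoped ComplexOrder in
/-- The isotropic vectors of a positive semidefinite matrix form its kernel. -/
lemma mem_ker_of_quadForm_eq_zero {A : Matrix (Fin p) (Fin p) ℂ} (hA : A.IsHermitian)
    (h0 : ∀ v, 0 ≤ quadForm A v) {v : EuclideanSpace ℂ (Fin p)} (hv : quadForm A v = 0) :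
    v ∈ LinearMap.ker (Matrix.toEuclideanLin A) := by
  have hpsd : A.PosSemidef := by
    refine Matrix.PosSemidef.of_dotProduct_mulVec_nonneg hA fun u => ?_
    have h1 := h0 (WithLp.toLp 2 u)
    have him : (star u ⬝ᵥ A.mulVec u).im = 0 := hA.im_star_dotProduct_mulVec_self u
    exact Complex.nonneg_iff.mpr ⟨h1, him.symm⟩
  have him : (star v.ofLp ⬝ᵥ A.mulVec v.ofLp).im = 0 := hA.im_star_dotProduct_mulVec_self _
  have h1 := (hpsd.dotProduct_mulVec_zero_iff v.ofLp).mp (Complex.ext hv him)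
  rw [LinearMap.mem_ker]
  ext i
  exact congrFun h1 i

/-- A positive semidefinite matrix is bounded below on a subspace whose dimension is its rank,
namely on the orthogonal complement of its kernel. -/
lemma exists_le_quadForm {A : Matrix (Fin p) (Fin p) ℂ} (hA : A.IsHermitian)
    (h0 : ∀ v, 0 ≤ quadForm A v) :
    ∃ (c : ℝ) (W : Submodule ℂ (EuclideanSpace ℂ (Fin p))), 0 < c ∧
      Module.finrank ℂ W = A.rank ∧ ∀ v ∈ W, c * ‖v‖ ^ 2 ≤ quadForm A v := by
  set T := Matrix.toEuclideanLin A with hT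
  set W := (LinearMap.ker T)ᗮ with hW
  have hrank : Module.finrank ℂ W = A.rank := by
    have h1 : Module.finrank ℂ (LinearMap.ker T) + A.rank = p := finrank_ker_add_rank A
    have h2 : Module.finrank ℂ (LinearMap.ker T) + Module.finrank ℂ W = p := by
      rw [hW, Submodule.finrank_add_finrank_orthogonal, finrank_euclideanSpace_fin]
    omega
  have hcont : Continuous fun v : EuclideanSpace ℂ (Fin p) => quadForm A v := by
    unfold quadForm
    fun_prop
  have hcomp : IsCompact ((W : Set (EuclideanSpace ℂ (Fin p))) ∩ Metric.sphere 0 1) :=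
    (isCompact_sphere _ _).inter_left W.closed_of_finiteDimensional
  have hscale : ∀ (r : ℝ) (v : EuclideanSpace ℂ (Fin p)),
      quadForm A ((r : ℂ) • v) = r ^ 2 * quadForm A v := by
    intro r v
    rw [quadForm_eq_inner, quadForm_eq_inner, map_smul, inner_smul_left, inner_smul_right,
      Complex.conj_ofReal, ← mul_assoc, ← Complex.ofReal_mul, Complex.re_ofReal_mul, sq]
  rcases ((W : Set (EuclideanSpace ℂ (Fin p))) ∩ Metric.sphere 0 1).eq_empty_or_nonempty
    with he | hne
  · refine ⟨1, W, one_pos, hrank, fun v hv => ?_⟩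
    rcases eq_or_ne v 0 with rfl | hv0
    · simp [quadForm]
    · have hn : ‖v‖ ≠ 0 := norm_ne_zero_iff.mpr hv0
      have hmem : ((‖v‖⁻¹ : ℝ) : ℂ) • v ∈
          (W : Set (EuclideanSpace ℂ (Fin p))) ∩ Metric.sphere 0 1 := by
        refine ⟨W.smul_mem _ hv, ?_⟩
        rw [mem_sphere_zero_iff_norm, norm_smul, Complex.norm_real, norm_inv, norm_norm,
          inv_mul_cancel₀ hn]
      rw [he] at hmem
      exact hmem.elim
  · obtain ⟨u, ⟨huW, hu1⟩, hmin⟩ := hcomp.exists_isMinOn hne hcont.continuousOn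
    have hu1' : ‖u‖ = 1 := by simpa using hu1
    have hpos : 0 < quadForm A u := by
      refine (h0 u).lt_of_ne fun hz => ?_
      have h1 := mem_ker_of_quadForm_eq_zero hA h0 hz.symm
      have h2 : u = 0 := by
        have h3 := (Submodule.mem_orthogonal _ _).mp huW u h1
        exact inner_self_eq_zero.mp h3
      simp [h2] at hu1'
    refine ⟨quadForm A u, W, hpos, hrank, fun v hv => ?_⟩
    rcases eq_or_ne v 0 with rfl | hv0
    · simp [quadForm]
    · have hn : ‖v‖ ≠ 0 := norm_ne_zero_iff.mpr hv0
      have hmem : ((‖v‖⁻¹ : ℝ) : ℂ) • v ∈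
          (W : Set (EuclideanSpace ℂ (Fin p))) ∩ Metric.sphere 0 1 := by
        refine ⟨W.smul_mem _ hv, ?_⟩
        rw [mem_sphere_zero_iff_norm, norm_smul, Complex.norm_real, norm_inv, norm_norm,
          inv_mul_cancel₀ hn]
      have h1 : quadForm A u ≤ quadForm A (((‖v‖⁻¹ : ℝ) : ℂ) • v) := hmin hmem
      rw [hscale, inv_pow, inv_mul_eq_div, le_div_iff₀ (by positivity)] at h1
      exact h1

end OuterMean

/-! ### Ridge ratios along a sequence of eigenvalue bounds -/

section RidgeAsymptotics

variable {c₁ c₂ : ℕ → ℝ} {τ : ℝ}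

/-- Squares of quantities of order `n⁻¹` are negligible compared with `c₁ c₂`. -/
lemma eventually_mul_div_sq_lt
    (h : Tendsto (fun n : ℕ => (n : ℝ) ^ 2 * c₁ n * c₂ n) atTop atTop) (C K : ℝ) :
    ∀ᶠ n : ℕ in atTop, C * (K / n) ^ 2 < c₁ n * c₂ n := by
  filter_upwards [h.eventually_gt_atTop (C * K ^ 2), eventually_gt_atTop 0] with n hn hn0
  have hn1 : (0 : ℝ) < n := by exact_mod_cast hn0
  rw [div_pow, ← mul_div_assoc, div_lt_iff₀ (by positivity)]
  linarith

/-- Eigenvalues of order `n⁻¹` eventually give ratios above the threshold. -/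
lemma eventually_lt_rRatio (hτ0 : 0 < τ) (hτ1 : τ < 1)
    (hc₁pos : ∀ᶠ n in atTop, 0 < c₁ n) (hc₂pos : ∀ᶠ n in atTop, 0 < c₂ n)
    (h : Tendsto (fun n : ℕ => (n : ℝ) ^ 2 * c₁ n * c₂ n) atTop atTop) (K : ℝ) :
    ∀ᶠ n : ℕ in atTop, ∀ (lam : ℕ → ℝ) (j : ℕ), (∀ k, 0 ≤ lam k) →
      (∀ k, j ≤ k → lam (k + 1) ≤ lam k) → (n : ℝ) * lam j ≤ K →
      τ < rRatio lam (c₁ n) (c₂ n) j := by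
  have h1τ : 0 < 1 - τ := by linarith
  filter_upwards [hc₁pos, hc₂pos, eventually_mul_div_sq_lt h (τ / (1 - τ)) K,
    eventually_gt_atTop 0] with n h1 h2 h3 hn0 lam j h0 hanti hK
  have hn1 : (0 : ℝ) < n := by exact_mod_cast hn0
  refine lt_rRatio h1 h2 hτ0 h0 hanti ?_
  have hle : lam j ≤ K / n := by rwa [le_div_iff₀' hn1]
  have h5 : lam j ^ 2 ≤ (K / n) ^ 2 := pow_le_pow_left₀ (h0 j) hle 2
  rw [div_mul_eq_mul_div, div_lt_iff₀' h1τ] at h3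
  exact (mul_le_mul_of_nonneg_left h5 hτ0.le).trans_lt h3

/-- An eigenvalue away from zero followed by one of order `n⁻¹` eventually gives a ratio below the
threshold. -/
lemma eventually_rRatio_le (hτ0 : 0 < τ)
    (hc₁pos : ∀ᶠ n in atTop, 0 < c₁ n) (hc₂pos : ∀ᶠ n in atTop, 0 < c₂ n)
    (hc₁ : Tendsto c₁ atTop (𝓝 0)) (hc₂ : Tendsto c₂ atTop (𝓝 0))
    (h : Tendsto (fun n : ℕ => (n : ℝ) ^ 2 * c₁ n * c₂ n) atTop atTop) {a : ℝ} (ha : 0 < a)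
    (K : ℝ) :
    ∀ᶠ n : ℕ in atTop, ∀ (lam : ℕ → ℝ) (q : ℕ), (∀ k, 0 ≤ lam k) → a ≤ lam q →
      (n : ℝ) * lam (q + 1) ≤ K → rRatio lam (c₁ n) (c₂ n) q ≤ τ := by
  have hb : Tendsto (fun n : ℕ => K / (n : ℝ)) atTop (𝓝 0) := tendsto_const_div_atTop_nhds_zero_nat K
  have hb2 : Tendsto (fun n : ℕ => (K / (n : ℝ)) ^ 2) atTop (𝓝 0) := by simpa using hb.pow 2
  have hl : Tendsto (fun n : ℕ => 2 * c₂ n * ((K / (n : ℝ)) ^ 2 + c₁ n)) atTop (𝓝 0) := by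
    simpa using (hc₂.const_mul 2).mul (hb2.add hc₁)
  have hr : Tendsto (fun n : ℕ => τ * ((a / (a + 1)) ^ 2 - (K / (n : ℝ)) ^ 2)) atTop
      (𝓝 (τ * ((a / (a + 1)) ^ 2))) := by
    simpa using (tendsto_const_nhds.sub hb2).const_mul τ
  have hpos : 0 < τ * ((a / (a + 1)) ^ 2) := by positivity
  filter_upwards [hc₁pos, hc₂pos, eventually_mul_div_sq_lt h 1 K, hl.eventually_lt hr hpos,
    hb.eventually_lt_const ha, eventually_gt_atTop 0] with n h1 h2 h3 h4 h5 hn0 lam q h0 hq hK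
  have hn1 : (0 : ℝ) < n := by exact_mod_cast hn0
  have hle : lam (q + 1) ≤ K / n := by rwa [le_div_iff₀' hn1]
  have hsq : lam (q + 1) ^ 2 ≤ (K / n) ^ 2 := pow_le_pow_left₀ (h0 _) hle 2
  refine rRatio_le h1 h2 hτ0 h0 ha hq le_rfl (hle.trans h5.le) (by linarith) ?_
  calc _ ≤ 2 * c₂ n * ((K / (n : ℝ)) ^ 2 + c₁ n) := by gcongr
    _ ≤ τ * ((a / (a + 1)) ^ 2 - (K / (n : ℝ)) ^ 2) := h4.le
    _ ≤ _ := by gcongr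

end RidgeAsymptotics

/-! ### Consistency of the estimated dimension -/

section Consistency

variable {p d : ℕ} {P : Measure (EuclideanSpace ℝ (Fin p) × ℝ)} [IsProbabilityMeasure P]
  {g : EuclideanSpace ℝ (Fin p) → EuclideanSpace ℝ (Fin d) → ℝ}
  {Θ : Set (EuclideanSpace ℝ (Fin d))} {θs : EuclideanSpace ℝ (Fin d)}
  {η : EuclideanSpace ℝ (Fin p) × ℝ → ℝ}
  {Ω : Type*} [MeasurableSpace Ω] {μ : Measure Ω} [IsProbabilityMeasure μ]

lemma quadForm_MHat_nonneg (x : ℕ → EuclideanSpace ℝ (Fin p)) (e : ℕ → ℝ) (n : ℕ)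
    (v : EuclideanSpace ℂ (Fin p)) : 0 ≤ quadForm (MHat x e n) v :=
  quadForm_outerMean_nonneg _ n v

lemma quadForm_MHat_le (x : ℕ → EuclideanSpace ℝ (Fin p)) (e : ℕ → ℝ) (m : ℕ → Fin p → ℂ)
    (n : ℕ) (v : EuclideanSpace ℂ (Fin p)) :
    quadForm (MHat x e n) v ≤ 2 * quadForm (outerMean m n) v + 2 * meanSqDev x e m n * ‖v‖ ^ 2 :=
  quadForm_outerMean_le _ m n v

lemma quadForm_outerMean_le_MHat (x : ℕ → EuclideanSpace ℝ (Fin p)) (e : ℕ → ℝ)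
    (m : ℕ → Fin p → ℂ) (n : ℕ) (v : EuclideanSpace ℂ (Fin p)) :
    quadForm (outerMean m n) v ≤ 2 * quadForm (MHat x e n) v + 2 * meanSqDev x e m n * ‖v‖ ^ 2 := by
  have h1 := quadForm_outerMean_le m (fun j => mHat x e n (e j)) n v
  simp_rw [norm_sub_rev (m _ _)] at h1
  exact h1

lemma sortedEigenvalue_le_of_le {A : Matrix (Fin p) (Fin p) ℂ} (hA : A.IsHermitian)
    (h : ∀ v, 0 ≤ quadForm A v) {i j : ℕ} (hi : 1 ≤ i) (hij : i ≤ j) :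
    sortedEigenvalue hA j ≤ sortedEigenvalue hA i := by
  induction j, hij using Nat.le_induction with
  | base => exact le_rfl
  | succ k hk ih => exact (sortedEigenvalue_succ_le hA h (hi.trans hk)).trans ih

/-- Under independence of `X` and `η` the target vector vanishes identically. -/
lemma targetVector_eq_zero_of_indepFun
    (hX : MemLp (fun z : EuclideanSpace ℝ (Fin p) × ℝ => z.1) 2 P) (h0 : ∫ z, z.1 ∂P = 0)
    (hη : Measurable η) (hind : IndepFun Prod.fst η P) (t : ℝ) (k : Fin p) :
    targetVector P η t k = 0 := by
  have h1 : IndepFun (fun z : EuclideanSpace ℝ (Fin p) × ℝ => (z.1 k : ℂ))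
      (fun z => Complex.exp (Complex.I * t * η z)) P :=
    hind.comp (φ := fun x : EuclideanSpace ℝ (Fin p) => (x k : ℂ))
      (ψ := fun s : ℝ => Complex.exp (Complex.I * t * s)) (by fun_prop) (by fun_prop)
  have h2 : ∫ z : EuclideanSpace ℝ (Fin p) × ℝ, (z.1 k : ℂ) ∂P = 0 := by
    have h3 : ∫ z : EuclideanSpace ℝ (Fin p) × ℝ, z.1 k ∂P = 0 := by
      have h4 := (EuclideanSpace.proj (𝕜 := ℝ) k).integral_comp_comm
        (hX.integrable (by norm_num) : Integrable (fun z => z.1) P)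
      rw [h0, map_zero] at h4
      exact h4
    rw [integral_complex_ofReal, h3, Complex.ofReal_zero]
  unfold targetVector
  rw [h1.integral_fun_mul_eq_mul_integral (by fun_prop)
    (by fun_prop : Measurable fun z => Complex.exp (Complex.I * t * η z)).aestronglyMeasurable,
    h2, zero_mul]

/-- Almost surely all target vectors are orthogonal to the whole kernel of the target matrix. -/
lemma ae_forall_mem_ker_sum_targetVector_eq_zero
    (hX : MemLp (fun z : EuclideanSpace ℝ (Fin p) × ℝ => z.1) 2 P) (hη : Measurable η) :
    ∀ᵐ z ∂P, ∀ v ∈ LinearMap.ker (Matrix.toEuclideanLin (targetMatrix P η)),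
      ∑ k, starRingEnd ℂ (v k) * targetVector P η (η z) k = 0 := by
  set K := LinearMap.ker (Matrix.toEuclideanLin (targetMatrix P η)) with hK
  -- a finite spanning set suffices, so only finitely many null sets are involved
  obtain ⟨S, hS⟩ := IsNoetherian.noetherian K
  have h1 : ∀ᵐ z ∂P, ∀ v ∈ S, ∑ k, starRingEnd ℂ (v k) * targetVector P η (η z) k = 0 := by
    refine (ae_ball_iff S.countable_toSet).mpr fun v hv => ?_
    refine ae_sum_targetVector_eq_zero hX hη (quadForm_eq_zero_of_mem_ker ?_)
    rw [← hK, ← hS]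
    exact Submodule.subset_span hv
  filter_upwards [h1] with z hz v hv
  rw [← hS] at hv
  induction hv using Submodule.span_induction with
  | mem v hv => exact hz v hv
  | zero => simp
  | add u w _ _ hu hw => simp [add_mul, Finset.sum_add_distrib, hu, hw]
  | smul c u _ hu => simp [mul_assoc, ← Finset.mul_sum, hu]

/-- The law of large numbers for the matrices `n⁻¹ ∑ⱼ m(ηⱼ) m(ηⱼ)ᴴ`. -/
lemma tendsto_measure_outerMean_sub
    (hX : MemLp (fun z : EuclideanSpace ℝ (Fin p) × ℝ => z.1) 2 P) (hη : Measurable η)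
    {Z : ℕ → Ω → EuclideanSpace ℝ (Fin p) × ℝ} (hindep : iIndepFun Z μ)
    (hlaw : ∀ j, HasLaw (Z j) P μ) {ε : ℝ} (hε : 0 < ε) :
    Tendsto (fun n => μ {ω | ε ≤ ∑ k, ∑ l,
      ‖outerMean (fun j => targetVector P η (η (Z j ω))) n k l - targetMatrix P η k l‖})
      atTop (𝓝 0) := by
  have hφ : ∀ k l, Measurable fun z => targetVector P η (η z) k *
      starRingEnd ℂ (targetVector P η (η z) l) := fun k l =>
    ((measurable_targetVector hη k).comp hη).mul
      (Complex.continuous_conj.measurable.comp ((measurable_targetVector hη l).comp hη))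
  have hZm : ∀ j, AEMeasurable (Z j) μ := fun j => (hlaw j).aemeasurable
  have hentry : ∀ k l, ∀ᵐ ω ∂μ, Tendsto (fun n => outerMean (fun j => targetVector P η
      (η (Z j ω))) n k l) atTop (𝓝 (targetMatrix P η k l)) := by
    intro k l
    set φ := fun z => targetVector P η (η z) k * starRingEnd ℂ (targetVector P η (η z) l) with hφd
    have hid : ∀ i, IdentDistrib (fun ω => φ (Z i ω)) (fun ω => φ (Z 0 ω)) μ μ := fun i =>
      ((hlaw i).identDistrib (hlaw 0)).comp (hφ k l)
    have hint : Integrable φ P := by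
      have h1 := (integrable_targetVector_mul (P := P) hX hη k l).comp_measurable hη
      exact h1
    have hmean : ∫ ω, φ (Z 0 ω) ∂μ = targetMatrix P η k l := by
      have h1 : ∫ ω, φ (Z 0 ω) ∂μ = ∫ z, φ z ∂P :=
        (hlaw 0).integral_comp (hφ k l).aestronglyMeasurable
      rw [h1]
      simp only [targetMatrix, Matrix.of_apply]
      rw [integral_map hη.aemeasurable
        (integrable_targetVector_mul (P := P) hX hη k l).aestronglyMeasurable]
    have hsl := strong_law_ae (fun i ω => φ (Z i ω))
      (by
        have h1 := (integrable_map_measure (μ := μ) (f := Z 0) (g := φ)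
          (hφ k l).aestronglyMeasurable (hZm 0)).mp (by rw [(hlaw 0).map_eq]; exact hint)
        exact h1)
      (fun i j hij => (hindep.indepFun hij).comp (hφ k l) (hφ k l)) hid
    filter_upwards [hsl] with ω hω
    rw [hmean] at hω
    refine hω.congr fun n => ?_
    simp [outerMean, hφd]
  have hall : ∀ᵐ ω ∂μ, Tendsto (fun n => ∑ k, ∑ l, ‖outerMean (fun j => targetVector P η
      (η (Z j ω))) n k l - targetMatrix P η k l‖) atTop (𝓝 0) := by
    filter_upwards [ae_all_iff.mpr fun k => ae_all_iff.mpr fun l => hentry k l] with ω hω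
    have h1 : ∀ k l, Tendsto (fun n => ‖outerMean (fun j => targetVector P η
      (η (Z j ω))) n k l - targetMatrix P η k l‖) atTop (𝓝 0) := fun k l =>
      tendsto_iff_norm_sub_tendsto_zero.mp (hω k l)
    simpa using tendsto_finsetSum (Finset.univ : Finset (Fin p)) fun k _ =>
      tendsto_finsetSum (Finset.univ : Finset (Fin p)) fun l _ => h1 k l
  have hm : ∀ n, AEStronglyMeasurable (fun ω => ∑ k, ∑ l, ‖outerMean (fun j => targetVector P η
      (η (Z j ω))) n k l - targetMatrix P η k l‖) μ := by
    intro n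
    refine (Finset.aemeasurable_fun_sum _ fun k _ => Finset.aemeasurable_fun_sum _ fun l _ =>
      ?_).aestronglyMeasurable
    simp only [outerMean, Matrix.of_apply]
    refine (((Finset.aemeasurable_fun_sum _ fun j _ =>
      (hφ k l).comp_aemeasurable (hZm j)).const_mul _).sub_const _).norm
  have hmeas := tendstoInMeasure_of_tendsto_ae hm hall (ENNReal.ofReal ε)
    (ENNReal.ofReal_pos.mpr hε)
  refine hmeas.congr fun n => ?_
  congr 1
  ext ω
  simp only [Set.mem_ofPred_eq]
  rw [edist_dist, ENNReal.ofReal_le_ofReal_iff dist_nonneg, Real.dist_0_eq_abs,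
    abs_of_nonneg (by positivity)]

/-- Under the null hypothesis the target matrix vanishes, so that all estimated eigenvalues are of
order `n⁻¹` and no ratio falls below the threshold. -/
lemma RegularityConditions.tendsto_measure_qHat_null (hreg : RegularityConditions P g Θ θs)
    {x : ℕ → Ω → EuclideanSpace ℝ (Fin p)} {y : ℕ → Ω → ℝ}
    (hindep : iIndepFun (fun j ω => (x j ω, y j ω)) μ)
    (hlaw : ∀ j, HasLaw (fun ω => (x j ω, y j ω)) P μ)
    {θhat : ℕ → Ω → EuclideanSpace ℝ (Fin d)}
    (hθ : ∀ n ω, IsLeastSquares g Θ (fun j => x j ω) (fun j => y j ω) n (θhat n ω))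
    {τ : ℝ} (hτ0 : 0 < τ) (hτ1 : τ < 1)
    {c₁ c₂ : ℕ → ℝ} (hc₁pos : ∀ᶠ n in atTop, 0 < c₁ n) (hc₂pos : ∀ᶠ n in atTop, 0 < c₂ n)
    (hnull : NullHypothesis P g Θ)
    (hc : Tendsto (fun n : ℕ => (n : ℝ) ^ 2 * c₁ n * c₂ n) atTop atTop) :
    Tendsto (fun n => μ {ω | qHat g (fun j => x j ω) (fun j => y j ω) n (θhat n ω)
      (c₁ n) (c₂ n) τ = 0}) atTop (𝓝 1) := by
  refine (hreg.bddAboveInProb_meanSqDev (hreg.nondegenerateMin_of_null hnull) hindep hlaw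
    hθ).tendsto_measure_one (N := fun _ => ∅) (by simp) fun K => ?_
  filter_upwards [eventually_lt_rRatio hτ0 hτ1 hc₁pos hc₂pos hc (2 * K)] with n hn
  refine ae_of_all _ fun ω hω _ => ?_
  set e := fun j => y j ω - g (x j ω) (θhat n ω) with he
  set m := fun j => targetVector P (residual g θs) (residual g θs (x j ω, y j ω)) with hm
  have hA := isHermitian_MHat (fun j => x j ω) e n
  have hnn := quadForm_MHat_nonneg (fun j => x j ω) e n
  have hdev := meanSqDev_nonneg (fun j => x j ω) e m n
  -- all target vectors vanish, so `m̂ₙ` itself is the deviation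
  have htop : sortedEigenvalue hA 1 ≤ 2 * meanSqDev (fun j => x j ω) e m n := by
    refine sortedEigenvalue_le hA (by positivity) ⊤ (by simp) fun v _ => ?_
    have h1 := quadForm_MHat_le (fun j => x j ω) e m n v
    have h2 : quadForm (outerMean m n) v = 0 := by
      simp [quadForm_outerMean, hm, targetVector_eq_zero_of_indepFun hreg.memLp_X hreg.mean_X
        (hreg.measurable_residual θs) (hreg.indepFun_of_null hnull).1]
    linarith
  refine tdrr_eq_zero fun j h1j _ => hn _ j (sortedEigenvalue_nonneg hA hnn)
    (fun k hk => sortedEigenvalue_succ_le hA hnn (h1j.trans hk)) ?_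
  have h3 := mul_le_mul_of_nonneg_left ((sortedEigenvalue_le_of_le hA hnn le_rfl h1j).trans htop)
    (Nat.cast_nonneg n : (0 : ℝ) ≤ n)
  linarith

/-- Under the alternative the first `q` estimated eigenvalues stay away from zero, while the others
are of order `n⁻¹`, so that the last ratio below the threshold is the one with index `q`. -/
lemma RegularityConditions.tendsto_measure_qHat_alternative
    (hreg : RegularityConditions P g Θ θs)
    {x : ℕ → Ω → EuclideanSpace ℝ (Fin p)} {y : ℕ → Ω → ℝ}
    (hindep : iIndepFun (fun j ω => (x j ω, y j ω)) μ)
    (hlaw : ∀ j, HasLaw (fun ω => (x j ω, y j ω)) P μ)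
    {θhat : ℕ → Ω → EuclideanSpace ℝ (Fin d)}
    (hθ : ∀ n ω, IsLeastSquares g Θ (fun j => x j ω) (fun j => y j ω) n (θhat n ω))
    {τ : ℝ} (hτ0 : 0 < τ) (hτ1 : τ < 1)
    {c₁ c₂ : ℕ → ℝ} (hc₁pos : ∀ᶠ n in atTop, 0 < c₁ n) (hc₂pos : ∀ᶠ n in atTop, 0 < c₂ n)
    (hc₁ : Tendsto c₁ atTop (𝓝 0)) (hc₂ : Tendsto c₂ atTop (𝓝 0))
    (halt : AlternativeHypothesis P g Θ) (hnd : NondegenerateMin P g Θ θs)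
    (hdr : IsDimensionReductionSubspace P (residual g θs) (centralSubspace P (residual g θs)))
    (hrank : indicativeDim P (residual g θs) ≤ (targetMatrix P (residual g θs)).rank)
    (hc : Tendsto (fun n : ℕ => (n : ℝ) * c₁ n * c₂ n) atTop atTop) :
    Tendsto (fun n => μ {ω | qHat g (fun j => x j ω) (fun j => y j ω) n (θhat n ω)
      (c₁ n) (c₂ n) τ = indicativeDim P (residual g θs) ∧
      0 < indicativeDim P (residual g θs)}) atTop (𝓝 1) := by
  have hη := hreg.measurable_residual θs
  have hX := hreg.memLp_X
  set q := indicativeDim P (residual g θs) with hq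
  set M := targetMatrix P (residual g θs) with hM
  have hq0 : 0 < q := Nat.pos_of_ne_zero fun h0 =>
    halt θs hreg.mem_Θ (indepFun_of_indicativeDim_eq_zero hη hdr h0)
  have hrk : M.rank = q := le_antisymm (rank_targetMatrix_le hX hη hreg.linearity hdr) hrank
  have hqp : q ≤ p := by
    rw [← hrk]
    exact M.rank_le_height
  obtain ⟨c, W, hc0, hWdim, hWc⟩ := exists_le_quadForm (isHermitian_targetMatrix)
    (quadForm_targetMatrix_nonneg hX hη)
  have hc2 : Tendsto (fun n : ℕ => (n : ℝ) ^ 2 * c₁ n * c₂ n) atTop atTop := by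
    refine tendsto_atTop_mono' _ ?_ hc
    filter_upwards [hc₁pos, hc₂pos, eventually_ge_atTop 1] with n h1 h2 h3
    have h4 : (1 : ℝ) ≤ n := by exact_mod_cast h3
    gcongr
    nlinarith
  have hker : ∀ᵐ ω ∂μ, ∀ j, ∀ v ∈ LinearMap.ker (Matrix.toEuclideanLin M), ∑ k,
      starRingEnd ℂ (v k) * targetVector P (residual g θs) (residual g θs (x j ω, y j ω)) k = 0 := by
    refine ae_all_iff.mpr fun j => ?_
    have h1 := ae_forall_mem_ker_sum_targetVector_eq_zero hX hη
    exact ae_of_ae_map (hlaw j).aemeasurable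
      ((hlaw j).map_eq.le.absolutelyContinuous.ae_le h1)
  -- three perturbations of the lower bound `c`: the law of large numbers costs `c / 4`, comparing
  -- the quadratic forms costs a factor `2`, and the mean square deviation costs at most `c / 8`
  refine (hreg.bddAboveInProb_meanSqDev hnd hindep hlaw hθ).tendsto_measure_one
    (tendsto_measure_outerMean_sub hX hη hindep hlaw (by positivity : 0 < c / 4)) fun K => ?_
  have hK : Tendsto (fun n : ℕ => K / (n : ℝ)) atTop (𝓝 0) := tendsto_const_div_atTop_nhds_zero_nat K
  filter_upwards [eventually_lt_rRatio hτ0 hτ1 hc₁pos hc₂pos hc2 (2 * K),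
    eventually_rRatio_le hτ0 hc₁pos hc₂pos hc₁ hc₂ hc2 (by positivity : 0 < c / 4) (2 * K),
    hK.eventually_lt_const (by positivity : 0 < c / 8), eventually_gt_atTop 0]
    with n hn hn' hKn hnpos
  filter_upwards [hker] with ω hω hU hN
  have hn1 : (0 : ℝ) < n := by exact_mod_cast hnpos
  set e := fun j => y j ω - g (x j ω) (θhat n ω) with he
  set m := fun j => targetVector P (residual g θs) (residual g θs (x j ω, y j ω)) with hm
  have hA := isHermitian_MHat (fun j => x j ω) e n
  have hnn := quadForm_MHat_nonneg (fun j => x j ω) e n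
  have hdev := meanSqDev_nonneg (fun j => x j ω) e m n
  have hdevle : meanSqDev (fun j => x j ω) e m n < c / 8 :=
    ((le_div_iff₀' hn1).mpr hU).trans_lt hKn
  have hclose : ∑ k, ∑ l, ‖outerMean m n k l - M k l‖ < c / 4 := not_le.mp hN
  have hlow : c / 4 ≤ sortedEigenvalue hA q := by
    refine le_sortedEigenvalue hA hq0 hqp W (by rw [hWdim, hrk]) fun v hv => ?_
    have h1 := hWc v hv
    have h2 := quadForm_le_add M (outerMean m n) v
    have h3 := quadForm_outerMean_le_MHat (fun j => x j ω) e m n v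
    have h4 := mul_le_mul_of_nonneg_right hclose.le (sq_nonneg ‖v‖)
    have h5 := mul_le_mul_of_nonneg_right hdevle.le (sq_nonneg ‖v‖)
    linarith
  have hup : sortedEigenvalue hA (q + 1) ≤ 2 * meanSqDev (fun j => x j ω) e m n := by
    refine sortedEigenvalue_le hA (by positivity)
      (LinearMap.ker (Matrix.toEuclideanLin M)) ?_ fun v hv => ?_
    · have h1 := finrank_ker_add_rank M
      omega
    · have h1 := quadForm_MHat_le (fun j => x j ω) e m n v
      have h2 : quadForm (outerMean m n) v = 0 := by
        rw [quadForm_outerMean]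
        simp [hm, hω _ v hv]
      linarith
  have hsmall : ∀ j, q < j → (n : ℝ) * sortedEigenvalue hA j ≤ 2 * K := by
    intro j hj
    have h3 := mul_le_mul_of_nonneg_left
      ((sortedEigenvalue_le_of_le hA hnn (by omega) hj).trans hup) hn1.le
    linarith
  refine ⟨tdrr_eq hq0 hqp (hn' _ q (sortedEigenvalue_nonneg hA hnn) hlow (hsmall _ (by omega)))
    fun j hj _ => hn _ j (sortedEigenvalue_nonneg hA hnn)
      (fun k hk => sortedEigenvalue_succ_le hA hnn (by omega)) (hsmall j hj), hq0⟩

end Consistency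

end HybridTest

end

theorem mainTheorem4 {p d : ℕ}
    (P : Measure (EuclideanSpace ℝ (Fin p) × ℝ)) [IsProbabilityMeasure P]
    (g : EuclideanSpace ℝ (Fin p) → EuclideanSpace ℝ (Fin d) → ℝ)
    (Θ : Set (EuclideanSpace ℝ (Fin d))) (θs : EuclideanSpace ℝ (Fin d))
    (hreg : HybridTest.RegularityConditions P g Θ θs)
    {Ω : Type*} [MeasurableSpace Ω] (μ : Measure Ω) [IsProbabilityMeasure μ]
    (x : ℕ → Ω → EuclideanSpace ℝ (Fin p)) (y : ℕ → Ω → ℝ)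
    (hindep : iIndepFun (fun j ω => (x j ω, y j ω)) μ)
    (hlaw : ∀ j, HasLaw (fun ω => (x j ω, y j ω)) P μ)
    (θhat : ℕ → Ω → EuclideanSpace ℝ (Fin d)) (hθmeas : ∀ n, Measurable (θhat n))
    (hθ : ∀ n ω, HybridTest.IsLeastSquares g Θ (fun j => x j ω) (fun j => y j ω) n (θhat n ω))
    (τ : ℝ) (hτ0 : 0 < τ) (hτ1 : τ < 1)
    (c₁ c₂ : ℕ → ℝ) (hc₁pos : ∀ᶠ n in atTop, 0 < c₁ n) (hc₂pos : ∀ᶠ n in atTop, 0 < c₂ n)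
    (hc₁ : Tendsto c₁ atTop (𝓝 0)) (hc₂ : Tendsto c₂ atTop (𝓝 0)) :
    (HybridTest.NullHypothesis P g Θ →
      Tendsto (fun n : ℕ => (n : ℝ) ^ 2 * c₁ n * c₂ n) atTop atTop →
      Tendsto (fun n => μ {ω | HybridTest.qHat g (fun j => x j ω) (fun j => y j ω) n (θhat n ω)
        (c₁ n) (c₂ n) τ = 0}) atTop (𝓝 1)) ∧
    (HybridTest.AlternativeHypothesis P g Θ →
      HybridTest.NondegenerateMin P g Θ θs →
      HybridTest.IsDimensionReductionSubspace P (HybridTest.residual g θs)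
        (HybridTest.centralSubspace P (HybridTest.residual g θs)) →
      HybridTest.indicativeDim P (HybridTest.residual g θs)
        ≤ (HybridTest.targetMatrix P (HybridTest.residual g θs)).rank →
      Tendsto (fun n : ℕ => (n : ℝ) * c₁ n * c₂ n) atTop atTop →
      Tendsto (fun n => μ {ω | HybridTest.qHat g (fun j => x j ω) (fun j => y j ω) n (θhat n ω)
        (c₁ n) (c₂ n) τ = HybridTest.indicativeDim P (HybridTest.residual g θs) ∧
        0 < HybridTest.indicativeDim P (HybridTest.residual g θs)}) atTop (𝓝 1)) :=
  ⟨hreg.tendsto_measure_qHat_null hindep hlaw hθ hτ0 hτ1 hc₁pos hc₂pos,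
    hreg.tendsto_measure_qHat_alternative hindep hlaw hθ hτ0 hτ1 hc₁pos hc₂pos hc₁ hc₂⟩
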